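/- Let $(X,d)$ be a metric space with positive complete Borel measures $\mu$ and $\nu$ (completions of measures on the Borel $\sigma$-algebra), and let $E\subset X$ be $\nu$-measurable and totally bounded with $\nu(E)>0$. Let $1\le p<q<\infty$, $\alpha>0$, $\lambda\ge1$ and $r_0>0$. Write $B(x,r)=\{y: d(x,y)<r\}$, $\lambda B(x,r)=B(x,\lambda r)$ and $u_{B}=\mu(B)^{-1}\int_B u\,d\mu$. Assume that there are $C,\delta>0$ such that for all $x\in E$ and $0<r'<r\le r_0$, \[ 0<\mu(B(x,2r))\le C\mu(B(x,r))<\infty,\qquad 0<\nu(B(x,2r))\le C\nu(B(x,r))<\infty,\qquad \frac{\nu(B(x,r'))}{\nu(B(x,r))}\le C\Bigl(\frac{r'}{r}\Bigr)^{\delta}. \] Let $P^{\alpha,p}_{\lambda,E}(X,\mu)$ be the set of all $u$ that are $\mu$-integrable on every ball of $X$ and for which there is $g\in L^p(X,\mu)$ such that, for all balls $B=B(x,r)$ with $x\in E$ and $0<r\le r_0$, \[ \frac1{\mu(B)}\int_B|u-u_B|\,d\mu\le r^\alpha\Bigl(\frac1{\mu(\lambda B)}\int_{\lambda B}|g|^p\,d\mu\Bigr)^{1/p}.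 \tag{1} \] Let $Y\subset P^{\alpha,p}_{\lambda,E}(X,\mu)$ be any subset, and for each $u\in Y$ let $G(u)\in L^p(X,\mu)$ be a function for which (1) holds with $g=G(u)$. For $u\in Y$ let \[ \bar u(x)=\limsup_{r\to0}\frac1{\mu(B(x,r))}\int_{B(x,r)}u\,d\mu ,\qquad x\in E. \] Equip $Y$ with one of the norms \[ \|u\|_Y=\|\bar u\|_{L^1(E,\nu)}+\|G(u)\|_{L^p(X,\mu)}\quad\text{or}\quad \|u\|_Y=\|u\|_{L^1(X,\mu)}+\|G(u)\|_{L^p(X,\mu)} . \] For $s\ge 1$, say that $Y$ embeds boundedly into $L^{s}(E,\nu)$ if $\bar u\in L^{s}(E,\nu)$ for all $u\in Y$ and there is a constant $C$ with $\|\bar u\|_{L^{s}(E,\nu)}\le C\|u\|_Y$ for all $u\in Y$; say that $Y$ embeds compactly into $L^{s}(E,\nu)$ if $\bar u\in L^{s}(E,\nu)$ for all $u\in Y$ and, for every sequence $(u_n)$ in $Y$ with $\sup_n\|u_n\|_Y<\infty$, the sequence $(\bar u_n)$ has a subsequence converging in $L^{s}(E,\nu)$. For $r>0$ let \[ \Theta_{q,\lambda}(r)=\sup_{0<\rho\le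 r}\ \sup_{x\in E}\frac{\rho^\alpha\,\nu(B(x,\rho))^{1/q}}{\mu(B(x,\lambda\rho))^{1/p}} . \] Then the following hold. (i) If $\Theta_{q,\lambda}(r_0)<\infty$, then $Y$ embeds compactly into $L^{q'}(E,\nu)$ for all $1\le q'<q$. (ii) Assume that the functions in $Y$ satisfy the truncation property: there is a constant $C$ such that for all $u\in Y$, all real $l<k$ and all balls $B=B(x,r)$ with $x\in E$ and $0<r\le r_0$, inequality (1) with $r^\alpha$ replaced by $Cr^\alpha$ holds when $u$ and $g$ are replaced by $\max\{l,\min\{u,k\}\}$ and $G(u)\chi_{\{l<u<k\}}$. Then $Y$ embeds boundedly into $L^q(E,\nu)$ if $\Theta_{q,\lambda}(r_0)<\infty$, and compactly if $\Theta_{q,\lambda}(r)\to0$ as $r\to0$. -/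

import Mathlib

open MeasureTheory Metric Set Filter Topology
open scoped ENNReal NNReal

noncomputable section

namespace PoincareEmbedding

variable {X : Type*} [MetricSpace X] [MeasurableSpace X]

/-- The conditions on balls centred in `E` with radius at most `r₀`: there are constants
`C, δ > 0` such that for all `x ∈ E` and `0 < r' < r ≤ r₀`,
`0 < μ(B(x,2r)) ≤ C μ(B(x,r)) < ∞`, the same for `ν`, and
`ν(B(x,r')) / ν(B(x,r)) ≤ C (r'/r)^δ`. -/
def LocallyDoublingOn (μ ν : Measure X) (E : Set X) (r₀ : ℝ) : Prop :=
  ∃ C δ : ℝ, 0 < C ∧ 0 < δ ∧ ∀ x ∈ E, ∀ r : ℝ, 0 < r → r ≤ r₀ →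
    (0 < μ (ball x (2 * r)) ∧ μ (ball x (2 * r)) ≤ ENNReal.ofReal C * μ (ball x r) ∧
      ENNReal.ofReal C * μ (ball x r) < ⊤) ∧
    (0 < ν (ball x (2 * r)) ∧ ν (ball x (2 * r)) ≤ ENNReal.ofReal C * ν (ball x r) ∧
      ENNReal.ofReal C * ν (ball x r) < ⊤) ∧
    ∀ r' : ℝ, 0 < r' → r' < r →
      ν (ball x r') / ν (ball x r) ≤ ENNReal.ofReal (C * (r' / r) ^ δ)

/-- `u ∈ L¹_loc(X, μ)`: `u` is integrable on every ball of `X`. -/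
def IntegrableOnBalls (μ : Measure X) (u : X → ℝ) : Prop :=
  ∀ (x : X) (r : ℝ), IntegrableOn u (ball x r) μ

/-- The `p`-Poincaré inequality with constant `C`, exponent `α` and dilation `τ` for the pair
`(u, g)` on all balls `B = B(x,r)` centred in `E` with radius at most `r₀`:
`⨍_B |u - u_B| dμ ≤ C r^α (⨍_{τB} |g|^p dμ)^{1/p}`. -/
def PoincareIneqOn (μ : Measure X) (E : Set X) (r₀ α p τ C : ℝ) (u g : X → ℝ) : Prop :=
  ∀ x ∈ E, ∀ r : ℝ, 0 < r → r ≤ r₀ →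
    ⨍⁻ y in ball x r, ‖u y - ⨍ z in ball x r, u z ∂μ‖ₑ ∂μ
      ≤ ENNReal.ofReal (C * r ^ α) * (⨍⁻ y in ball x (τ * r), ‖g y‖ₑ ^ p ∂μ) ^ (1 / p)

/-- `g ∈ L^p(X, μ)` is admissible for `u` in the definition of the `E`-restricted Poincaré
Sobolev space. -/
def IsPoincareGradient (μ : Measure X) (E : Set X) (r₀ α p τ : ℝ) (u g : X → ℝ) : Prop :=
  MemLp g (ENNReal.ofReal p) μ ∧ PoincareIneqOn μ E r₀ α p τ 1 u g

/-- The `E`-restricted Poincaré Sobolev space `P^{α,p}_{τ,E}(X, μ)`. -/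
def poincareSobolev (μ : Measure X) (E : Set X) (r₀ α p τ : ℝ) : Set (X → ℝ) :=
  {u | IntegrableOnBalls μ u ∧ ∃ g : X → ℝ, IsPoincareGradient μ E r₀ α p τ u g}

/-- The truncation `u_{l,k} = max {l, min {u, k}}`. -/
def truncate (l k : ℝ) (u : X → ℝ) : X → ℝ := fun x => max l (min (u x) k)

/-- The truncation property for the pairs `(u, G u)`, `u ∈ Y`: the Poincaré inequality holds, with
a constant independent of `u`, `l` and `k`, for all pairs `(u_{l,k}, G(u) χ_{l < u < k})`. -/
def TruncationProperty (μ : Measure X) (E : Set X) (r₀ α p τ : ℝ) (Y : Set (X → ℝ))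
    (G : (X → ℝ) → (X → ℝ)) : Prop :=
  ∃ C : ℝ, 0 < C ∧ ∀ u ∈ Y, ∀ l k : ℝ, l < k →
    PoincareIneqOn μ E r₀ α p τ C (truncate l k u) ({x | l < u x ∧ u x < k}.indicator (G u))

/-- The local Poincaré constant
`Θ_{q,τ}(r) = sup_{0 < ρ ≤ r} sup_{x ∈ E} ρ^α ν(B(x,ρ))^{1/q} / μ(B(x,τρ))^{1/p}`. -/
def Theta (μ ν : Measure X) (E : Set X) (α p q τ r : ℝ) : ℝ≥0∞ :=
  ⨆ ρ ∈ Ioc 0 r, ⨆ x ∈ E,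
    ENNReal.ofReal (ρ ^ α) * ν (ball x ρ) ^ (1 / q) / μ (ball x (τ * ρ)) ^ (1 / p)

/-- The representative `ū(x) = limsup_{r → 0} ⨍_{B(x,r)} u dμ`, with values in `[-∞, ∞]`. -/
def limsupRep (μ : Measure X) (u : X → ℝ) (x : X) : EReal :=
  limsup (fun r : ℝ => ((⨍ y in ball x r, u y ∂μ : ℝ) : EReal)) (𝓝[>] (0 : ℝ))

/-- The norm of `L^q(E, ν)` for functions with values in `[-∞, ∞]`. -/
def extLpNorm (ν : Measure X) (E : Set X) (q : ℝ) (f : X → EReal) : ℝ≥0∞ :=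
  (∫⁻ x in E, (f x).abs ^ q ∂ν) ^ (1 / q)

/-- Membership in `L^q(E, ν)` for functions with values in `[-∞, ∞]`. -/
def ExtMemLp (ν : Measure X) (E : Set X) (q : ℝ) (f : X → EReal) : Prop :=
  AEMeasurable f (ν.restrict E) ∧ extLpNorm ν E q f < ⊤

/-- The norm `‖ū‖_{L¹(E,ν)} + ‖G(u)‖_{L^p(X,μ)}`. -/
def targetNorm (μ ν : Measure X) (E : Set X) (p : ℝ) (G : (X → ℝ) → (X → ℝ)) (u : X → ℝ) :
    ℝ≥0∞ :=
  extLpNorm ν E 1 (limsupRep μ u) + eLpNorm (G u) (ENNReal.ofReal p) μ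

/-- The norm `‖u‖_{L¹(X,μ)} + ‖G(u)‖_{L^p(X,μ)}`. -/
def domainNorm (μ : Measure X) (p : ℝ) (G : (X → ℝ) → (X → ℝ)) (u : X → ℝ) : ℝ≥0∞ :=
  eLpNorm u 1 μ + eLpNorm (G u) (ENNReal.ofReal p) μ

/-- `u ↦ ū` maps `Y`, with the norm `N`, boundedly into `L^q(E, ν)`. -/
def EmbedsBoundedly (μ ν : Measure X) (E : Set X) (Y : Set (X → ℝ)) (N : (X → ℝ) → ℝ≥0∞)
    (q : ℝ) : Prop :=
  (∀ u ∈ Y, ExtMemLp ν E q (limsupRep μ u)) ∧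
    ∃ C : ℝ, 0 < C ∧ ∀ u ∈ Y, extLpNorm ν E q (limsupRep μ u) ≤ ENNReal.ofReal C * N u

/-- `u ↦ ū` maps `Y`, with the norm `N`, compactly into `L^q(E, ν)`: the image of every
`N`-bounded sequence in `Y` has a subsequence converging in `L^q(E, ν)`. -/
def EmbedsCompactly (μ ν : Measure X) (E : Set X) (Y : Set (X → ℝ)) (N : (X → ℝ) → ℝ≥0∞)
    (q : ℝ) : Prop :=
  (∀ u ∈ Y, ExtMemLp ν E q (limsupRep μ u)) ∧
    ∀ u : ℕ → X → ℝ, (∀ n, u n ∈ Y) → (∃ M : ℝ, ∀ n, N (u n) ≤ ENNReal.ofReal M) →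
      ∃ φ : ℕ → ℕ, StrictMono φ ∧ ∃ v : X → ℝ, MemLp v (ENNReal.ofReal q) (ν.restrict E) ∧
        Tendsto (fun n => extLpNorm ν E q (fun x => limsupRep μ (u (φ n)) x - (v x : EReal)))
          atTop (𝓝 0)

end PoincareEmbedding

end

/-! Everything rests on one pointwise estimate. At a Lebesgue point `x ∈ E` of `u`, telescoping the
averages of `u` over the dyadic balls `B_i = B(x, R/2^i)` bounds the difference between the Lebesgue
value and the average over a nearby ball `B(y, R/2)` by the sum of the mean oscillations. The
Poincaré inequality and the definition of `Theta` bound this by a constant times `Theta R` times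
`radialSum`, the sum of `ν(B_i)^(-1/q) γ(τB_i)^(1/p)`, where `γ = |g|^p μ`
(`enorm_sub_average_le_radialSum`).

The radial sum is of weak type `q`. If `γ(τB_i) ≤ m ν(B_i)` for all `i`, the geometric decay of
`ν(B_i)` and `p < q` bound the sum by a multiple of `m^(1/q) γ(X)^(1/p-1/q)`. A large sum therefore
forces a ball with `γ(τB_i) > m ν(B_i)`, and a Vitali covering estimates the set of such centres
(`BallConditions.exists_radialWeakType`). Hence `ν`-almost every point of `E` is a Lebesgue point,
and the deviation of `ū` from the averages has a weak-type bound with constant proportional to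
`Theta R` (`measure_deviationSet_le`).

Compactness below the weak-type exponent: by total boundedness finitely many balls of radius `R/2`
cover `E`, the averages over them form a bounded sequence of vectors, and the deviations are small
in weak `L^s` when `Theta R` is small. Integrating the weak bound gives finite nets in `L^q` for `q
< s` (`exists_finite_net`). For part (i) the weak-type exponent is lowered slightly below `q`, which
makes `Theta` vanish at zero (`tendsto_Theta_of_lt`).

For the exponent `q` itself Maz'ya's truncation method is used: the weak-type bounds for the
truncations of `u` between consecutive dyadic levels involve energies on disjoint sets, and since
`q/p ≥ 1` they add up to a strong bound for the tail of `ū` (`lintegral_tail_le`). This gives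
boundedness; if `Theta` tends to zero, the tails are uniformly small and finite nets in `L^1` become
finite nets in `L^q`. -/

namespace PoincareEmbedding

/-! ### Averages of extended nonnegative functions. -/

section Averages

variable {X : Type*} [MeasurableSpace X] {μ : Measure X}

theorem enorm_setAverage_sub_le {s : Set X} {u : X → ℝ} (h0 : μ s ≠ 0) (hs : μ s ≠ ⊤)
    (hu : IntegrableOn u s μ) (c : ℝ) :
    ‖(⨍ y in s, u y ∂μ) - c‖ₑ ≤ ⨍⁻ y in s, ‖u y - c‖ₑ ∂μ := by
  have huniv : (μ.restrict s) univ ≠ 0 := by simpa using h0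
  have hfin : (μ.restrict s) univ ≠ ⊤ := by simpa using hs
  have : IsFiniteMeasure (μ.restrict s) := ⟨hfin.lt_top⟩
  have : NeZero (μ.restrict s) := ⟨fun h => huniv (by rw [h]; simp)⟩
  have hint : Integrable u (((μ.restrict s) univ)⁻¹ • μ.restrict s) :=
    hu.smul_measure (by simpa using h0)
  have e : (⨍ y in s, u y ∂μ) - c = ⨍ y in s, (u y - c) ∂μ := by
    have hr : μ.real s ≠ 0 := ENNReal.toReal_ne_zero.2 ⟨h0, hs⟩
    rw [average_eq', average_eq', integral_sub hint (integrable_const c)]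
    simp [← measureReal_def, hr]
  rw [e, average_eq', laverage_eq']
  exact enorm_integral_le_lintegral_enorm _

theorem setLAverage_le_mul {s t : Set X} (hst : s ⊆ t) {K : ℝ≥0} (h0 : μ s ≠ 0) (ht : μ t ≠ ⊤)
    (hK : μ t ≤ K * μ s) (f : X → ℝ≥0∞) :
    ⨍⁻ y in s, f y ∂μ ≤ K * ⨍⁻ y in t, f y ∂μ := by
  have hs : μ s ≠ ⊤ := ne_top_of_le_ne_top ht (measure_mono hst)
  rw [setLAverage_eq, setLAverage_eq, div_eq_mul_inv, div_eq_mul_inv, mul_comm,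
    mul_comm _ (μ t)⁻¹, ← mul_assoc]
  refine mul_le_mul' ?_ (lintegral_mono_set hst)
  have ht0 : μ t ≠ 0 := fun h => h0 (measure_mono_null hst h)
  calc (μ s)⁻¹ = (μ s)⁻¹ * (μ t * (μ t)⁻¹) := by rw [ENNReal.mul_inv_cancel ht0 ht, mul_one]
    _ ≤ (μ s)⁻¹ * ((K * μ s) * (μ t)⁻¹) := by gcongr
    _ = ((μ s)⁻¹ * μ s) * (K * (μ t)⁻¹) := by ring
    _ = K * (μ t)⁻¹ := by rw [ENNReal.inv_mul_cancel h0 hs, one_mul]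

theorem setLAverage_const_add {s : Set X} (h0 : μ s ≠ 0) (hs : μ s ≠ ⊤) (f : X → ℝ≥0∞)
    (c : ℝ≥0∞) : ⨍⁻ y in s, (f y + c) ∂μ = (⨍⁻ y in s, f y ∂μ) + c := by
  rw [setLAverage_eq, setLAverage_eq, lintegral_add_right _ measurable_const,
    setLIntegral_const, ENNReal.add_div, ENNReal.mul_div_cancel_right h0 hs]

theorem setLAverage_mono {s : Set X} {f g : X → ℝ≥0∞} (h : ∀ y, f y ≤ g y) :
    ⨍⁻ y in s, f y ∂μ ≤ ⨍⁻ y in s, g y ∂μ := by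
  rw [setLAverage_eq, setLAverage_eq]
  gcongr
  exact h _

theorem setLAverage_enorm_sub_le {s : Set X} (h0 : μ s ≠ 0) (hs : μ s ≠ ⊤) (u : X → ℝ)
    (a b : ℝ) : ⨍⁻ y in s, ‖u y - a‖ₑ ∂μ ≤ (⨍⁻ y in s, ‖u y - b‖ₑ ∂μ) + ‖b - a‖ₑ := by
  rw [← setLAverage_const_add h0 hs]
  refine setLAverage_mono fun y => ?_
  calc ‖u y - a‖ₑ = ‖(u y - b) + (b - a)‖ₑ := by congr 1; ring
    _ ≤ _ := enorm_add_le _ _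

end Averages

/-! ### Measurability of ball measures and averages in the centre. -/

section MeasurableBalls

variable {X : Type*} [PseudoMetricSpace X] [MeasurableSpace X]

/-- An open ball is the increasing union of the concentric balls of radius `r - 1/(n+1)`, and each
of these lies in every `r`-ball with sufficiently close centre. -/
theorem lowerSemicontinuous_measure_ball (γ : Measure X) (r : ℝ) :
    LowerSemicontinuous fun x => γ (ball x r) := by
  intro x c hc
  have hU : ball x r = ⋃ n : ℕ, ball x (r - 1 / ((n : ℝ) + 1)) := by
    ext y
    simp only [mem_ball, mem_iUnion]
    constructor
    · intro h
      obtain ⟨n, hn⟩ := exists_nat_one_div_lt (sub_pos.2 h)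
      exact ⟨n, by linarith⟩
    · rintro ⟨n, hn⟩
      have : (0 : ℝ) < 1 / ((n : ℝ) + 1) := by positivity
      linarith
  have hmono : Monotone fun n : ℕ => ball x (r - 1 / ((n : ℝ) + 1)) := by
    intro m n hmn
    refine ball_subset_ball ?_
    have : 1 / ((n : ℝ) + 1) ≤ 1 / ((m : ℝ) + 1) := Nat.one_div_le_one_div hmn
    linarith
  simp only at hc
  rw [hU, hmono.measure_iUnion] at hc
  obtain ⟨n, hn⟩ := lt_iSup_iff.1 hc
  have hpos : (0 : ℝ) < 1 / ((n : ℝ) + 1) := by positivity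
  filter_upwards [ball_mem_nhds x hpos] with z hz
  refine hn.trans_le (measure_mono fun y hy => ?_)
  rw [mem_ball] at *
  have := dist_triangle_right y z x
  have h2 := dist_triangle y x z
  rw [dist_comm x z] at h2
  linarith

variable [OpensMeasurableSpace X]

theorem measurable_measure_ball (γ : Measure X) (r : ℝ) : Measurable fun x => γ (ball x r) :=
  (lowerSemicontinuous_measure_ball γ r).measurable

/-- The integral over a ball is the difference of the ball's measures with densities `u⁺` and `u⁻`,
so the measurability of ball measures suffices and no separability of `X` is involved. -/
theorem measurable_setAverage_ball {μ : Measure X} {u : X → ℝ}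
    {r : ℝ} (hu : ∀ x, IntegrableOn u (ball x r) μ) :
    Measurable fun x => ⨍ y in ball x r, u y ∂μ := by
  have h : (fun x => ⨍ y in ball x r, u y ∂μ) = fun x => (μ (ball x r)).toReal⁻¹ *
      (((μ.withDensity fun y => ENNReal.ofReal (u y)) (ball x r)).toReal -
        ((μ.withDensity fun y => ENNReal.ofReal (-u y)) (ball x r)).toReal) := by
    funext x
    rw [setAverage_eq, integral_eq_lintegral_pos_part_sub_lintegral_neg_part (hu x),
      withDensity_apply _ measurableSet_ball, withDensity_apply _ measurableSet_ball]
    rfl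
  rw [h]
  exact (measurable_measure_ball μ r).ennreal_toReal.inv.mul
    ((measurable_measure_ball _ r).ennreal_toReal.sub
      (measurable_measure_ball _ r).ennreal_toReal)

end MeasurableBalls

/-! ### From weak-type to strong-type bounds. -/

section WeakType

variable {X : Type*} [MeasurableSpace X]

/-- Dyadic layer-cake bound. -/
theorem lintegral_rpow_le_tsum (m : Measure X) {f : X → ℝ≥0∞} (hf : AEMeasurable f m) {q : ℝ}
    (hq : 0 < q) {L : ℝ≥0∞} (hL : L ≠ 0) (hL' : L ≠ ⊤) :
    ∫⁻ x in {x | L < f x}, f x ^ q ∂m ≤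
      ∑' k : ℕ, (2 ^ (k + 1) * L) ^ q * m {x | 2 ^ k * L < f x} := by
  have hset : ∀ k : ℕ, NullMeasurableSet {x | 2 ^ k * L < f x} m := fun k =>
    nullMeasurableSet_lt aemeasurable_const hf
  have hpt : ∀ x ∈ {x | L < f x}, f x ^ q ≤
      ∑' k : ℕ, {x | 2 ^ k * L < f x}.indicator (fun _ => (2 ^ (k + 1) * L) ^ q) x := by
    intro x hx
    by_cases htop : f x = ⊤
    -- Where `f` is infinite, all indicators equal one and every term is at least `L ^ q`, so the
    -- series diverges.
    · have : ∀ k : ℕ, L ^ q ≤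
          {x | 2 ^ k * L < f x}.indicator (fun _ => (2 ^ (k + 1) * L) ^ q) x := by
        intro k
        rw [indicator_of_mem]
        · gcongr
          refine le_mul_of_one_le_left zero_le ?_
          exact one_le_pow₀ (by norm_num)
        · simp only [mem_ofPred_eq, htop]
          exact ENNReal.mul_lt_top (by finiteness) hL'.lt_top
      have h2 : ∑' k : ℕ, L ^ q = ⊤ :=
        ENNReal.tsum_const_eq_top_of_ne_zero (by
          simp [ENNReal.rpow_eq_zero_iff, hL, hL'])
      refine le_top.trans (h2.symm.le.trans (ENNReal.tsum_le_tsum this))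
    · have hx' : L < f x := hx
      obtain ⟨k, hk1, hk2⟩ : ∃ k : ℕ, 2 ^ k * L < f x ∧ f x ≤ 2 ^ (k + 1) * L := by
        have hex : ∃ n : ℕ, f x ≤ 2 ^ n * L := by
          have := ENNReal.tendsto_pow_atTop_nhds_top_iff.2 (by norm_num : (1 : ℝ≥0∞) < 2)
          have h3 := (ENNReal.tendsto_nhds_top_iff_nnreal.1 this) ((f x / L).toNNReal)
          obtain ⟨n, hn⟩ := h3.exists
          refine ⟨n, ?_⟩
          rw [ENNReal.coe_toNNReal (ENNReal.div_lt_top htop hL).ne] at hn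
          exact (ENNReal.div_le_iff hL hL').1 hn.le
        classical
        have hn0 : Nat.find hex ≠ 0 := by
          intro h0
          have := Nat.find_spec hex
          rw [h0, pow_zero, one_mul] at this
          exact absurd hx' (not_lt.2 this)
        obtain ⟨k, hk⟩ := Nat.exists_eq_succ_of_ne_zero hn0
        refine ⟨k, ?_, ?_⟩
        · have := Nat.find_min hex (m := k) (by omega)
          exact not_le.1 this
        · have := Nat.find_spec hex
          rwa [hk] at this
      refine le_trans ?_ (ENNReal.le_tsum k)
      rw [indicator_of_mem (by exact hk1)]
      gcongr
  calc ∫⁻ x in {x | L < f x}, f x ^ q ∂m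
      ≤ ∫⁻ x in {x | L < f x}, ∑' k : ℕ,
          {x | 2 ^ k * L < f x}.indicator (fun _ => (2 ^ (k + 1) * L) ^ q) x ∂m := by
        have hm : NullMeasurableSet {x | L < f x} m := nullMeasurableSet_lt aemeasurable_const hf
        refine lintegral_mono_ae ?_
        filter_upwards [ae_restrict_mem₀ hm] with x hx
        exact hpt x hx
    _ ≤ ∫⁻ x, ∑' k : ℕ,
          {x | 2 ^ k * L < f x}.indicator (fun _ => (2 ^ (k + 1) * L) ^ q) x ∂m :=
        setLIntegral_le_lintegral _ _
    _ = ∑' k : ℕ, (2 ^ (k + 1) * L) ^ q * m {x | 2 ^ k * L < f x} := by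
        rw [lintegral_tsum]
        · congr 1
          funext k
          rw [lintegral_indicator_const₀ (hset k)]
        · intro k
          exact aemeasurable_const.indicator₀ (hset k)

theorem lintegral_rpow_le_add (m : Measure X) {f : X → ℝ≥0∞} (hf : AEMeasurable f m) {q : ℝ}
    (hq : 0 ≤ q) (L : ℝ≥0∞) :
    ∫⁻ x, f x ^ q ∂m ≤ L ^ q * m univ + ∫⁻ x in {x | L < f x}, f x ^ q ∂m := by
  have hm : NullMeasurableSet {x | L < f x} m := nullMeasurableSet_lt aemeasurable_const hf
  rw [← setLIntegral_univ, ← setLIntegral_const, ← lintegral_indicator₀ hm,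
    setLIntegral_univ, setLIntegral_univ, ← lintegral_add_left measurable_const]
  refine lintegral_mono fun x => ?_
  by_cases hx : x ∈ {x | L < f x}
  · rw [indicator_of_mem hx]
    exact le_add_self
  · refine le_trans ?_ le_self_add
    gcongr
    simpa using hx

/-- A weak-type bound of exponent `s` for levels above `L` bounds the strong norms of lower
exponent. -/
theorem lintegral_rpow_le_of_weak (q s : ℝ) (hq : 0 < q) (hqs : q < s) :
    ∃ C : ℝ≥0, ∀ (m : Measure X) (f : X → ℝ≥0∞), AEMeasurable f m → ∀ (L B : ℝ≥0∞), L ≠ 0 →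
      L ≠ ⊤ → (∀ t, L ≤ t → t ≠ ⊤ → m {x | t < f x} * t ^ s ≤ B * L ^ s) →
      ∫⁻ x, f x ^ q ∂m ≤ L ^ q * (m univ + C * B) := by
  have hlt : (2 : ℝ≥0) ^ (q - s) < 1 :=
    NNReal.rpow_lt_one_of_one_lt_of_neg (by norm_num) (by linarith)
  have hsum : Summable fun k : ℕ => ((2 : ℝ≥0) ^ (q - s)) ^ k := NNReal.summable_geometric hlt
  refine ⟨2 ^ q * ∑' k : ℕ, ((2 : ℝ≥0) ^ (q - s)) ^ k, fun m f hf L B hL hL' h => ?_⟩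
  refine (lintegral_rpow_le_add m hf hq.le L).trans ?_
  rw [mul_add]
  gcongr
  refine (lintegral_rpow_le_tsum m hf hq hL hL').trans ?_
  rw [ENNReal.coe_mul, ENNReal.coe_tsum hsum, mul_assoc, mul_comm _ B, ← mul_assoc, ← mul_assoc,
    ← ENNReal.tsum_mul_left]
  refine ENNReal.tsum_le_tsum fun k => ?_
  have h2k : (2 : ℝ≥0∞) ^ k ≠ ⊤ := by finiteness
  have h2k0 : (2 : ℝ≥0∞) ^ k ≠ 0 := by positivity
  have hk := h (2 ^ k * L) (le_mul_of_one_le_left zero_le (one_le_pow₀ (by norm_num)))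
    (ENNReal.mul_ne_top h2k hL')
  rw [ENNReal.mul_rpow_of_nonneg _ _ (hq.trans hqs).le, ← mul_assoc] at hk
  have hLs0 : L ^ s ≠ 0 := by simp [ENNReal.rpow_eq_zero_iff, hL, hL']
  have hLs : L ^ s ≠ ⊤ := ENNReal.rpow_ne_top_of_nonneg (hq.trans hqs).le hL'
  have hk' : m {x | 2 ^ k * L < f x} * (2 ^ k) ^ s ≤ B :=
    (ENNReal.mul_le_mul_iff_left hLs0 hLs).1 hk
  -- The weak bound absorbs the `s`-th power of the level; the remaining factor `2^(k(q-s))` is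
  -- summable because `q < s`.
  have e : ((2 ^ k : ℝ≥0∞)) ^ q = (2 ^ k : ℝ≥0∞) ^ s * ((2 : ℝ≥0∞) ^ (q - s)) ^ k := by
    rw [← ENNReal.rpow_natCast, ← ENNReal.rpow_natCast, ← ENNReal.rpow_mul, ← ENNReal.rpow_mul,
      ← ENNReal.rpow_mul, ← ENNReal.rpow_add _ _ (by norm_num) (by norm_num)]
    congr 1
    ring
  have e2 : (((2 : ℝ≥0) ^ (q - s)) ^ k : ℝ≥0) = ((2 : ℝ≥0∞) ^ (q - s)) ^ k := by
    rw [ENNReal.coe_pow, ENNReal.coe_rpow_of_ne_zero (by norm_num)]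
    norm_num
  have e3 : (((2 : ℝ≥0) ^ q : ℝ≥0) : ℝ≥0∞) = 2 ^ q := by
    rw [ENNReal.coe_rpow_of_ne_zero (by norm_num)]
    norm_num
  rw [e2, e3, pow_succ, mul_comm _ (2 : ℝ≥0∞), mul_assoc, ENNReal.mul_rpow_of_nonneg _ _ hq.le,
    ENNReal.mul_rpow_of_nonneg _ _ hq.le, e]
  calc 2 ^ q * ((2 ^ k) ^ s * (2 ^ (q - s)) ^ k * L ^ q) * m {x | 2 ^ k * L < f x}
      = (m {x | 2 ^ k * L < f x} * (2 ^ k) ^ s) * (L ^ q * 2 ^ q * (2 ^ (q - s)) ^ k) := by ring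
    _ ≤ B * (L ^ q * 2 ^ q * (2 ^ (q - s)) ^ k) := by gcongr
    _ = _ := by ring

end WeakType

/-! ### Geometric sums. -/

section Sums

/-- Let `k` be the first index with `y k ≤ 1`. The decay makes `(y i)⁻¹ ^ a` geometrically small
going backwards from `k - 1` and `y i ^ b` geometrically small going forwards from `k`, so the bound
does not depend on where the crossing occurs. -/
theorem tsum_min_rpow_le (D ρ : ℝ≥0) (hρ : ρ < 1) {a b : ℝ} (ha : 0 < a) (hb : 0 < b) :
    ∃ A : ℝ≥0, ∀ y : ℕ → ℝ≥0∞, (∀ i, y i ≠ 0) → (∀ i, y i ≠ ⊤) →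
      (∀ i j, i ≤ j → y j ≤ D * ρ ^ (j - i) * y i) →
      ∑' i, min ((y i)⁻¹ ^ a) (y i ^ b) ≤ A := by
  have hgeom : ∀ {c : ℝ}, 0 < c → ∑' j : ℕ, ((D : ℝ≥0∞) * ρ ^ j) ^ c ≠ ⊤ := by
    intro c hc
    have e : ∀ j : ℕ, ((D : ℝ≥0∞) * ρ ^ j) ^ c = (D : ℝ≥0∞) ^ c * ((ρ : ℝ≥0∞) ^ c) ^ j := by
      intro j
      rw [ENNReal.mul_rpow_of_nonneg _ _ hc.le, ← ENNReal.rpow_natCast, ← ENNReal.rpow_natCast,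
        ← ENNReal.rpow_mul, ← ENNReal.rpow_mul, mul_comm c]
    simp_rw [e]
    rw [ENNReal.tsum_mul_left, ENNReal.tsum_geometric]
    refine ENNReal.mul_ne_top (ENNReal.rpow_ne_top_of_nonneg hc.le ENNReal.coe_ne_top) ?_
    rw [ENNReal.inv_ne_top]
    have : (ρ : ℝ≥0∞) ^ c < 1 := ENNReal.rpow_lt_one (by exact_mod_cast hρ) hc
    exact (tsub_pos_of_lt this).ne'
  refine ⟨(∑' j : ℕ, ((D : ℝ≥0∞) * ρ ^ j) ^ a).toNNReal +
    (∑' j : ℕ, ((D : ℝ≥0∞) * ρ ^ j) ^ b).toNNReal, fun y h0 htop hdec => ?_⟩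
  rw [ENNReal.coe_add, ENNReal.coe_toNNReal (hgeom ha), ENNReal.coe_toNNReal (hgeom hb)]
  have hex : ∃ k, y k ≤ 1 := by
    have h1 : Tendsto (fun k : ℕ => (D : ℝ≥0∞) * ρ ^ k * y 0) atTop (𝓝 (D * 0 * y 0)) := by
      refine ENNReal.Tendsto.mul_const (ENNReal.Tendsto.const_mul ?_ (Or.inr ENNReal.coe_ne_top))
        (Or.inr (htop 0))
      exact ENNReal.tendsto_pow_atTop_nhds_zero_of_lt_one (by exact_mod_cast hρ)
    rw [mul_zero, zero_mul] at h1
    obtain ⟨k, hk⟩ := (h1.eventually (gt_mem_nhds zero_lt_one)).exists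
    exact ⟨k, (by simpa using hdec 0 k (Nat.zero_le _) : y k ≤ _).trans hk.le⟩
  classical
  set k := Nat.find hex with hk
  have hyk : y k ≤ 1 := Nat.find_spec hex
  rw [← ENNReal.summable.sum_add_tsum_nat_add' (k := k)]
  refine add_le_add ?_ ?_
  -- Reversing the order counts the terms before the crossing from `k - 1` downwards, where `y (k -
  -- 1) > 1` by minimality of `k`.
  · rw [← Finset.sum_range_reflect]
    refine (Finset.sum_le_sum fun j hj => ?_).trans (ENNReal.sum_le_tsum (Finset.range k))
    have hj' := Finset.mem_range.1 hj
    refine (min_le_left _ _).trans ?_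
    gcongr
    have h1 : 1 ≤ y (k - 1) := (not_le.1 (Nat.find_min hex (m := k - 1) (by omega))).le
    have h2 := hdec (k - 1 - j) (k - 1) (by omega)
    rw [show k - 1 - (k - 1 - j) = j by omega] at h2
    calc (y (k - 1 - j))⁻¹ ≤ (y (k - 1 - j))⁻¹ * (D * ρ ^ j * y (k - 1 - j)) := by
          conv_lhs => rw [← mul_one (y (k - 1 - j))⁻¹]
          gcongr
          exact h1.trans h2
      _ = (D * ρ ^ j) * ((y (k - 1 - j))⁻¹ * y (k - 1 - j)) := by ring
      _ = D * ρ ^ j := by rw [ENNReal.inv_mul_cancel (h0 _) (htop _), mul_one]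
  · refine ENNReal.tsum_le_tsum fun j => (min_le_right _ _).trans ?_
    gcongr
    have := hdec k (j + k) (by omega)
    rw [show j + k - k = j by omega] at this
    refine this.trans ?_
    conv_rhs => rw [← mul_one ((D : ℝ≥0∞) * ρ ^ j)]
    gcongr

/-- A Hedberg-type splitting: `g i ≤ Γ` is the efficient bound for large `n i`, and `g i ≤ m * n i`
for small `n i`. In the second case the power of `n i` left over is `1/p - 1/q`, which is positive
because `p < q`. -/
theorem tsum_inv_rpow_mul_rpow_le (D ρ : ℝ≥0) (hρ : ρ < 1) {p q : ℝ} (hp : 0 < p)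
    (hpq : p < q) :
    ∃ A : ℝ≥0, ∀ (n g : ℕ → ℝ≥0∞) (Γ m : ℝ≥0∞), (∀ i, n i ≠ 0) → (∀ i, n i ≠ ⊤) →
      (∀ i j, i ≤ j → n j ≤ D * ρ ^ (j - i) * n i) → Γ ≠ ⊤ → m ≠ 0 → m ≠ ⊤ →
      (∀ i, g i ≤ Γ) → (∀ i, g i ≤ m * n i) →
      ∑' i, (n i)⁻¹ ^ (1 / q) * g i ^ (1 / p) ≤ A * (m ^ (1 / q) * Γ ^ (1 / p - 1 / q)) := by
  have hq : 0 < q := hp.trans hpq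
  have ha : 0 < 1 / q := by positivity
  have hb : 0 < 1 / p - 1 / q := sub_pos.2 (one_div_lt_one_div_of_lt hp hpq)
  have hp' : 0 < 1 / p := by positivity
  obtain ⟨A, hA⟩ := tsum_min_rpow_le D ρ hρ ha hb
  refine ⟨A, fun n g Γ m hn0 hn hdec hΓ hm0 hm hgΓ hgm => ?_⟩
  rcases eq_or_ne Γ 0 with rfl | hΓ0
  · have : ∀ i, (n i)⁻¹ ^ (1 / q) * g i ^ (1 / p) = 0 := fun i => by
      rw [le_zero_iff.1 (hgΓ i), ENNReal.zero_rpow_of_pos hp', mul_zero]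
    simp only [this, tsum_zero, zero_le]
  -- This normalisation makes the two bounds on `g i` coincide when `c * n i = 1`.
  set c := m / Γ with hc
  have hc0 : c ≠ 0 := ENNReal.div_ne_zero.2 ⟨hm0, hΓ⟩
  have hctop : c ≠ ⊤ := ENNReal.div_ne_top hm hΓ0
  have hmc : m = c * Γ := (ENNReal.div_mul_cancel hΓ0 hΓ).symm
  have key := hA (fun i => c * n i) (fun i => mul_ne_zero hc0 (hn0 i))
    (fun i => ENNReal.mul_ne_top hctop (hn i)) (fun i j hij => by
      calc c * n j ≤ c * (D * ρ ^ (j - i) * n i) := by gcongr; exact hdec i j hij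
        _ = _ := by ring)
  have hmul : ∀ x y : ℝ≥0∞, 0 ≤ x → (x * y) ^ (1 / q) = x ^ (1 / q) * y ^ (1 / q) :=
    fun x y _ => ENNReal.mul_rpow_of_nonneg _ _ ha.le
  have hΓs : Γ ^ (1 / p) = Γ ^ (1 / q) * Γ ^ (1 / p - 1 / q) := by
    rw [← ENNReal.rpow_add _ _ hΓ0 hΓ]; congr 1; ring
  calc ∑' i, (n i)⁻¹ ^ (1 / q) * g i ^ (1 / p)
      ≤ ∑' i, m ^ (1 / q) * Γ ^ (1 / p - 1 / q) *
          min ((c * n i)⁻¹ ^ (1 / q)) ((c * n i) ^ (1 / p - 1 / q)) := by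
        refine ENNReal.tsum_le_tsum fun i => ?_
        have hY0 : c * n i ≠ 0 := mul_ne_zero hc0 (hn0 i)
        have hYt : c * n i ≠ ⊤ := ENNReal.mul_ne_top hctop (hn i)
        have hninv : (n i)⁻¹ ^ (1 / q) = c ^ (1 / q) * (c * n i)⁻¹ ^ (1 / q) := by
          rw [← hmul _ _ zero_le, ENNReal.mul_inv (Or.inl hc0) (Or.inl hctop), ← mul_assoc,
            ENNReal.mul_inv_cancel hc0 hctop, one_mul]
        have hYs : (c * n i) ^ (1 / p) = (c * n i) ^ (1 / q) * (c * n i) ^ (1 / p - 1 / q) := by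
          rw [← ENNReal.rpow_add _ _ hY0 hYt]; congr 1; ring
        rw [mul_min, hninv, hmc, hmul _ _ zero_le]
        refine le_min ?_ ?_
        · calc c ^ (1 / q) * (c * n i)⁻¹ ^ (1 / q) * g i ^ (1 / p)
              ≤ c ^ (1 / q) * (c * n i)⁻¹ ^ (1 / q) * Γ ^ (1 / p) := by gcongr; exact hgΓ i
            _ = _ := by rw [hΓs]; ring
        · have hg' : g i ≤ Γ * (c * n i) := (hgm i).trans (by rw [hmc]; exact le_of_eq (by ring))
          calc c ^ (1 / q) * (c * n i)⁻¹ ^ (1 / q) * g i ^ (1 / p)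
              ≤ c ^ (1 / q) * (c * n i)⁻¹ ^ (1 / q) * (Γ * (c * n i)) ^ (1 / p) := by gcongr
            _ = c ^ (1 / q) * Γ ^ (1 / q) * Γ ^ (1 / p - 1 / q) * (c * n i) ^ (1 / p - 1 / q) *
                ((c * n i)⁻¹ ^ (1 / q) * (c * n i) ^ (1 / q)) := by
                rw [ENNReal.mul_rpow_of_nonneg _ _ hp'.le, hΓs, hYs]; ring
            _ = _ := by
                rw [← hmul (c * n i)⁻¹ _ zero_le, ENNReal.inv_mul_cancel hY0 hYt,
                  ENNReal.one_rpow, mul_one, ← hmul c Γ zero_le]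
    _ ≤ _ := by
        rw [ENNReal.tsum_mul_left, mul_comm]
        gcongr

/-- The inclusion of `ℓ^1` in `ℓ^t`. With `t = q/p` it lets the energies on disjoint level sets be
summed inside the weak-type bounds. -/
theorem tsum_rpow_le_rpow {ι : Type*} (g : ι → ℝ≥0∞) {Γ : ℝ≥0∞} (hg : ∑' i, g i ≤ Γ) {t : ℝ}
    (ht : 1 ≤ t) : ∑' i, g i ^ t ≤ Γ ^ t := by
  have e : ∀ x : ℝ≥0∞, x ^ t = x ^ (t - 1) * x := fun x => by
    conv_rhs => rw [← ENNReal.rpow_one x, ← ENNReal.rpow_mul]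
    rw [← ENNReal.rpow_add_of_nonneg _ _ (by linarith) zero_le_one]
    congr 1; ring
  calc ∑' i, g i ^ t ≤ ∑' i, Γ ^ (t - 1) * g i := by
        refine ENNReal.tsum_le_tsum fun i => ?_
        rw [e]
        exact mul_le_mul' (ENNReal.rpow_le_rpow ((ENNReal.le_tsum i).trans hg) (by linarith)) le_rfl
    _ ≤ Γ ^ t := by
        rw [ENNReal.tsum_mul_left, e Γ]
        gcongr

end Sums

/-! ### A Vitali covering estimate. -/

section Covering

variable {X : Type*} [MetricSpace X] [MeasurableSpace X] [OpensMeasurableSpace X]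

/-- Weak-type bound for a restricted maximal function of `γ` relative to `ν`. -/
theorem mul_measure_le_of_forall_exists_ball (ν γ : Measure X) [IsFiniteMeasure γ] {F : Set X}
    {τ R : ℝ} (hτ : 0 < τ) {K : ℝ≥0} {m : ℝ≥0∞}
    (h : ∀ x ∈ F, ∃ r, 0 < r ∧ r ≤ R ∧ ν (ball x (8 * τ * r)) ≤ K * ν (ball x r) ∧
      m * ν (ball x r) < γ (ball x (τ * r))) :
    m * ν F ≤ K * γ univ := by
  choose! r hr0 hrR hrK hrm using h
  -- The selected closed balls cover after enlargement by the factor 5. The factor 8 in the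
  -- hypothesis leaves room to pass to open balls.
  obtain ⟨u, huF, hdisj, hcov⟩ := Vitali.exists_disjoint_subfamily_covering_enlargement_closedBall
    F (fun x => x) (fun x => τ * r x) (τ * R)
    (fun x hx => by have := hrR x hx; gcongr) 5 (by norm_num)
  have hpos : ∀ x ∈ u, 0 < γ (closedBall x (τ * r x)) := fun x hx =>
    (zero_le.trans_lt (hrm x (huF hx))).trans_le (measure_mono ball_subset_closedBall)
  have hdisj' : Pairwise (Function.onFun Disjoint fun x : u => closedBall (x : X) (τ * r x)) :=
    fun a b hab => hdisj a.2 b.2 (fun e => hab (Subtype.ext e))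
  -- Disjoint sets of positive measure for the finite measure `γ` are countably many.
  have hcount : u.Countable := by
    have := Measure.countable_meas_pos_of_disjoint_iUnion (μ := γ)
      (fun x : u => measurableSet_closedBall (x := (x : X)) (ε := τ * r x)) hdisj'
    have hall : {x : u | 0 < γ (closedBall (x : X) (τ * r x))} = univ :=
      eq_univ_of_forall fun x => hpos x x.2
    rw [hall] at this
    exact countable_coe_iff.1 (countable_univ_iff.1 this)
  have : Countable u := hcount.to_subtype
  have hsub : F ⊆ ⋃ x : u, ball (x : X) (8 * τ * r x) := by
    intro x hx
    obtain ⟨y, hy, hxy⟩ := hcov x hx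
    have hry := hr0 y (huF hy)
    have hrx := hr0 x hx
    refine mem_iUnion.2 ⟨⟨y, hy⟩, ?_⟩
    have := hxy (mem_closedBall_self (by positivity))
    rw [mem_closedBall] at this
    rw [mem_ball]
    nlinarith [mul_pos hτ hry]
  calc m * ν F ≤ m * ∑' x : u, ν (ball (x : X) (8 * τ * r x)) := by
        gcongr
        exact (measure_mono hsub).trans (measure_iUnion_le _)
    _ ≤ m * ∑' x : u, K * ν (ball (x : X) (r x)) := by
        gcongr with x
        exact hrK x (huF x.2)
    _ = K * ∑' x : u, m * ν (ball (x : X) (r x)) := by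
        rw [ENNReal.tsum_mul_left, ENNReal.tsum_mul_left]; ring
    _ ≤ K * ∑' x : u, γ (closedBall (x : X) (τ * r x)) := by
        gcongr with x
        exact (hrm x (huF x.2)).le.trans (measure_mono ball_subset_closedBall)
    _ ≤ K * γ univ := by
        gcongr
        exact (tsum_meas_le_meas_iUnion_of_disjoint γ (fun x => measurableSet_closedBall)
          hdisj').trans (measure_mono (subset_univ _))

end Covering

/-! ### Finite nets and compactness in Lebesgue spaces. -/

section Compactness

/-- A bounded set in the finite-dimensional space `J → ℝ` is totally bounded for the sup metric, and
the net can be taken among the terms of the sequence itself. -/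
theorem exists_finset_forall_abs_sub_le {J : Type*} [Fintype J] (a : ℕ → J → ℝ) {M : ℝ}
    (hM : ∀ n y, |a n y| ≤ M) {ε : ℝ} (hε : 0 < ε) :
    ∃ T : Finset ℕ, ∀ n, ∃ k ∈ T, ∀ y, |a n y - a k y| ≤ ε := by
  classical
  have hb : Bornology.IsBounded (range a) := by
    refine (Metric.isBounded_closedBall (x := (0 : J → ℝ)) (r := max M 0)).subset ?_
    rintro _ ⟨n, rfl⟩
    rw [mem_closedBall, dist_pi_le_iff (le_max_right _ _)]
    intro y
    simpa using Or.inl (hM n y)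
  obtain ⟨t, hts, htf, hcov⟩ := Metric.finite_approx_of_totallyBounded 
    (hb.isCompact_closure.totallyBounded.subset subset_closure) ε hε
  obtain ⟨S, hS, rfl⟩ : ∃ S : Set ℕ, S.Finite ∧ a '' S = t := by
    obtain ⟨S, hS⟩ := subset_range_iff_exists_image_eq.1 hts
    obtain ⟨S', -, h1⟩ := exists_subset_bijOn S a
    refine ⟨S', ?_, by rw [h1.image_eq, hS]⟩
    exact Finite.of_finite_image (by rw [h1.image_eq, hS]; exact htf) h1.injOn
  refine ⟨hS.toFinset, fun n => ?_⟩
  have := hcov (mem_range_self n)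
  simp only [mem_iUnion, mem_image, exists_prop] at this
  obtain ⟨_, ⟨k, hk, rfl⟩, hd⟩ := this
  refine ⟨k, hS.mem_toFinset.2 hk, fun y => ?_⟩
  exact (dist_le_pi_dist (a n) (a k) y).trans (mem_ball.1 hd).le

variable {X : Type*} [MeasurableSpace X]

/-- A sequence in `L^q` with finite nets has a convergent subsequence. -/
theorem exists_subseq_tendsto_of_finite_nets (m : Measure X) {q : ℝ} (hq : 1 ≤ q)
    (w : ℕ → X → ℝ) (hw : ∀ n, MemLp (w n) (ENNReal.ofReal q) m)
    (H : ∀ ε : ℝ, 0 < ε → ∃ T : Finset ℕ, ∀ n, ∃ k ∈ T,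
      (∫⁻ x, ‖w n x - w k x‖ₑ ^ q ∂m) ^ (1 / q) ≤ ENNReal.ofReal ε) :
    ∃ φ : ℕ → ℕ, StrictMono φ ∧ ∃ v : X → ℝ, MemLp v (ENNReal.ofReal q) m ∧
      Tendsto (fun n => (∫⁻ x, ‖w (φ n) x - v x‖ₑ ^ q ∂m) ^ (1 / q)) atTop (𝓝 0) := by
  have hq0 : 0 < q := by linarith
  have hnorm : ∀ f : X → ℝ, (∫⁻ x, ‖f x‖ₑ ^ q ∂m) ^ (1 / q) = eLpNorm f (ENNReal.ofReal q) m := by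
    intro f
    rw [eLpNorm_eq_lintegral_rpow_enorm_toReal (by simpa using hq0) ENNReal.ofReal_ne_top,
      ENNReal.toReal_ofReal hq0.le]
  have : Fact (1 ≤ ENNReal.ofReal q) := ⟨by simpa using hq⟩
  set W : ℕ → Lp ℝ (ENNReal.ofReal q) m := fun n => (hw n).toLp (w n) with hW
  have htb : TotallyBounded (range W) := by
    rw [Metric.totallyBounded_iff]
    intro ε hε
    obtain ⟨T, hT⟩ := H (ε / 2) (by positivity)
    refine ⟨W '' T, T.finite_toSet.image W, ?_⟩
    rintro _ ⟨n, rfl⟩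
    obtain ⟨k, hk, hnk⟩ := hT n
    refine mem_biUnion (mem_image_of_mem W hk) ?_
    rw [mem_ball, ← edist_lt_ofReal, Lp.edist_toLp_toLp]
    refine lt_of_le_of_lt ?_ ((ENNReal.ofReal_lt_ofReal_iff hε).2 (half_lt_self hε))
    exact (hnorm (w n - w k)).symm.le.trans hnk
  obtain ⟨V, -, φ, hφ, hlim⟩ :=
    (htb.closure.isCompact_of_isClosed isClosed_closure).tendsto_subseq
      (fun n => subset_closure (mem_range_self n) : ∀ n, W n ∈ closure (range W))
  refine ⟨φ, hφ, V, Lp.memLp V, ?_⟩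
  rw [tendsto_iff_edist_tendsto_0] at hlim
  refine hlim.congr fun n => ?_
  rw [Lp.edist_def]
  refine Eq.trans ?_ (hnorm (w (φ n) - V)).symm
  refine eLpNorm_congr_ae ?_
  exact ((hw (φ n)).coeFn_toLp).sub (ae_eq_refl _)

end Compactness

/-! ### Quantitative forms of the hypotheses and auxiliary objects. -/

variable {X : Type*} [MetricSpace X] [MeasurableSpace X]

/-- Doubling on balls centred in `E` of radius at most `R₀`, with finite positive measures. -/
def DoublingBalls (μ : Measure X) (E : Set X) (K : ℝ≥0) (R₀ : ℝ) : Prop :=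
  ∀ x ∈ E, ∀ r : ℝ, 0 < r → r ≤ R₀ →
    0 < μ (ball x r) ∧ μ (ball x (2 * r)) ≤ K * μ (ball x r) ∧ μ (ball x (2 * r)) < ⊤

/-- Geometric decay of the measures of dyadic balls centred in `E`. -/
def DecayBalls (ν : Measure X) (E : Set X) (D ρ : ℝ≥0) (R₀ : ℝ) : Prop :=
  ∀ x ∈ E, ∀ r : ℝ, 0 < r → r ≤ R₀ → ∀ n : ℕ, ν (ball x (r / 2 ^ n)) ≤ D * ρ ^ n * ν (ball x r)

/-- The hypotheses on balls, with named constants. -/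
structure BallConditions (μ ν : Measure X) (E : Set X) (K D ρ : ℝ≥0) (R₀ : ℝ) : Prop where
  pos : 0 < R₀
  rho_lt_one : ρ < 1
  doubling : DoublingBalls μ E K R₀
  doubling' : DoublingBalls ν E K R₀
  decay : DecayBalls ν E D ρ R₀

/-- Integrability on the balls centred in `E` of radius at most `R₀`. -/
def IntegrableOnBallsOf (μ : Measure X) (E : Set X) (R₀ : ℝ) (u : X → ℝ) : Prop :=
  ∀ x ∈ E, ∀ r : ℝ, 0 < r → r ≤ R₀ → IntegrableOn u (ball x r) μ

/-- The mean oscillation of `u` on a ball. -/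
noncomputable def meanOsc (μ : Measure X) (u : X → ℝ) (x : X) (r : ℝ) : ℝ≥0∞ :=
  ⨍⁻ y in ball x r, ‖u y - ⨍ z in ball x r, u z ∂μ‖ₑ ∂μ

/-- `x` is a Lebesgue point of `u` with value `a`. -/
def IsLebesguePoint (μ : Measure X) (u : X → ℝ) (x : X) (a : ℝ) : Prop :=
  Tendsto (fun r : ℝ => ⨍⁻ y in ball x r, ‖u y - a‖ₑ ∂μ) (𝓝[>] 0) (𝓝 0)

/-- The discrete Riesz-type potential of the measure `γ` along dyadic balls. -/
noncomputable def radialSum (γ ν : Measure X) (τ p q R : ℝ) (x : X) : ℝ≥0∞ :=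
  ∑' i : ℕ, (ν (ball x (R / 2 ^ i)))⁻¹ ^ (1 / q) * γ (ball x (τ * (R / 2 ^ i))) ^ (1 / p)

/-- The weak-type bound of exponent `q` for radial sums of radius at most `R₁`. -/
def RadialWeakType (ν : Measure X) (E : Set X) (τ p q : ℝ) (C : ℝ≥0) (R₁ : ℝ) : Prop :=
  ∀ R, 0 < R → R ≤ R₁ → ∀ γ : Measure X, IsFiniteMeasure γ → ∀ t : ℝ≥0∞, t ≠ 0 → t ≠ ⊤ →
    ν {x | x ∈ E ∧ t < radialSum γ ν τ p q R x} * t ^ q ≤ C * γ univ ^ (q / p)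

/-- The pair `(u, g)` satisfies the Poincaré inequality with constant `C`, and `g` has finite
`p`-energy. -/
structure PoincarePair (μ : Measure X) (E : Set X) (R₀ α p τ C : ℝ) (u g : X → ℝ) : Prop where
  nonneg : 0 ≤ C
  integrable : IntegrableOnBallsOf μ E R₀ u
  poincare : PoincareIneqOn μ E R₀ α p τ C u g
  energy_ne_top : ∫⁻ y, ‖g y‖ₑ ^ p ∂μ ≠ ⊤

/-- The set where the Lebesgue value of `u` differs by more than `t` from its average over a
nearby ball of radius `R / 2`. -/
def deviationSet (μ : Measure X) (E : Set X) (R : ℝ) (u : X → ℝ) (t : ℝ≥0∞) : Set X :=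
  {x | x ∈ E ∧ ∃ y ∈ E, dist x y < R / 2 ∧ ∃ a, IsLebesguePoint μ u x a ∧
    t < ‖a - ⨍ z in ball y (R / 2), u z ∂μ‖ₑ}

/-- The real-valued version of `limsupRep`. -/
noncomputable def realRep (μ : Measure X) (u : X → ℝ) (x : X) : ℝ := (limsupRep μ u x).toReal

/-! ### Consequences of doubling. -/

section Doubling

variable {μ : Measure X} {E : Set X} {K : ℝ≥0} {R₀ : ℝ} {x : X} {r : ℝ}

theorem DoublingBalls.ne_zero (h : DoublingBalls μ E K R₀) (hR : 0 < R₀) (hx : x ∈ E)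
    (hr : 0 < r) : μ (ball x r) ≠ 0 := by
  have := (h x hx (min r R₀) (lt_min hr hR) (min_le_right _ _)).1
  exact (this.trans_le (measure_mono (ball_subset_ball (min_le_left _ _)))).ne'

theorem DoublingBalls.ne_top (h : DoublingBalls μ E K R₀) (hR : 0 < R₀) (hx : x ∈ E)
    (hr : r ≤ 2 * R₀) : μ (ball x r) ≠ ⊤ :=
  ((measure_mono (ball_subset_ball hr)).trans_lt (h x hx R₀ hR le_rfl).2.2).ne

theorem DoublingBalls.pow (h : DoublingBalls μ E K R₀) (hx : x ∈ E) (hr : 0 < r) :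
    ∀ n : ℕ, 2 ^ n * r ≤ 2 * R₀ → μ (ball x (2 ^ n * r)) ≤ K ^ n * μ (ball x r)
  | 0, _ => by simp
  | n + 1, hn => by
    have hpos : 0 < 2 ^ n * r := by positivity
    have e : 2 ^ (n + 1) * r = 2 * (2 ^ n * r) := by ring
    have h1 : 2 ^ n * r ≤ R₀ := by rw [e] at hn; linarith
    rw [e]
    calc μ (ball x (2 * (2 ^ n * r))) ≤ K * μ (ball x (2 ^ n * r)) := (h x hx _ hpos h1).2.1
      _ ≤ K * (K ^ n * μ (ball x r)) := by
        gcongr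
        exact h.pow hx hr n (by linarith)
      _ = _ := by ring

theorem DoublingBalls.mono_radius (h : DoublingBalls μ E K R₀) {R : ℝ} (hR : R ≤ R₀) :
    DoublingBalls μ E K R :=
  fun x hx r hr hrR => h x hx r hr (hrR.trans hR)

theorem BallConditions.mono_radius {ν : Measure X} {D ρ : ℝ≥0}
    (h : BallConditions μ ν E K D ρ R₀) {R : ℝ} (hR0 : 0 < R) (hR : R ≤ R₀) :
    BallConditions μ ν E K D ρ R :=
  ⟨hR0, h.rho_lt_one, h.doubling.mono_radius hR, h.doubling'.mono_radius hR,
    fun x hx r hr hrR => h.decay x hx r hr (hrR.trans hR)⟩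

/-- The conditions on balls in the definition yield constants for `BallConditions`. -/
theorem LocallyDoublingOn.exists_ballConditions {ν : Measure X}
    (h : LocallyDoublingOn μ ν E R₀) (hR : 0 < R₀) :
    ∃ K D ρ : ℝ≥0, BallConditions μ ν E K D ρ R₀ := by
  obtain ⟨C, δ, hC, hδ, h⟩ := h
  have hdbl : ∀ m : Measure X, (∀ x ∈ E, ∀ r : ℝ, 0 < r → r ≤ R₀ → 0 < m (ball x (2 * r)) ∧
      m (ball x (2 * r)) ≤ ENNReal.ofReal C * m (ball x r) ∧
      ENNReal.ofReal C * m (ball x r) < ⊤) → DoublingBalls m E C.toNNReal R₀ := by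
    intro m hm x hx r hr hrR
    refine ⟨?_, (hm x hx r hr hrR).2.1, (hm x hx r hr hrR).2.1.trans_lt (hm x hx r hr hrR).2.2⟩
    -- Positivity is assumed for the doubled ball, so the hypothesis is applied at half the radius.
    have := (hm x hx (r / 2) (by positivity) (by linarith)).1
    rwa [mul_div_cancel₀ _ (two_ne_zero)] at this
  have hν : DoublingBalls ν E C.toNNReal R₀ := hdbl ν fun x hx r hr hrR => (h x hx r hr hrR).2.1
  -- The dyadic decay rate is `2^(-δ)`. The maximum with 1 covers `n = 0`, since the decay
  -- hypothesis concerns only `r' < r`.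
  refine ⟨C.toNNReal, max C.toNNReal 1, (2 : ℝ≥0) ^ (-δ), hR,
    NNReal.rpow_lt_one_of_one_lt_of_neg (by norm_num) (by linarith),
    hdbl μ fun x hx r hr hrR => (h x hx r hr hrR).1, hν, fun x hx r hr hrR n => ?_⟩
  rcases Nat.eq_zero_or_pos n with rfl | hn
  · simp only [pow_zero, div_one, mul_one]
    refine le_mul_of_one_le_left zero_le ?_
    exact_mod_cast le_max_right _ _
  · have h2 : (1 : ℝ) < 2 ^ n := one_lt_pow₀ (by norm_num) hn.ne'
    have h3 := (h x hx r hr hrR).2.2 (r / 2 ^ n) (by positivity) (div_lt_self hr h2)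
    rw [ENNReal.div_le_iff (hν.ne_zero hR hx hr) (hν.ne_top hR hx (by linarith))] at h3
    refine h3.trans ?_
    gcongr
    have e : (r / 2 ^ n / r) ^ δ = (((2 : ℝ≥0) ^ (-δ)) ^ n : ℝ≥0) := by
      rw [div_div, mul_comm, ← div_div, div_self hr.ne', one_div, NNReal.coe_pow,
        NNReal.coe_rpow, ← Real.rpow_natCast, ← Real.rpow_natCast, ← Real.rpow_mul (by norm_num),
        ← Real.rpow_neg (by norm_num), ← Real.rpow_mul (by norm_num)]
      norm_num
      congr 1
      ring
    rw [e, ENNReal.ofReal_mul hC.le, ENNReal.ofReal_coe_nnreal, ENNReal.coe_pow]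
    gcongr
    exact ENNReal.coe_le_coe.2 (le_max_left _ _)

end Doubling

/-! ### Lebesgue points and telescoping of averages. -/

section LebesguePoints

variable {μ : Measure X} {E : Set X} {K : ℝ≥0} {R₀ : ℝ} {x : X} {u : X → ℝ}

/-- Convergence of the mean of `|u - a|`, unlike mere convergence of averages, is preserved by
contractions. This is what makes Lebesgue values compatible with truncation. -/
theorem IsLebesguePoint.comp {a : ℝ} (h : IsLebesguePoint μ u x a) {f : ℝ → ℝ}
    (hf : ∀ s t, ‖f s - f t‖ₑ ≤ ‖s - t‖ₑ) : IsLebesguePoint μ (fun y => f (u y)) x (f a) :=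
  tendsto_of_tendsto_of_tendsto_of_le_of_le tendsto_const_nhds h (fun _ => zero_le)
    fun _ => setLAverage_mono fun _ => hf _ _

theorem IsLebesguePoint.neg {a : ℝ} (h : IsLebesguePoint μ u x a) :
    IsLebesguePoint μ (fun y => -u y) x (-a) :=
  h.comp (f := fun s => -s) fun s t => by
    rw [← enorm_neg (s - t)]; exact le_of_eq (by congr 1; ring)

theorem enorm_clamp_sub_clamp_le (l k s t : ℝ) :
    ‖max l (min s k) - max l (min t k)‖ₑ ≤ ‖s - t‖ₑ := by
  rw [Real.enorm_eq_ofReal_abs, Real.enorm_eq_ofReal_abs]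
  refine ENNReal.ofReal_le_ofReal ?_
  refine (abs_max_sub_max_le_max _ _ _ _).trans ?_
  rw [sub_self, abs_zero, max_eq_right (abs_nonneg _)]
  refine (abs_min_sub_min_le_max _ _ _ _).trans ?_
  rw [sub_self, abs_zero, max_eq_left (abs_nonneg _)]

theorem IsLebesguePoint.truncate {a : ℝ} (h : IsLebesguePoint μ u x a) (l k : ℝ) :
    IsLebesguePoint μ (truncate l k u) x (max l (min a k)) :=
  h.comp (f := fun s => max l (min s k)) (enorm_clamp_sub_clamp_le l k)

theorem IsLebesguePoint.tendsto_average {a : ℝ} (h : IsLebesguePoint μ u x a)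
    (hd : DoublingBalls μ E K R₀) (hR : 0 < R₀) (hx : x ∈ E)
    (hu : IntegrableOnBallsOf μ E R₀ u) :
    Tendsto (fun r : ℝ => ⨍ y in ball x r, u y ∂μ) (𝓝[>] 0) (𝓝 a) := by
  rw [tendsto_iff_edist_tendsto_0]
  refine tendsto_of_tendsto_of_tendsto_of_le_of_le' tendsto_const_nhds h
    (Eventually.of_forall fun _ => zero_le) ?_
  filter_upwards [Ioc_mem_nhdsGT hR] with r hr
  rw [edist_eq_enorm_sub]
  exact enorm_setAverage_sub_le (hd.ne_zero hR hx hr.1) (hd.ne_top hR hx (by linarith [hr.2, hR]))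
    (hu x hx r hr.1 hr.2) a

theorem IsLebesguePoint.limsupRep_eq {a : ℝ} (h : IsLebesguePoint μ u x a)
    (hd : DoublingBalls μ E K R₀) (hR : 0 < R₀) (hx : x ∈ E)
    (hu : IntegrableOnBallsOf μ E R₀ u) : limsupRep μ u x = a :=
  Tendsto.limsup_eq
    ((continuous_coe_real_ereal.tendsto a).comp (h.tendsto_average hd hR hx hu))

theorem enorm_average_subball_sub_le (hd : DoublingBalls μ E K R₀) (hR : 0 < R₀)
    (hu : IntegrableOnBallsOf μ E R₀ u) {z : X} (hz : z ∈ E) {r r' : ℝ} (hr' : 0 < r')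
    (hr'R : r' ≤ R₀) (hsub : ball z r' ⊆ ball x r) {K' : ℝ≥0}
    (hK : μ (ball x r) ≤ K' * μ (ball z r')) (c : ℝ) :
    ‖(⨍ y in ball z r', u y ∂μ) - c‖ₑ ≤ K' * ⨍⁻ y in ball x r, ‖u y - c‖ₑ ∂μ := by
  have h0 := hd.ne_zero hR hz hr'
  have htop := hd.ne_top hR hz (r := r') (by linarith)
  refine (enorm_setAverage_sub_le h0 htop (hu z hz r' hr' hr'R) c).trans ?_
  exact setLAverage_le_mul hsub h0
    (ne_top_of_le_ne_top (ENNReal.mul_ne_top ENNReal.coe_ne_top htop) hK) hK _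

variable {R : ℝ}

theorem edist_dyadic_averages_le (hd : DoublingBalls μ E K R₀) (hx : x ∈ E)
    (hu : IntegrableOnBallsOf μ E R₀ u) (hR : 0 < R) (hRR : R ≤ R₀) (i : ℕ) :
    edist (⨍ y in ball x (R / 2 ^ i), u y ∂μ) (⨍ y in ball x (R / 2 ^ i.succ), u y ∂μ) ≤
      K * meanOsc μ u x (R / 2 ^ i) := by
  have h2 : (1 : ℝ) ≤ 2 ^ i := one_le_pow₀ (by norm_num)
  have hri : R / 2 ^ i ≤ R := div_le_self hR.le h2
  have hpos : 0 < R / 2 ^ i := by positivity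
  have e : R / 2 ^ i = 2 * (R / 2 ^ i.succ) := by rw [pow_succ]; field_simp
  rw [edist_comm, edist_eq_enorm_sub]
  refine enorm_average_subball_sub_le hd (hR.trans_le hRR) hu hx (by positivity) ?_ ?_ ?_ _
  · linarith
  · exact ball_subset_ball (by linarith)
  · rw [e]
    exact (hd x hx _ (by linarith) (by linarith)).2.1

/-- Summability of the oscillations makes the dyadic averages Cauchy and sends the oscillations to
zero, which gives the limit along dyadic radii. Any other small radius `r` is compared by doubling
with the dyadic ball whose radius lies between `r` and `2 * r`. -/
theorem exists_isLebesguePoint (hd : DoublingBalls μ E K R₀) (hx : x ∈ E)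
    (hu : IntegrableOnBallsOf μ E R₀ u) (hR : 0 < R) (hRR : R ≤ R₀)
    (hsum : ∑' i : ℕ, meanOsc μ u x (R / 2 ^ i) ≠ ⊤) : ∃ a, IsLebesguePoint μ u x a := by
  have hR₀ := hR.trans_le hRR
  have hstep := fun i => edist_dyadic_averages_le hd hx hu hR hRR i
  have hsum' : ∑' i : ℕ, (K * meanOsc μ u x (R / 2 ^ i)) ≠ ⊤ := by
    rw [ENNReal.tsum_mul_left]; exact ENNReal.mul_ne_top ENNReal.coe_ne_top hsum
  obtain ⟨a, ha⟩ := cauchySeq_tendsto_of_complete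
    (cauchySeq_of_edist_le_of_tsum_ne_top _ hstep hsum')
  refine ⟨a, ENNReal.tendsto_nhds_zero.2 fun ε hε => ?_⟩
  have hlim : Tendsto (fun i : ℕ => K * (meanOsc μ u x (R / 2 ^ i) +
      edist (⨍ y in ball x (R / 2 ^ i), u y ∂μ) a)) atTop (𝓝 (K * (0 + 0))) := by
    refine ENNReal.Tendsto.const_mul (Tendsto.add ?_ ?_) (Or.inr ENNReal.coe_ne_top)
    · exact ENNReal.tendsto_atTop_zero_of_tsum_ne_top hsum
    · exact tendsto_iff_edist_tendsto_0.1 ha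
  rw [add_zero, mul_zero] at hlim
  obtain ⟨N, hN⟩ := eventually_atTop.1 ((ENNReal.tendsto_nhds_zero.1 hlim) ε hε)
  have hNpos : 0 < R / 2 ^ N := by positivity
  filter_upwards [Ioo_mem_nhdsGT hNpos] with r hr
  obtain ⟨n, hn1, hn2⟩ := exists_nat_pow_near_of_lt_one (x := r / R) (y := 1 / 2)
    (div_pos hr.1 hR) ((div_le_one hR).2 (hr.2.le.trans (div_le_self hR.le
      (one_le_pow₀ (by norm_num))))) (by norm_num) (by norm_num)
  have hNn : N ≤ n := by
    by_contra hlt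
    have h1 : (1 / 2 : ℝ) ^ N ≤ (1 / 2) ^ (n + 1) :=
      pow_le_pow_of_le_one (by norm_num) (by norm_num) (by omega)
    have h2 : r / R < (1 / 2 : ℝ) ^ N := by
      rw [div_lt_iff₀ hR, one_div_pow, one_div_mul_eq_div]; exact hr.2
    linarith
  have hpown : (0 : ℝ) < 2 ^ n := by positivity
  have hrn : r ≤ R / 2 ^ n := by
    rw [div_le_iff₀ hR, one_div_pow, one_div_mul_eq_div] at hn2; exact hn2
  have hrn' : R / 2 ^ n ≤ 2 * r := by
    rw [lt_div_iff₀ hR, one_div_pow, one_div_mul_eq_div, pow_succ] at hn1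
    have : R / 2 ^ n = 2 * (R / (2 ^ n * 2)) := by field_simp
    linarith
  have hRn : R / 2 ^ n ≤ R := div_le_self hR.le (one_le_pow₀ (by norm_num))
  have hnpos : 0 < R / 2 ^ n := by positivity
  refine le_trans ?_ (hN n hNn)
  refine (setLAverage_le_mul (ball_subset_ball hrn) (hd.ne_zero hR₀ hx hr.1)
    (hd.ne_top hR₀ hx (by linarith)) (K := K) ?_ _).trans ?_
  · exact (measure_mono (ball_subset_ball hrn')).trans (hd x hx r hr.1 (by linarith)).2.1
  · gcongr
    rw [edist_eq_enorm_sub]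
    exact setLAverage_enorm_sub_le (hd.ne_zero hR₀ hx hnpos)
      (hd.ne_top hR₀ hx (by linarith)) u a _

theorem IsLebesguePoint.enorm_sub_average_le {a : ℝ} (h : IsLebesguePoint μ u x a)
    (hd : DoublingBalls μ E K R₀) (hx : x ∈ E)
    (hu : IntegrableOnBallsOf μ E R₀ u) (hR : 0 < R) (hRR : R ≤ R₀) :
    ‖a - ⨍ y in ball x R, u y ∂μ‖ₑ ≤ K * ∑' i : ℕ, meanOsc μ u x (R / 2 ^ i) := by
  have hstep := fun i => edist_dyadic_averages_le hd hx hu hR hRR i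
  have hlim : Tendsto (fun i : ℕ => ⨍ y in ball x (R / 2 ^ i), u y ∂μ) atTop (𝓝 a) := by
    refine (h.tendsto_average hd (hR.trans_le hRR) hx hu).comp ?_
    refine tendsto_nhdsWithin_iff.2 ⟨?_, Eventually.of_forall fun i => ?_⟩
    · exact tendsto_const_nhds.div_atTop (tendsto_pow_atTop_atTop_of_one_lt (by norm_num))
    · have : 0 < R / 2 ^ i := by positivity
      exact this
  have := edist_le_tsum_of_edist_le_of_tendsto₀ _ hstep hlim
  rwa [ENNReal.tsum_mul_left, pow_zero, div_one, edist_comm, edist_eq_enorm_sub] at this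

end LebesguePoints

/-! ### Oscillations, radial sums and their weak-type bound. -/

section Poincare

variable {μ ν : Measure X} {E : Set X} {K D ρ : ℝ≥0} {R₀ α p q τ : ℝ} {u g : X → ℝ} {x : X}

/-- Multiply and divide the right side of the Poincaré inequality by `ν(B)^(1/q)`: the factor with
`r^α` and `μ` becomes one of the quantities whose supremum is `Theta`. -/
theorem meanOsc_le [OpensMeasurableSpace X] (hν : DoublingBalls ν E K R₀) (hp : 0 < p) (hq : 0 < q)
    {C : ℝ} (hC : 0 ≤ C) (hP : PoincareIneqOn μ E R₀ α p τ C u g) (hx : x ∈ E) {r R : ℝ}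
    (hr : 0 < r) (hrR : r ≤ R) (hRR : R ≤ R₀) :
    meanOsc μ u x r ≤ ENNReal.ofReal C * Theta μ ν E α p q τ R *
      ((ν (ball x r))⁻¹ ^ (1 / q) *
        (μ.withDensity fun y => ‖g y‖ₑ ^ p) (ball x (τ * r)) ^ (1 / p)) := by
  have hR₀ : 0 < R₀ := by linarith
  have h0 := hν.ne_zero hR₀ hx hr
  have htop := hν.ne_top hR₀ hx (r := r) (by linarith)
  have hq' : 0 ≤ 1 / q := by positivity
  have hΘ : ENNReal.ofReal (r ^ α) * ν (ball x r) ^ (1 / q) / μ (ball x (τ * r)) ^ (1 / p) ≤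
      Theta μ ν E α p q τ R :=
    le_iSup₂_of_le r ⟨hr, hrR⟩ (le_iSup₂_of_le x hx le_rfl)
  have hcancel : ν (ball x r) ^ (1 / q) * (ν (ball x r))⁻¹ ^ (1 / q) = 1 := by
    rw [← ENNReal.mul_rpow_of_nonneg _ _ hq', ENNReal.mul_inv_cancel h0 htop, ENNReal.one_rpow]
  refine (hP x hx r hr (hrR.trans hRR)).trans ?_
  rw [setLAverage_eq, ENNReal.div_rpow_of_nonneg _ _ (by positivity),
    withDensity_apply _ measurableSet_ball, ENNReal.ofReal_mul hC]
  set I := (∫⁻ y in ball x (τ * r), ‖g y‖ₑ ^ p ∂μ) ^ (1 / p)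
  set m := μ (ball x (τ * r)) ^ (1 / p)
  calc ENNReal.ofReal C * ENNReal.ofReal (r ^ α) * (I / m)
      = ENNReal.ofReal C * (ENNReal.ofReal (r ^ α) *
          (ν (ball x r) ^ (1 / q) * (ν (ball x r))⁻¹ ^ (1 / q)) / m) * I := by
        rw [hcancel, mul_one, div_eq_mul_inv, div_eq_mul_inv]; ring
    _ = ENNReal.ofReal C * (ENNReal.ofReal (r ^ α) * ν (ball x r) ^ (1 / q) / m) *
          ((ν (ball x r))⁻¹ ^ (1 / q) * I) := by
        simp only [div_eq_mul_inv]; ring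
    _ ≤ _ := by gcongr

theorem tsum_meanOsc_le [OpensMeasurableSpace X] (hν : DoublingBalls ν E K R₀) (hp : 0 < p)
    (hq : 0 < q)
    {C : ℝ} (hC : 0 ≤ C) (hP : PoincareIneqOn μ E R₀ α p τ C u g) (hx : x ∈ E) {R : ℝ}
    (hR : 0 < R) (hRR : R ≤ R₀) :
    ∑' i : ℕ, meanOsc μ u x (R / 2 ^ i) ≤ ENNReal.ofReal C * Theta μ ν E α p q τ R *
      radialSum (μ.withDensity fun y => ‖g y‖ₑ ^ p) ν τ p q R x := by
  rw [radialSum, ← ENNReal.tsum_mul_left]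
  exact ENNReal.tsum_le_tsum fun i => meanOsc_le hν hp hq hC hP hx (by positivity)
    (div_le_self hR.le (one_le_pow₀ (by norm_num))) hRR

/-- By contraposition in `tsum_inv_rpow_mul_rpow_le`, a radial sum above `t` forces a dyadic ball on
which `γ` is large relative to `ν`. The centres of such balls are handled by
`mul_measure_le_of_forall_exists_ball`. -/
theorem BallConditions.exists_radialWeakType [OpensMeasurableSpace X]
    (h : BallConditions μ ν E K D ρ R₀)
    (hp : 0 < p) (hpq : p < q) (hτ : 0 < τ) :
    ∃ (C : ℝ≥0) (R₁ : ℝ), 0 < R₁ ∧ R₁ ≤ R₀ ∧ RadialWeakType ν E τ p q C R₁ := by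
  have hq : 0 < q := hp.trans hpq
  obtain ⟨A, hA⟩ := tsum_inv_rpow_mul_rpow_le D ρ h.rho_lt_one hp hpq
  -- The covering enlarges balls by `8 * τ`, so `n` doublings are needed; radii up to `R₀ / 2 ^ n`
  -- keep all enlarged balls in the doubling range.
  obtain ⟨n, hn⟩ := pow_unbounded_of_one_lt (8 * τ) (one_lt_two : (1 : ℝ) < 2)
  have h2n : (1 : ℝ) ≤ 2 ^ n := one_le_pow₀ (by norm_num)
  refine ⟨K ^ n * (A + 1) ^ q, R₀ / 2 ^ n, div_pos h.pos (by positivity),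
    div_le_self h.pos.le h2n, fun R hR hRR γ hγ t ht0 ht => ?_⟩
  have hRR₀ : R ≤ R₀ := hRR.trans (div_le_self h.pos.le h2n)
  rw [le_div_iff₀ (by positivity)] at hRR
  rcases eq_or_ne (γ univ) 0 with hΓ | hΓ
  · have : γ = 0 := Measure.measure_univ_eq_zero.1 hΓ
    have hzero : ∀ x, radialSum γ ν τ p q R x = 0 := fun x => by
      rw [radialSum]
      have hp' : 0 < 1 / p := by positivity
      simp only [this, Measure.coe_zero, Pi.zero_apply, ENNReal.zero_rpow_of_pos hp', mul_zero,
        tsum_zero]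
    simp [hzero]
  have hΓt : γ univ ≠ ⊤ := measure_ne_top γ univ
  set Γ := γ univ with hΓdef
  set b := 1 / p - 1 / q with hb
  have hb0 : 0 < b := sub_pos.2 (one_div_lt_one_div_of_lt hp hpq)
  set c : ℝ≥0∞ := ((A + 1 : ℝ≥0) : ℝ≥0∞) * Γ ^ b with hc
  have hΓb0 : Γ ^ b ≠ 0 := by simp [ENNReal.rpow_eq_zero_iff, hΓ, hΓt]
  have hΓbt : Γ ^ b ≠ ⊤ := ENNReal.rpow_ne_top_of_nonneg hb0.le hΓt
  have hc0 : c ≠ 0 := mul_ne_zero (by simp) hΓb0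
  have hct : c ≠ ⊤ := ENNReal.mul_ne_top ENNReal.coe_ne_top hΓbt
  -- The density threshold `s ^ q` is chosen so that `A * (s ^ q) ^ (1 / q) * Γ ^ b ≤ t`. Taking `A
  -- + 1` in `c` keeps `c` nonzero.
  set s := t / c with hs
  have hs0 : s ≠ 0 := ENNReal.div_ne_zero.2 ⟨ht0, hct⟩
  have hst : s ≠ ⊤ := ENNReal.div_ne_top ht hc0
  have hsc : t = s * c := (ENNReal.div_mul_cancel hc0 hct).symm
  have hroot : (s ^ q) ^ (1 / q) = s := by
    rw [← ENNReal.rpow_mul, mul_one_div_cancel hq.ne', ENNReal.rpow_one]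
  have key : s ^ q * ν {x | x ∈ E ∧ t < radialSum γ ν τ p q R x} ≤ ((K ^ n : ℝ≥0) : ℝ≥0∞) * Γ := by
    refine mul_measure_le_of_forall_exists_ball ν γ hτ (R := R) fun x hx => ?_
    obtain ⟨i, hi⟩ : ∃ i : ℕ, s ^ q * ν (ball x (R / 2 ^ i)) < γ (ball x (τ * (R / 2 ^ i))) := by
      by_contra! hcon
      have := hA (fun i : ℕ => ν (ball x (R / 2 ^ i))) (fun i => γ (ball x (τ * (R / 2 ^ i)))) Γ
        (s ^ q) (fun i => h.doubling'.ne_zero h.pos hx.1 (by positivity))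
        (fun i => h.doubling'.ne_top h.pos hx.1
          ((div_le_self hR.le (one_le_pow₀ (by norm_num))).trans (by linarith [h.pos])))
        (fun i j hij => by
          have h1 := h.decay x hx.1 (R / 2 ^ i) (by positivity)
            ((div_le_self hR.le (one_le_pow₀ (by norm_num))).trans hRR₀) (j - i)
          rwa [div_div, ← pow_add, Nat.add_sub_cancel' hij] at h1)
        hΓt (by simp [ENNReal.rpow_eq_zero_iff, hs0, hst])
        (ENNReal.rpow_ne_top_of_nonneg hq.le hst)
        (fun i => measure_mono (subset_univ _)) hcon
      refine absurd hx.2 (not_lt.2 (this.trans ?_))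
      rw [hroot, hsc, hc, mul_left_comm]
      gcongr
      simp
    have hle : R / 2 ^ i ≤ R := div_le_self hR.le (one_le_pow₀ (by norm_num))
    have hip : 0 < R / 2 ^ i := by positivity
    refine ⟨R / 2 ^ i, hip, hle, ?_, hi⟩
    rw [ENNReal.coe_pow]
    refine (measure_mono (ball_subset_ball ?_)).trans (h.doubling'.pow hx.1 hip n ?_)
    · gcongr
    · nlinarith [h.pos]
  have hpow : t ^ q = s ^ q * ((((A + 1) ^ q : ℝ≥0) : ℝ≥0∞) * Γ ^ (q / p - 1)) := by
    rw [hsc, hc, ENNReal.mul_rpow_of_nonneg _ _ hq.le, ENNReal.mul_rpow_of_nonneg _ _ hq.le,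
      ← ENNReal.rpow_mul, ENNReal.coe_rpow_of_nonneg _ hq.le]
    congr 3
    rw [hb]; field_simp
  have hΓpow : Γ ^ (q / p) = Γ * Γ ^ (q / p - 1) := by
    conv_rhs => rw [← ENNReal.rpow_one Γ, ← ENNReal.rpow_mul]
    rw [← ENNReal.rpow_add _ _ hΓ hΓt]
    congr 1; ring
  rw [hpow, hΓpow, ENNReal.coe_mul]
  calc ν {x | x ∈ E ∧ t < radialSum γ ν τ p q R x} *
        (s ^ q * ((((A + 1) ^ q : ℝ≥0) : ℝ≥0∞) * Γ ^ (q / p - 1)))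
      = (s ^ q * ν {x | x ∈ E ∧ t < radialSum γ ν τ p q R x}) *
          ((((A + 1) ^ q : ℝ≥0) : ℝ≥0∞) * Γ ^ (q / p - 1)) := by ring
    _ ≤ (((K ^ n : ℝ≥0) : ℝ≥0∞) * Γ) * ((((A + 1) ^ q : ℝ≥0) : ℝ≥0∞) * Γ ^ (q / p - 1)) := by
        gcongr
    _ = _ := by ring

end Poincare

/-! ### Pointwise estimates, deviation bounds and Lebesgue points. -/

section Estimates

variable {μ ν : Measure X} {E : Set X} {K D ρ C₁ : ℝ≥0} {R₀ R₁ R α p q τ C : ℝ} {u g : X → ℝ}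
  {x y : X} {a : ℝ}

theorem PoincarePair.mono_radius (h : PoincarePair μ E R₀ α p τ C u g) (hR : R ≤ R₀) :
    PoincarePair μ E R α p τ C u g :=
  ⟨h.nonneg, fun x hx r hr hrR => h.integrable x hx r hr (hrR.trans hR),
    fun x hx r hr hrR => h.poincare x hx r hr (hrR.trans hR), h.energy_ne_top⟩

theorem PoincarePair.neg (h : PoincarePair μ E R₀ α p τ C u g) :
    PoincarePair μ E R₀ α p τ C (fun x => -u x) g := by
  refine ⟨h.nonneg, fun x hx r hr hrR => (h.integrable x hx r hr hrR).neg,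
    fun x hx r hr hrR => le_trans (le_of_eq ?_) (h.poincare x hx r hr hrR), h.energy_ne_top⟩
  congr 1
  funext y
  rw [setAverage_eq, setAverage_eq, integral_neg, smul_neg, ← enorm_neg]
  congr 1
  ring

theorem measure_ball_le_of_dist_lt (hd : DoublingBalls μ E K R₀) (hR : 0 < R) (hRR : R ≤ R₀)
    (hy : y ∈ E) (hxy : dist x y < R / 2) :
    ball y (R / 2) ⊆ ball x R ∧ μ (ball x R) ≤ ((K ^ 2 : ℝ≥0) : ℝ≥0∞) * μ (ball y (R / 2)) := by
  refine ⟨ball_subset_ball' ?_, ?_⟩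
  · rw [dist_comm]; linarith
  · refine (measure_mono (ball_subset_ball' (?_ : R + dist x y ≤ 2 ^ 2 * (R / 2)))).trans ?_
    · linarith
    · rw [ENNReal.coe_pow]
      exact hd.pow hy (by positivity) 2 (by linarith)

/-- Telescoping reaches `B(x, R)` at the cost `K`, and one comparison of balls passes to `B(y, R/2)`
at the cost `K ^ 2`. The change of centre allows finitely many reference balls to serve all `x ∈ E`.
-/
theorem enorm_sub_average_le_radialSum [OpensMeasurableSpace X]
    (h : BallConditions μ ν E K D ρ R₀) (hP : PoincarePair μ E R₀ α p τ C u g) (hp : 0 < p)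
    (hq : 0 < q) (hR : 0 < R) (hRR : R ≤ R₀) (hx : x ∈ E) (hy : y ∈ E) (hxy : dist x y < R / 2)
    (ha : IsLebesguePoint μ u x a) :
    ‖a - ⨍ z in ball y (R / 2), u z ∂μ‖ₑ ≤ ((K + K ^ 2 : ℝ≥0) : ℝ≥0∞) *
      (ENNReal.ofReal C * Theta μ ν E α p q τ R *
        radialSum (μ.withDensity fun y => ‖g y‖ₑ ^ p) ν τ p q R x) := by
  obtain ⟨hsub, hK⟩ := measure_ball_le_of_dist_lt h.doubling hR hRR hy hxy
  have hσ := tsum_meanOsc_le h.doubling' hp hq hP.nonneg hP.poincare hx hR hRR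
  have h1 := ha.enorm_sub_average_le h.doubling hx hP.integrable hR hRR
  have h2 : ‖(⨍ z in ball y (R / 2), u z ∂μ) - ⨍ z in ball x R, u z ∂μ‖ₑ ≤
      ((K ^ 2 : ℝ≥0) : ℝ≥0∞) * meanOsc μ u x R :=
    enorm_average_subball_sub_le h.doubling h.pos hP.integrable hy (by positivity) (by linarith)
      hsub hK _
  have h3 : meanOsc μ u x R ≤ ∑' i : ℕ, meanOsc μ u x (R / 2 ^ i) := by
    simpa using ENNReal.le_tsum (f := fun i : ℕ => meanOsc μ u x (R / 2 ^ i)) 0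
  calc ‖a - ⨍ z in ball y (R / 2), u z ∂μ‖ₑ
      = ‖(a - ⨍ z in ball x R, u z ∂μ) -
          ((⨍ z in ball y (R / 2), u z ∂μ) - ⨍ z in ball x R, u z ∂μ)‖ₑ := by congr 1; ring
    _ ≤ ‖a - ⨍ z in ball x R, u z ∂μ‖ₑ +
          ‖(⨍ z in ball y (R / 2), u z ∂μ) - ⨍ z in ball x R, u z ∂μ‖ₑ := enorm_sub_le
    _ ≤ K * (∑' i : ℕ, meanOsc μ u x (R / 2 ^ i)) +
          ((K ^ 2 : ℝ≥0) : ℝ≥0∞) * (∑' i : ℕ, meanOsc μ u x (R / 2 ^ i)) := by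
        gcongr
        exact h2.trans (by gcongr)
    _ = ((K + K ^ 2 : ℝ≥0) : ℝ≥0∞) * (∑' i : ℕ, meanOsc μ u x (R / 2 ^ i)) := by
        rw [ENNReal.coe_add, add_mul]
    _ ≤ _ := by gcongr

/-- The telescoping estimate read in reverse: one point at which both the Lebesgue value and the
radial sum are controlled suffices to control the average of `|u|` on a nearby ball. -/
theorem setLAverage_enorm_le_radialSum [OpensMeasurableSpace X]
    (h : BallConditions μ ν E K D ρ R₀) (hP : PoincarePair μ E R₀ α p τ C u g) (hp : 0 < p)
    (hq : 0 < q) (hR : 0 < R) (hRR : R ≤ R₀) (hx : x ∈ E) (hy : y ∈ E) (hxy : dist x y < R / 2)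
    (ha : IsLebesguePoint μ u x a) :
    ⨍⁻ z in ball y (R / 2), ‖u z‖ₑ ∂μ ≤ ((K ^ 2 : ℝ≥0) : ℝ≥0∞) * (‖a‖ₑ +
      ((K + 1 : ℝ≥0) : ℝ≥0∞) * (ENNReal.ofReal C * Theta μ ν E α p q τ R *
        radialSum (μ.withDensity fun y => ‖g y‖ₑ ^ p) ν τ p q R x)) := by
  obtain ⟨hsub, hK⟩ := measure_ball_le_of_dist_lt h.doubling hR hRR hy hxy
  have hσ := tsum_meanOsc_le h.doubling' hp hq hP.nonneg hP.poincare hx hR hRR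
  have h1 := ha.enorm_sub_average_le h.doubling hx hP.integrable hR hRR
  have h3 : meanOsc μ u x R ≤ ∑' i : ℕ, meanOsc μ u x (R / 2 ^ i) := by
    simpa using ENNReal.le_tsum (f := fun i : ℕ => meanOsc μ u x (R / 2 ^ i)) 0
  have hx0 := h.doubling.ne_zero h.pos hx hR
  have hxt := h.doubling.ne_top h.pos hx (r := R) (by linarith [h.pos])
  refine (setLAverage_le_mul hsub (h.doubling.ne_zero h.pos hy (by positivity)) hxt hK _).trans ?_
  gcongr
  calc ⨍⁻ z in ball x R, ‖u z‖ₑ ∂μ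
      = ⨍⁻ z in ball x R, ‖u z - 0‖ₑ ∂μ := by simp only [sub_zero]
    _ ≤ meanOsc μ u x R + ‖(⨍ z in ball x R, u z ∂μ) - 0‖ₑ := setLAverage_enorm_sub_le hx0 hxt _ _ _
    _ ≤ meanOsc μ u x R + (‖a‖ₑ + ‖a - ⨍ z in ball x R, u z ∂μ‖ₑ) := by
        gcongr
        calc ‖(⨍ z in ball x R, u z ∂μ) - 0‖ₑ = ‖a - (a - ⨍ z in ball x R, u z ∂μ)‖ₑ := by
              congr 1; ring
          _ ≤ _ := enorm_sub_le
    _ ≤ (∑' i : ℕ, meanOsc μ u x (R / 2 ^ i)) +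
          (‖a‖ₑ + K * ∑' i : ℕ, meanOsc μ u x (R / 2 ^ i)) := by gcongr
    _ = ‖a‖ₑ + ((K + 1 : ℝ≥0) : ℝ≥0∞) * ∑' i : ℕ, meanOsc μ u x (R / 2 ^ i) := by
        rw [ENNReal.coe_add, ENNReal.coe_one]; ring
    _ ≤ _ := by gcongr

theorem PoincarePair.isFiniteMeasure (hP : PoincarePair μ E R₀ α p τ C u g) :
    IsFiniteMeasure (μ.withDensity fun y => ‖g y‖ₑ ^ p) :=
  ⟨by rw [withDensity_apply _ MeasurableSet.univ, setLIntegral_univ]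
      exact hP.energy_ne_top.lt_top⟩

/-- Weak-type bound for the deviation of `u` from its averages. -/
theorem measure_deviationSet_le [OpensMeasurableSpace X] (h : BallConditions μ ν E K D ρ R₀)
    (hW : RadialWeakType ν E τ p q C₁ R₁) (hP : PoincarePair μ E R₀ α p τ C u g) (hp : 0 < p)
    (hq : 0 < q) (hR : 0 < R) (hRR : R ≤ R₀) (hRR₁ : R ≤ R₁)
    (hΘ : Theta μ ν E α p q τ R ≠ ⊤) {t : ℝ≥0∞} (ht0 : t ≠ 0) (ht : t ≠ ⊤) :
    ν (deviationSet μ E R u t) * t ^ q ≤ ((C₁ * (K + K ^ 2) ^ q : ℝ≥0) : ℝ≥0∞) *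
      (ENNReal.ofReal C * Theta μ ν E α p q τ R) ^ q * (∫⁻ y, ‖g y‖ₑ ^ p ∂μ) ^ (q / p) := by
  have := hP.isFiniteMeasure
  set κ := ENNReal.ofReal C * Theta μ ν E α p q τ R with hκ
  set γ := μ.withDensity fun y => ‖g y‖ₑ ^ p with hγ
  have hκt : κ ≠ ⊤ := ENNReal.mul_ne_top ENNReal.ofReal_ne_top hΘ
  set c : ℝ≥0∞ := ((K + K ^ 2 : ℝ≥0) : ℝ≥0∞) * κ with hc
  have hct : c ≠ ⊤ := ENNReal.mul_ne_top ENNReal.coe_ne_top hκt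
  have hsub : deviationSet μ E R u t ⊆ {x | x ∈ E ∧ t < c * radialSum γ ν τ p q R x} := by
    rintro x ⟨hx, y, hy, hxy, a, ha, hta⟩
    refine ⟨hx, hta.trans_le ?_⟩
    rw [hc, mul_assoc]
    exact enorm_sub_average_le_radialSum h hP hp hq hR hRR hx hy hxy ha
  have hγu : γ univ = ∫⁻ y, ‖g y‖ₑ ^ p ∂μ := by
    rw [hγ, withDensity_apply _ MeasurableSet.univ, setLIntegral_univ]
  rcases eq_or_ne c 0 with hc0 | hc0
  · have : deviationSet μ E R u t = ∅ := by
      refine eq_empty_of_subset_empty fun x hx => ?_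
      have := (hsub hx).2
      rw [hc0, zero_mul] at this
      exact not_lt_zero this
    rw [this, measure_empty, zero_mul]
    exact zero_le
  have hsub' : deviationSet μ E R u t ⊆ {x | x ∈ E ∧ t / c < radialSum γ ν τ p q R x} := by
    refine fun x hx => ⟨(hsub hx).1, ?_⟩
    rw [ENNReal.div_lt_iff (Or.inl hc0) (Or.inl hct), mul_comm]
    exact (hsub hx).2
  have key := hW R hR hRR₁ γ this (t / c) (ENNReal.div_ne_zero.2 ⟨ht0, hct⟩)
    (ENNReal.div_ne_top ht hc0)
  have htc : t ^ q = (t / c) ^ q * c ^ q := by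
    rw [← ENNReal.mul_rpow_of_nonneg _ _ hq.le, ENNReal.div_mul_cancel hc0 hct]
  rw [htc, ENNReal.coe_mul, ENNReal.coe_rpow_of_nonneg _ hq.le, mul_assoc (C₁ : ℝ≥0∞),
    ← ENNReal.mul_rpow_of_nonneg _ κ hq.le, ← hc, ← hγu]
  calc ν (deviationSet μ E R u t) * ((t / c) ^ q * c ^ q)
      ≤ (ν {x | x ∈ E ∧ t / c < radialSum γ ν τ p q R x} * (t / c) ^ q) * c ^ q := by
        rw [← mul_assoc]; gcongr
    _ ≤ (C₁ * γ univ ^ (q / p)) * c ^ q := by gcongr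
    _ = _ := by ring

/-- The weak-type bound at the levels `n ^ (1/q)` shows that `n` times the measure stays bounded. -/
theorem RadialWeakType.ae_radialSum_ne_top (hW : RadialWeakType ν E τ p q C₁ R₁) (hq : 0 < q)
    (hp : 0 < p) (hR : 0 < R) (hRR₁ : R ≤ R₁) (γ : Measure X) [IsFiniteMeasure γ] :
    ν {x | x ∈ E ∧ radialSum γ ν τ p q R x = ⊤} = 0 := by
  by_contra hne
  have hB : (C₁ : ℝ≥0∞) * γ univ ^ (q / p) ≠ ⊤ :=
    ENNReal.mul_ne_top ENNReal.coe_ne_top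
      (ENNReal.rpow_ne_top_of_nonneg (by positivity) (measure_ne_top _ _))
  obtain ⟨n, hn⟩ := ENNReal.exists_nat_mul_gt hne hB
  have hn0 : n ≠ 0 := by
    rintro rfl
    simp at hn
  have key := hW R hR hRR₁ γ inferInstance ((n : ℝ≥0∞) ^ (1 / q))
    (by simp [ENNReal.rpow_eq_zero_iff, hn0])
    (ENNReal.rpow_ne_top_of_nonneg (by positivity) (ENNReal.natCast_ne_top n))
  rw [← ENNReal.rpow_mul, one_div_mul_cancel hq.ne', ENNReal.rpow_one] at key
  refine absurd (hn.trans_le (le_trans ?_ key)) (lt_irrefl _)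
  rw [mul_comm]
  gcongr
  rename_i x
  intro hx
  rw [hx]
  exact (ENNReal.rpow_ne_top_of_nonneg (by positivity) (ENNReal.natCast_ne_top n)).lt_top

/-- The measures `μ` and `ν` may be mutually singular, so differentiation of integrals with respect
to `μ` says nothing about `ν`-almost every point. Finiteness of the radial sum takes its place. -/
theorem ae_isLebesguePoint_realRep [OpensMeasurableSpace X] (h : BallConditions μ ν E K D ρ R₀)
    (hW : RadialWeakType ν E τ p q C₁ R₁) (hE : NullMeasurableSet E ν)
    (hP : PoincarePair μ E R₀ α p τ C u g) (hp : 0 < p)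
    (hq : 0 < q) (hR : 0 < R) (hRR : R ≤ R₀) (hRR₁ : R ≤ R₁)
    (hΘ : Theta μ ν E α p q τ R ≠ ⊤) :
    ∀ᵐ x ∂ν.restrict E, x ∈ E ∧ IsLebesguePoint μ u x (realRep μ u x) ∧
      limsupRep μ u x = realRep μ u x := by
  have := hP.isFiniteMeasure
  have h0 := hW.ae_radialSum_ne_top hq hp hR hRR₁ (μ.withDensity fun y => ‖g y‖ₑ ^ p)
  have h1 : ∀ᵐ x ∂ν, x ∈ E → radialSum (μ.withDensity fun y => ‖g y‖ₑ ^ p) ν τ p q R x ≠ ⊤ := by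
    rw [ae_iff]
    refine Eq.trans ?_ h0
    congr 1
    ext x
    simp
  filter_upwards [ae_restrict_mem₀ hE, ae_restrict_of_ae h1] with x hx hxS
  have hsum : ∑' i : ℕ, meanOsc μ u x (R / 2 ^ i) ≠ ⊤ :=
    ne_top_of_le_ne_top (ENNReal.mul_ne_top (ENNReal.mul_ne_top ENNReal.ofReal_ne_top hΘ) (hxS hx))
      (tsum_meanOsc_le h.doubling' hp hq hP.nonneg hP.poincare hx hR hRR)
  obtain ⟨a, ha⟩ := exists_isLebesguePoint h.doubling hx hP.integrable hR hRR hsum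
  have hlim := ha.limsupRep_eq h.doubling h.pos hx hP.integrable
  have hrep : realRep μ u x = a := by rw [realRep, hlim, EReal.toReal_coe]
  exact ⟨hx, by rwa [hrep], by rw [hrep, hlim]⟩

end Estimates

/-! ### Measurability and norms of the representative. -/

section Representative

variable {μ ν : Measure X} {E : Set X} {K D ρ : ℝ≥0} {R₀ : ℝ} {u : X → ℝ}

theorem aemeasurable_realRep [OpensMeasurableSpace X] (h : BallConditions μ ν E K D ρ R₀)
    (hu : IntegrableOnBalls μ u)
    (hL : ∀ᵐ x ∂ν.restrict E, x ∈ E ∧ IsLebesguePoint μ u x (realRep μ u x) ∧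
      limsupRep μ u x = realRep μ u x) : AEMeasurable (realRep μ u) (ν.restrict E) := by
  refine aemeasurable_of_tendsto_metrizable_ae atTop
    (f := fun (n : ℕ) x => ⨍ y in ball x (1 / ((n : ℝ) + 1)), u y ∂μ)
    (fun n => (measurable_setAverage_ball fun x => hu x _).aemeasurable) ?_
  filter_upwards [hL] with x hx
  refine (hx.2.1.tendsto_average h.doubling h.pos hx.1 fun z _ r _ _ => hu z r).comp ?_
  refine tendsto_nhdsWithin_iff.2 ⟨tendsto_one_div_add_atTop_nhds_zero_nat,
    Eventually.of_forall fun n => ?_⟩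
  have : (0 : ℝ) < 1 / ((n : ℝ) + 1) := by positivity
  exact this

omit [MetricSpace X] in
theorem extLpNorm_eq_of_ae {f : X → EReal} {w : X → ℝ} (q : ℝ)
    (h : ∀ᵐ x ∂ν.restrict E, f x = w x) :
    extLpNorm ν E q f = (∫⁻ x, ‖w x‖ₑ ^ q ∂ν.restrict E) ^ (1 / q) := by
  rw [extLpNorm]
  congr 1
  refine lintegral_congr_ae ?_
  filter_upwards [h] with x hx
  rw [hx, EReal.abs_def, Real.enorm_eq_ofReal_abs]

omit [MetricSpace X] in
theorem extMemLp_of_ae {f : X → EReal} {w : X → ℝ} {q : ℝ} (hq : 0 < q)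
    (h : ∀ᵐ x ∂ν.restrict E, f x = w x) (hw : AEMeasurable w (ν.restrict E))
    (hfin : ∫⁻ x, ‖w x‖ₑ ^ q ∂ν.restrict E ≠ ⊤) : ExtMemLp ν E q f := by
  refine ⟨hw.coe_real_ereal.congr ?_, ?_⟩
  · filter_upwards [h] with x hx
    exact hx.symm
  · rw [extLpNorm_eq_of_ae q h]
    exact ENNReal.rpow_lt_top_of_nonneg (by positivity) hfin

end Representative

/-! ### Finite covers of `E`. -/

section Covers

variable {E : Set X} {ν : Measure X}

omit [MeasurableSpace X] in
theorem exists_finset_cover (hE : TotallyBounded E) {ε : ℝ} (hε : 0 < ε) :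
    ∃ J : Finset X, (∀ y ∈ J, y ∈ E) ∧ ∀ x ∈ E, ∃ y ∈ J, dist x y < ε := by
  obtain ⟨t, htE, htf, hcov⟩ := Metric.finite_approx_of_totallyBounded hE ε hε
  refine ⟨htf.toFinset, fun y hy => htE (htf.mem_toFinset.1 hy), fun x hx => ?_⟩
  obtain ⟨y, hy, hxy⟩ := mem_iUnion₂.1 (hcov hx)
  exact ⟨y, htf.mem_toFinset.2 hy, hxy⟩

/-- Balls meeting `E` in a null set are discarded, since the norm of `ū` in `L^1(E, ν)` gives no
information about averages over them. -/
theorem exists_finset_ae_cover (hE : TotallyBounded E) (hEm : NullMeasurableSet E ν) {ε : ℝ}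
    (hε : 0 < ε) :
    ∃ J : Finset X, (∀ y ∈ J, y ∈ E ∧ ν (E ∩ ball y ε) ≠ 0) ∧
      ∀ᵐ x ∂ν.restrict E, ∃ y ∈ J, dist x y < ε := by
  classical
  obtain ⟨J, hJE, hJ⟩ := exists_finset_cover hE hε
  refine ⟨J.filter fun y => ν (E ∩ ball y ε) ≠ 0, fun y hy => ?_, ?_⟩
  · rw [Finset.mem_filter] at hy
    exact ⟨hJE y hy.1, hy.2⟩
  · have hnull : ∀ᵐ x ∂ν, ∀ y ∈ J, ν (E ∩ ball y ε) = 0 → x ∉ E ∩ ball y ε := by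
      rw [Filter.eventually_all_finset]
      intro y _
      by_cases hy : ν (E ∩ ball y ε) = 0
      · filter_upwards [measure_eq_zero_iff_ae_notMem.1 hy] with x hx _
        exact hx
      · exact Eventually.of_forall fun x h => absurd h hy
    filter_upwards [ae_restrict_of_ae hnull, ae_restrict_mem₀ hEm] with x hx hxE
    obtain ⟨y, hy, hxy⟩ := hJ x hxE
    exact ⟨y, Finset.mem_filter.2 ⟨hy, fun h0 => hx y hy h0 ⟨hxE, hxy⟩⟩, hxy⟩

variable {K : ℝ≥0} {R₀ : ℝ}

theorem exists_measure_ball_le (hE : TotallyBounded E) (hν : DoublingBalls ν E K R₀)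
    (hR : 0 < R₀) : ∃ V : ℝ≥0∞, V ≠ ⊤ ∧ ν E ≤ V ∧ ∀ x ∈ E, ν (ball x R₀) ≤ V := by
  obtain ⟨J, hJE, hJ⟩ := exists_finset_cover hE hR
  refine ⟨∑ y ∈ J, ν (ball y (2 * R₀)), ?_, ?_, fun x hx => ?_⟩
  · exact ENNReal.sum_ne_top.2 fun y hy => hν.ne_top hR (hJE y hy) le_rfl
  · refine (measure_mono (t := ⋃ y ∈ J, ball y (2 * R₀)) fun x hx => ?_).trans
      (measure_biUnion_finset_le J _)
    obtain ⟨y, hy, hxy⟩ := hJ x hx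
    exact mem_iUnion₂.2 ⟨y, hy, by rw [mem_ball]; linarith⟩
  · obtain ⟨y, hy, hxy⟩ := hJ x hx
    refine (measure_mono (ball_subset_ball' (?_ : R₀ + dist x y ≤ 2 * R₀))).trans
      (Finset.single_le_sum (f := fun y => ν (ball y (2 * R₀))) (fun _ _ => zero_le) hy)
    linarith

end Covers

/-! ### Dependence of the local Poincaré constant on radius and exponent. -/

section Theta

variable {μ ν : Measure X} {E : Set X} {K D ρ : ℝ≥0} {R₀ α p q s τ : ℝ}

theorem Theta_mono {r r' : ℝ} (h : r ≤ r') :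
    Theta μ ν E α p q τ r ≤ Theta μ ν E α p q τ r' := by
  refine iSup₂_le fun ρ hρ => ?_
  exact le_iSup₂_of_le (f := fun ρ (_ : ρ ∈ Ioc 0 r') => ⨆ x ∈ E,
    ENNReal.ofReal (ρ ^ α) * ν (ball x ρ) ^ (1 / q) / μ (ball x (τ * ρ)) ^ (1 / p)) ρ
    ⟨hρ.1, hρ.2.trans h⟩ le_rfl

/-- Lowering the exponent makes the local Poincaré constant vanish at zero. -/
theorem tendsto_Theta_of_lt (h : BallConditions μ ν E K D ρ R₀) (hE : TotallyBounded E)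
    (hs : 0 < s) (hsq : s < q) (hΘ : Theta μ ν E α p q τ R₀ ≠ ⊤) :
    Tendsto (fun r : ℝ => Theta μ ν E α p s τ r) (𝓝[>] 0) (𝓝 0) := by
  have hq : 0 < q := hs.trans hsq
  set e := 1 / s - 1 / q with he
  have he0 : 0 < e := sub_pos.2 (one_div_lt_one_div_of_lt hs hsq)
  obtain ⟨V, hV, -, hVb⟩ := exists_measure_ball_le hE h.doubling' h.pos
  have hlim : Tendsto (fun n : ℕ => Theta μ ν E α p q τ R₀ * (D * ρ ^ n * V) ^ e) atTop
      (𝓝 (Theta μ ν E α p q τ R₀ * (D * 0 * V) ^ e)) := by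
    refine ENNReal.Tendsto.const_mul ?_ (Or.inr ?_)
    · refine (ENNReal.continuous_rpow_const.tendsto _).comp ?_
      refine ENNReal.Tendsto.mul_const (ENNReal.Tendsto.const_mul ?_ (Or.inr ENNReal.coe_ne_top))
        (Or.inr hV)
      exact ENNReal.tendsto_pow_atTop_nhds_zero_of_lt_one (by exact_mod_cast h.rho_lt_one)
    · exact hΘ
  rw [mul_zero, zero_mul, ENNReal.zero_rpow_of_pos he0, mul_zero] at hlim
  refine ENNReal.tendsto_nhds_zero.2 fun ε hε => ?_
  obtain ⟨n, hn⟩ := ((ENNReal.tendsto_nhds_zero.1 hlim) ε hε).exists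
  have hnpos : 0 < R₀ / 2 ^ n := div_pos h.pos (by positivity)
  filter_upwards [Ioc_mem_nhdsGT hnpos] with r hr
  refine (iSup₂_le fun t ht => iSup₂_le fun x hx => ?_).trans hn
  have htn : t ≤ R₀ / 2 ^ n := ht.2.trans hr.2
  have htR : t ≤ R₀ := htn.trans (div_le_self h.pos.le (one_le_pow₀ (by norm_num)))
  have h0 := h.doubling'.ne_zero h.pos hx ht.1
  have htop := h.doubling'.ne_top h.pos hx (r := t) (by linarith [h.pos])
  have hball : ν (ball x t) ≤ D * ρ ^ n * V :=
    (measure_mono (ball_subset_ball htn)).trans ((h.decay x hx R₀ h.pos le_rfl n).trans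
      (by gcongr; exact hVb x hx))
  -- The spare power `e = 1/s - 1/q` of `ν (ball x t)` tends to zero uniformly in `x ∈ E`, by the
  -- decay and the uniform bound `V`.
  have hsplit : ν (ball x t) ^ (1 / s) = ν (ball x t) ^ (1 / q) * ν (ball x t) ^ e := by
    rw [← ENNReal.rpow_add _ _ h0 htop]; congr 1; rw [he]; ring
  have hΘt : ENNReal.ofReal (t ^ α) * ν (ball x t) ^ (1 / q) / μ (ball x (τ * t)) ^ (1 / p) ≤
      Theta μ ν E α p q τ R₀ :=
    le_iSup₂_of_le t ⟨ht.1, htR⟩ (le_iSup₂_of_le x hx le_rfl)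
  calc ENNReal.ofReal (t ^ α) * ν (ball x t) ^ (1 / s) / μ (ball x (τ * t)) ^ (1 / p)
      = ENNReal.ofReal (t ^ α) * ν (ball x t) ^ (1 / q) / μ (ball x (τ * t)) ^ (1 / p) *
          ν (ball x t) ^ e := by
        rw [hsplit, div_eq_mul_inv, div_eq_mul_inv (_ * _) (μ (ball x (τ * t)) ^ (1 / p))]; ring
    _ ≤ _ := by gcongr

end Theta

/-! ### Averages controlled by either norm. -/

section AverageBounds

variable {μ ν : Measure X} {E : Set X} {K D ρ C₁ : ℝ≥0} {R₀ R₁ R α p q τ C : ℝ} {y : X}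

/-- Averages of `|u|` over a ball meeting `E` in positive measure are controlled by the
`L¹(E, ν)`-norm of the representative and the energy. -/
theorem exists_setLAverage_le_target [OpensMeasurableSpace X] (h : BallConditions μ ν E K D ρ R₀)
    (hW : RadialWeakType ν E τ p q C₁ R₁) (hE : NullMeasurableSet E ν) (hp : 0 < p)
    (hq : 0 < q) (hR : 0 < R) (hRR : R ≤ R₀) (hRR₁ : R ≤ R₁)
    (hΘ : Theta μ ν E α p q τ R ≠ ⊤) (hy : y ∈ E) (hpos : ν (E ∩ ball y (R / 2)) ≠ 0) :
    ∃ B : ℝ≥0∞, B ≠ ⊤ ∧ ∀ u g : X → ℝ, PoincarePair μ E R₀ α p τ C u g →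
      AEMeasurable (realRep μ u) (ν.restrict E) →
      ∀ M : ℝ≥0∞, M ≠ 0 → M ≠ ⊤ → ∫⁻ x, ‖realRep μ u x‖ₑ ∂ν.restrict E ≤ M →
        ∫⁻ x, ‖g x‖ₑ ^ p ∂μ ≤ M ^ p →
        ⨍⁻ z in ball y (R / 2), ‖u z‖ₑ ∂μ ≤ B * M := by
  set n := ν (E ∩ ball y (R / 2)) with hn
  have hnt : n ≠ ⊤ := ne_top_of_le_ne_top
    (h.doubling'.ne_top h.pos hy (r := R / 2) (by linarith)) (measure_mono inter_subset_right)
  -- The constants `b₁` and `b₂` are chosen so that Chebyshev's inequality and the weak-type bound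
  -- each exclude at most a third of `E ∩ ball y (R / 2)`; a good point then remains.
  set b₁ : ℝ≥0∞ := 3 / n with hb₁
  set b₂ : ℝ≥0∞ := (3 * (C₁ + 1) / n) ^ (1 / q) with hb₂
  have hb₁0 : b₁ ≠ 0 := ENNReal.div_ne_zero.2 ⟨by norm_num, hnt⟩
  have hb₁t : b₁ ≠ ⊤ := ENNReal.div_ne_top (by norm_num) hpos
  have hbb0 : 3 * ((C₁ : ℝ≥0∞) + 1) / n ≠ 0 := ENNReal.div_ne_zero.2 ⟨by simp, hnt⟩
  have hbbt : 3 * ((C₁ : ℝ≥0∞) + 1) / n ≠ ⊤ := ENNReal.div_ne_top (by finiteness) hpos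
  have hb₂0 : b₂ ≠ 0 := by
    rw [hb₂]
    exact (ENNReal.rpow_pos (pos_iff_ne_zero.2 hbb0) hbbt).ne'
  have hb₂t : b₂ ≠ ⊤ := ENNReal.rpow_ne_top_of_nonneg (by positivity) hbbt
  refine ⟨((K ^ 2 : ℝ≥0) : ℝ≥0∞) * (b₁ +
    ((K + 1 : ℝ≥0) : ℝ≥0∞) * (ENNReal.ofReal C * Theta μ ν E α p q τ R * b₂)), ?_,
    fun u g hP hmeas M hM0 hMt hu hg => ?_⟩
  · refine ENNReal.mul_ne_top ENNReal.coe_ne_top (ENNReal.add_ne_top.2 ⟨hb₁t, ?_⟩)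
    exact ENNReal.mul_ne_top ENNReal.coe_ne_top
      (ENNReal.mul_ne_top (ENNReal.mul_ne_top ENNReal.ofReal_ne_top hΘ) hb₂t)
  have := hP.isFiniteMeasure
  set γ := μ.withDensity fun y => ‖g y‖ₑ ^ p with hγ
  have hγu : γ univ = ∫⁻ y, ‖g y‖ₑ ^ p ∂μ := by
    rw [hγ, withDensity_apply _ MeasurableSet.univ, setLIntegral_univ]
  have hae := ae_isLebesguePoint_realRep h hW hE hP hp hq hR hRR hRR₁ hΘ
  obtain ⟨x, ⟨hxE, hxL, -⟩, hxy, hx1, hx2⟩ : ∃ x, (x ∈ E ∧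
      IsLebesguePoint μ u x (realRep μ u x) ∧ limsupRep μ u x = realRep μ u x) ∧
      x ∈ ball y (R / 2) ∧ ‖realRep μ u x‖ₑ < b₁ * M ∧ radialSum γ ν τ p q R x ≤ b₂ * M := by
    by_contra! hcon
    have hcov : ∀ᵐ x ∂ν.restrict E, x ∈ ball y (R / 2) →
        x ∈ {x | b₁ * M ≤ ‖realRep μ u x‖ₑ} ∪ {x | x ∈ E ∧ b₂ * M < radialSum γ ν τ p q R x} := by
      filter_upwards [hae] with x hx hxb
      by_cases hx1 : b₁ * M ≤ ‖realRep μ u x‖ₑ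
      · exact Or.inl hx1
      · exact Or.inr ⟨hx.1, hcon x hx hxb (not_le.1 hx1)⟩
    have h1 : ν.restrict E {x | b₁ * M ≤ ‖realRep μ u x‖ₑ} ≤ n / 3 := by
      have := mul_meas_ge_le_lintegral₀ hmeas.enorm (b₁ * M)
      have h2 : M * (b₁ * ν.restrict E {x | b₁ * M ≤ ‖realRep μ u x‖ₑ}) ≤ M * 1 := by
        rw [mul_one]
        refine le_trans (le_of_eq (by ring)) (this.trans hu)
      have h3 := (ENNReal.mul_le_mul_iff_right hM0 hMt).1 h2
      rw [mul_comm] at h3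
      have h4 := (ENNReal.le_div_iff_mul_le (Or.inl hb₁0) (Or.inl hb₁t)).2 h3
      refine h4.trans (le_of_eq ?_)
      rw [hb₁, one_div, ENNReal.inv_div (Or.inl hnt) (Or.inl hpos)]
    have h2 : ν {x | x ∈ E ∧ b₂ * M < radialSum γ ν τ p q R x} ≤ n / 3 := by
      have key := hW R hR hRR₁ γ this (b₂ * M) (mul_ne_zero hb₂0 hM0) (ENNReal.mul_ne_top hb₂t hMt)
      have hΓ : γ univ ^ (q / p) ≤ M ^ q := by
        rw [hγu]
        refine (ENNReal.rpow_le_rpow hg (by positivity)).trans (le_of_eq ?_)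
        rw [← ENNReal.rpow_mul, mul_div_cancel₀ _ hp.ne']
      rw [ENNReal.mul_rpow_of_nonneg _ _ hq.le, hb₂, ← ENNReal.rpow_mul,
        one_div_mul_cancel hq.ne', ENNReal.rpow_one, ← mul_assoc] at key
      have key2 := key.trans (mul_le_mul' (le_self_add (b := 1)) hΓ)
      have hMq0 : M ^ q ≠ 0 := by simp [ENNReal.rpow_eq_zero_iff, hM0, hMt]
      have key3 := (ENNReal.mul_le_mul_iff_left hMq0
        (ENNReal.rpow_ne_top_of_nonneg hq.le hMt)).1 key2
      have hc0 : (C₁ : ℝ≥0∞) + 1 ≠ 0 := by simp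
      have key4 := (ENNReal.le_div_iff_mul_le (Or.inl hbb0) (Or.inl hbbt)).2 key3
      refine key4.trans (le_of_eq ?_)
      rw [div_eq_mul_inv, ENNReal.inv_div (Or.inl hnt) (Or.inl hpos), div_eq_mul_inv,
        ENNReal.mul_inv (Or.inl (by norm_num)) (Or.inl (by norm_num)), div_eq_mul_inv]
      calc ((C₁ : ℝ≥0∞) + 1) * (n * (3⁻¹ * ((C₁ : ℝ≥0∞) + 1)⁻¹))
          = n * 3⁻¹ * (((C₁ : ℝ≥0∞) + 1) * ((C₁ : ℝ≥0∞) + 1)⁻¹) := by ring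
        _ = n * 3⁻¹ := by rw [ENNReal.mul_inv_cancel hc0 (by finiteness), mul_one]
    have hle : n ≤ n / 3 + n / 3 := by
      calc n = ν.restrict E (ball y (R / 2)) := by
            rw [Measure.restrict_apply measurableSet_ball, inter_comm]
        _ ≤ ν.restrict E ({x | b₁ * M ≤ ‖realRep μ u x‖ₑ} ∪
              {x | x ∈ E ∧ b₂ * M < radialSum γ ν τ p q R x}) := measure_mono_ae hcov
        _ ≤ _ := (measure_union_le _ _).trans
              (add_le_add h1 ((Measure.restrict_le_self _).trans h2))
    have hlt : n / 3 + n / 3 < n := by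
      have h3 : n / 3 + n / 3 + n / 3 = n := ENNReal.add_thirds n
      have hn3 : n / 3 ≠ 0 := ENNReal.div_ne_zero.2 ⟨hpos, by norm_num⟩
      conv_rhs => rw [← h3]
      exact ENNReal.lt_add_right
        (ENNReal.add_ne_top.2 ⟨ENNReal.div_ne_top hnt (by norm_num),
          ENNReal.div_ne_top hnt (by norm_num)⟩) hn3
    exact absurd hle (not_le.2 hlt)
  refine (setLAverage_enorm_le_radialSum h hP hp hq hR hRR hxE hy hxy hxL).trans ?_
  calc ((K ^ 2 : ℝ≥0) : ℝ≥0∞) * (‖realRep μ u x‖ₑ + ((K + 1 : ℝ≥0) : ℝ≥0∞) *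
        (ENNReal.ofReal C * Theta μ ν E α p q τ R * radialSum γ ν τ p q R x))
      ≤ ((K ^ 2 : ℝ≥0) : ℝ≥0∞) * (b₁ * M + ((K + 1 : ℝ≥0) : ℝ≥0∞) *
        (ENNReal.ofReal C * Theta μ ν E α p q τ R * (b₂ * M))) := by gcongr
    _ = _ := by ring

theorem exists_setLAverage_le_domain (h : BallConditions μ ν E K D ρ R₀) (hR : 0 < R)
    (hy : y ∈ E) :
    ∃ B : ℝ≥0∞, B ≠ ⊤ ∧ ∀ (u : X → ℝ) (M : ℝ≥0∞), ∫⁻ x, ‖u x‖ₑ ∂μ ≤ M →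
        ⨍⁻ z in ball y (R / 2), ‖u z‖ₑ ∂μ ≤ B * M := by
  refine ⟨(μ (ball y (R / 2)))⁻¹, ENNReal.inv_ne_top.2 (h.doubling.ne_zero h.pos hy (by positivity)),
    fun u M hu => ?_⟩
  rw [setLAverage_eq, div_eq_mul_inv, mul_comm]
  gcongr
  exact (setLIntegral_le_lintegral _ _).trans hu

end AverageBounds

/-! ### Maz'ya's truncation method. -/

section Truncation

variable {μ ν : Measure X} {E : Set X} {K D ρ C₁ : ℝ≥0} {R₀ R₁ R α p q τ C L : ℝ} {u g w : X → ℝ}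

/-- The pairs of truncations of `u` and restrictions of `g` are Poincaré pairs. -/
def TruncationPairs (μ : Measure X) (E : Set X) (R₀ α p τ C : ℝ) (u g : X → ℝ) : Prop :=
  ∀ l k : ℝ, l < k →
    PoincarePair μ E R₀ α p τ C (truncate l k u) ({x | l < u x ∧ u x < k}.indicator g)

/-- Truncating `-u` at `l`, `k` is minus the truncation of `u` at `-k`, `-l`, with the same
restriction of `g`. This transfers estimates for upper level sets to lower ones. -/
theorem TruncationPairs.neg (h : TruncationPairs μ E R₀ α p τ C u g) :
    TruncationPairs μ E R₀ α p τ C (fun x => -u x) g := by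
  intro l k hlk
  have := (h (-k) (-l) (neg_lt_neg hlk)).neg
  convert this using 1
  · funext x
    simp only [truncate]
    rw [← min_neg_neg, ← max_neg_neg]
    simp only [neg_neg]
    rcases le_total (-u x) k with h1 | h1 <;> rcases le_total (-u x) l with h2 | h2 <;>
      simp [h1, h2, hlk.le]
    linarith
  · congr 1
    ext x
    constructor
    · rintro ⟨h1, h2⟩
      exact ⟨by linarith, by linarith⟩
    · rintro ⟨h1, h2⟩
      exact ⟨by linarith, by linarith⟩

/-- Weak-type bound at a single dyadic level. -/
theorem measure_lt_mul_rpow_le [OpensMeasurableSpace X] (h : BallConditions μ ν E K D ρ R₀)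
    (hW : RadialWeakType ν E τ p q C₁ R₁)
    (hT : TruncationPairs μ E R₀ α p τ C u g) (hp : 0 < p)
    (hq : 0 < q) (hR : 0 < R) (hRR : R ≤ R₀) (hRR₁ : R ≤ R₁)
    (hΘ : Theta μ ν E α p q τ R ≠ ⊤) {s : ℝ} (hs : 0 < s)
    (hw : ∀ᵐ x ∂ν.restrict E, x ∈ E ∧ IsLebesguePoint μ u x (w x))
    (hcov : ∀ᵐ x ∂ν.restrict E, ∃ y ∈ E, dist x y < R / 2 ∧
      ⨍⁻ z in ball y (R / 2), ‖u z‖ₑ ∂μ ≤ ENNReal.ofReal (s / 4)) :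
    ν.restrict E {x | s < w x} * ENNReal.ofReal s ^ q ≤
      8 ^ q * (((C₁ * (K + K ^ 2) ^ q : ℝ≥0) : ℝ≥0∞) *
        (ENNReal.ofReal C * Theta μ ν E α p q τ R) ^ q) *
        (∫⁻ y, ‖{x | s / 2 < u x ∧ u x < s}.indicator g y‖ₑ ^ p ∂μ) ^ (q / p) := by
  have hP := hT (s / 2) s (half_lt_self hs)
  have h8 : ENNReal.ofReal s = 8 * ENNReal.ofReal (s / 8) := by
    rw [← ENNReal.ofReal_ofNat, ← ENNReal.ofReal_mul (by norm_num)]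
    congr 1; ring
  have key := measure_deviationSet_le h hW hP hp hq hR hRR hRR₁ hΘ
    (t := ENNReal.ofReal (s / 8)) (by simpa using hs) ENNReal.ofReal_ne_top
  have hsub : ν.restrict E {x | s < w x} ≤
      ν (deviationSet μ E R (truncate (s / 2) s u) (ENNReal.ofReal (s / 8))) := by
    refine le_trans (measure_mono_ae ?_) (Measure.restrict_le_self _)
    filter_upwards [hw, hcov] with x hx hxc hsw
    obtain ⟨y, hy, hxy, hav⟩ := hxc
    have hLp := hx.2.truncate (s / 2) s
    have hsw' : s < w x := hsw
    rw [min_eq_right hsw'.le, max_eq_right (half_le_self hs.le)] at hLp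
    refine ⟨hx.1, y, hy, hxy, s, hLp, ?_⟩
    -- The truncation exceeds `s / 2` by at most `|u|`, so its average is at most `3 * s / 4`. Its
    -- Lebesgue value at `x` is `s`, which leaves a deviation of at least `s / 4 > s / 8`.
    have hnear : ‖(⨍ z in ball y (R / 2), truncate (s / 2) s u z ∂μ) - s / 2‖ₑ ≤
        ENNReal.ofReal (s / 4) := by
      refine (enorm_setAverage_sub_le (h.doubling.ne_zero h.pos hy (by positivity))
        (h.doubling.ne_top h.pos hy (r := R / 2) (by linarith))
        (hP.integrable y hy _ (by positivity) (by linarith)) _).trans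
        ((setLAverage_mono fun z => ?_).trans hav)
      rw [Real.enorm_eq_ofReal_abs, Real.enorm_eq_ofReal_abs]
      refine ENNReal.ofReal_le_ofReal ?_
      simp only [truncate]
      rw [abs_of_nonneg (sub_nonneg.2 (le_max_left _ _)), sub_le_iff_le_add]
      refine max_le (by linarith [abs_nonneg (u z)]) ?_
      exact (min_le_left _ _).trans (by linarith [le_abs_self (u z)])
    rw [Real.enorm_eq_ofReal_abs, ENNReal.ofReal_le_ofReal_iff (by positivity)] at hnear
    rw [Real.enorm_eq_ofReal_abs, ENNReal.ofReal_lt_ofReal_iff_of_nonneg (by positivity)]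
    have h1 := (abs_le.1 hnear).2
    refine lt_of_lt_of_le ?_ (le_abs_self _)
    linarith
  rw [h8, ENNReal.mul_rpow_of_nonneg _ _ hq.le]
  calc ν.restrict E {x | s < w x} * (8 ^ q * ENNReal.ofReal (s / 8) ^ q)
      = 8 ^ q * (ν.restrict E {x | s < w x} * ENNReal.ofReal (s / 8) ^ q) := by ring
    _ ≤ 8 ^ q * (ν (deviationSet μ E R (truncate (s / 2) s u) (ENNReal.ofReal (s / 8))) *
          ENNReal.ofReal (s / 8) ^ q) := by gcongr
    _ ≤ 8 ^ q * (((C₁ * (K + K ^ 2) ^ q : ℝ≥0) : ℝ≥0∞) *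
      (ENNReal.ofReal C * Theta μ ν E α p q τ R) ^ q * (∫⁻ y,
        ‖{x | s / 2 < u x ∧ u x < s}.indicator g y‖ₑ ^ p ∂μ) ^ (q / p)) := by gcongr
    _ = _ := by ring

omit [MetricSpace X] in
-- The dyadic level strips are pairwise disjoint, so at each point at most one term is nonzero.
theorem tsum_energy_dyadic_le (hp : 0 < p) (hL : 0 < L) (hu : AEMeasurable u μ)
    (hg : AEMeasurable g μ) :
    ∑' k : ℕ, ∫⁻ y, ‖{x | 2 ^ k * L / 2 < u x ∧ u x < 2 ^ k * L}.indicator g y‖ₑ ^ p ∂μ ≤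
      ∫⁻ y, ‖g y‖ₑ ^ p ∂μ := by
  have hset : ∀ k : ℕ, NullMeasurableSet {x | 2 ^ k * L / 2 < u x ∧ u x < 2 ^ k * L} μ := fun k =>
    (nullMeasurableSet_lt aemeasurable_const hu).inter (nullMeasurableSet_lt hu aemeasurable_const)
  rw [← lintegral_tsum fun k => ((hg.indicator₀ (hset k)).enorm.pow_const p)]
  refine lintegral_mono fun y => ?_
  by_cases hex : ∃ k : ℕ, y ∈ {x | 2 ^ k * L / 2 < u x ∧ u x < 2 ^ k * L}
  · obtain ⟨k, hk⟩ := hex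
    rw [tsum_eq_single k]
    · rw [indicator_of_mem hk]
    · intro j hj
      rw [indicator_of_notMem, enorm_zero, ENNReal.zero_rpow_of_pos hp]
      rintro ⟨h1, h2⟩
      obtain ⟨h3, h4⟩ := hk
      rcases lt_or_gt_of_ne hj with hlt | hlt
      · have : (2 : ℝ) ^ (j + 1) ≤ 2 ^ k := pow_le_pow_right₀ (by norm_num) hlt
        rw [pow_succ] at this
        nlinarith
      · have : (2 : ℝ) ^ (k + 1) ≤ 2 ^ j := pow_le_pow_right₀ (by norm_num) hlt
        rw [pow_succ] at this
        nlinarith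
  · have hzero : ∀ k : ℕ,
        ‖{x | 2 ^ k * L / 2 < u x ∧ u x < 2 ^ k * L}.indicator g y‖ₑ ^ p = 0 := by
      intro k
      rw [indicator_of_notMem (fun hy => hex ⟨k, hy⟩), enorm_zero, ENNReal.zero_rpow_of_pos hp]
    simp [hzero]

/-- The single-level bounds are summed using `q / p ≥ 1` and the disjointness of the strips. The
smallness of the averages at level `L` implies it at every level `2 ^ k * L`. -/
theorem tsum_measure_lt_mul_rpow_le [OpensMeasurableSpace X] (h : BallConditions μ ν E K D ρ R₀)
    (hW : RadialWeakType ν E τ p q C₁ R₁)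
    (hT : TruncationPairs μ E R₀ α p τ C u g) (hp : 0 < p)
    (hpq : p ≤ q) (hR : 0 < R) (hRR : R ≤ R₀) (hRR₁ : R ≤ R₁)
    (hΘ : Theta μ ν E α p q τ R ≠ ⊤) (hL : 0 < L)
    (hu : AEMeasurable u μ) (hg : AEMeasurable g μ)
    (hw : ∀ᵐ x ∂ν.restrict E, x ∈ E ∧ IsLebesguePoint μ u x (w x))
    (hcov : ∀ᵐ x ∂ν.restrict E, ∃ y ∈ E, dist x y < R / 2 ∧
      ⨍⁻ z in ball y (R / 2), ‖u z‖ₑ ∂μ ≤ ENNReal.ofReal (L / 4)) :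
    ∑' k : ℕ, ν.restrict E {x | 2 ^ k * L < w x} * ENNReal.ofReal (2 ^ k * L) ^ q ≤
      8 ^ q * (((C₁ * (K + K ^ 2) ^ q : ℝ≥0) : ℝ≥0∞) *
        (ENNReal.ofReal C * Theta μ ν E α p q τ R) ^ q) *
        (∫⁻ y, ‖g y‖ₑ ^ p ∂μ) ^ (q / p) := by
  have hq : 0 < q := hp.trans_le hpq
  refine le_trans (ENNReal.tsum_le_tsum fun k => ?_) (le_trans
    (le_of_eq ENNReal.tsum_mul_left) (mul_le_mul' le_rfl (tsum_rpow_le_rpow _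
      (tsum_energy_dyadic_le hp hL hu hg) ((one_le_div hp).2 hpq))))
  refine measure_lt_mul_rpow_le h hW hT hp hq hR hRR hRR₁ hΘ (by positivity) hw ?_
  filter_upwards [hcov] with x hx
  obtain ⟨y, hy, hxy, hav⟩ := hx
  refine ⟨y, hy, hxy, hav.trans (ENNReal.ofReal_le_ofReal ?_)⟩
  have : (1 : ℝ) ≤ 2 ^ k := one_le_pow₀ (by norm_num)
  nlinarith

/-- Strong-type tail bound obtained by truncation. -/
theorem lintegral_tail_le [OpensMeasurableSpace X] (h : BallConditions μ ν E K D ρ R₀)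
    (hW : RadialWeakType ν E τ p q C₁ R₁)
    (hT : TruncationPairs μ E R₀ α p τ C u g) (hp : 0 < p)
    (hpq : p ≤ q) (hR : 0 < R) (hRR : R ≤ R₀) (hRR₁ : R ≤ R₁)
    (hΘ : Theta μ ν E α p q τ R ≠ ⊤) (hL : 0 < L)
    (hu : AEMeasurable u μ) (hg : AEMeasurable g μ)
    (hw : ∀ᵐ x ∂ν.restrict E, x ∈ E ∧ IsLebesguePoint μ u x (w x))
    (hwm : AEMeasurable w (ν.restrict E))
    (hcov : ∀ᵐ x ∂ν.restrict E, ∃ y ∈ E, dist x y < R / 2 ∧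
      ⨍⁻ z in ball y (R / 2), ‖u z‖ₑ ∂μ ≤ ENNReal.ofReal (L / 4)) :
    ∫⁻ x in {x | ENNReal.ofReal L < ‖w x‖ₑ}, ‖w x‖ₑ ^ q ∂ν.restrict E ≤
      2 ^ q * (2 * (8 ^ q * (((C₁ * (K + K ^ 2) ^ q : ℝ≥0) : ℝ≥0∞) *
        (ENNReal.ofReal C * Theta μ ν E α p q τ R) ^ q) *
        (∫⁻ y, ‖g y‖ₑ ^ p ∂μ) ^ (q / p))) := by
  have hq : 0 < q := hp.trans_le hpq
  have h1 := tsum_measure_lt_mul_rpow_le h hW hT hp hpq hR hRR hRR₁ hΘ hL hu hg hw hcov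
  -- The set where `|w|` is large splits into the upper level sets of `w` and of `-w`; hence the
  -- factor 2.
  have h2 := tsum_measure_lt_mul_rpow_le (w := fun x => -w x) h hW hT.neg hp hpq hR hRR hRR₁ hΘ hL
    hu.neg hg (by filter_upwards [hw] with x hx using ⟨hx.1, hx.2.neg⟩)
    (by simpa only [enorm_neg] using hcov)
  refine (lintegral_rpow_le_tsum _ hwm.enorm hq (by simpa using hL) ENNReal.ofReal_ne_top).trans ?_
  rw [two_mul]
  refine le_trans ?_ (mul_le_mul' le_rfl (add_le_add h1 h2))
  rw [← ENNReal.tsum_add, ← ENNReal.tsum_mul_left]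
  refine ENNReal.tsum_le_tsum fun k => ?_
  have e : (2 : ℝ≥0∞) ^ k * ENNReal.ofReal L = ENNReal.ofReal (2 ^ k * L) := by
    rw [ENNReal.ofReal_mul (by positivity), ENNReal.ofReal_pow (by norm_num),
      ENNReal.ofReal_ofNat]
  rw [pow_succ, mul_comm _ (2 : ℝ≥0∞), mul_assoc, ENNReal.mul_rpow_of_nonneg _ _ hq.le, e,
    mul_assoc, ← add_mul, mul_comm (ENNReal.ofReal (2 ^ k * L) ^ q)]
  gcongr
  refine le_trans (measure_mono ?_) (measure_union_le _ _)
  intro x hx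
  have hx' : ENNReal.ofReal (2 ^ k * L) < ‖w x‖ₑ := hx
  rw [Real.enorm_eq_ofReal_abs, ENNReal.ofReal_lt_ofReal_iff_of_nonneg (by positivity)] at hx'
  exact lt_abs.1 hx'

end Truncation

/-! ### Integrability and finite nets below the weak-type exponent. -/

section WeakToStrong

variable {μ ν : Measure X} {E : Set X} {K D ρ C₁ : ℝ≥0} {R₀ R₁ R α p s q τ C : ℝ}

omit [MetricSpace X] in
theorem mul_rpow_le_of_measure_le {m : Measure X} {c t B : ℝ≥0∞} {S : Set X} (hs : 0 ≤ s)
    (hc0 : c ≠ 0) (hc : c ≠ ⊤) (h : m S * (t / c) ^ s ≤ B) : m S * t ^ s ≤ c ^ s * B := by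
  have : t ^ s = c ^ s * (t / c) ^ s := by
    rw [← ENNReal.mul_rpow_of_nonneg _ _ hs, mul_comm, ENNReal.div_mul_cancel hc0 hc]
  rw [this, mul_left_comm]
  gcongr

/-- The representative of `u` lies in `L^q(E, ν)` for `q` below the weak-type exponent. -/
theorem lintegral_realRep_ne_top [OpensMeasurableSpace X] (h : BallConditions μ ν E K D ρ R₀)
    (hW : RadialWeakType ν E τ p s C₁ R₁) (hE : NullMeasurableSet E ν) (hEtb : TotallyBounded E)
    (hp : 0 < p) (hq : 0 < q) (hqs : q < s) (hR : 0 < R) (hRR : R ≤ R₀) (hRR₁ : R ≤ R₁)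
    (hΘ : Theta μ ν E α p s τ R ≠ ⊤) {u g : X → ℝ} (hP : PoincarePair μ E R₀ α p τ C u g)
    (hm : AEMeasurable (realRep μ u) (ν.restrict E)) :
    ∫⁻ x, ‖realRep μ u x‖ₑ ^ q ∂ν.restrict E ≠ ⊤ := by
  have hs : 0 < s := hq.trans hqs
  obtain ⟨V, hV, hVE, -⟩ := exists_measure_ball_le hEtb h.doubling' h.pos
  obtain ⟨C₂, hC₂⟩ := lintegral_rpow_le_of_weak (X := X) q s hq hqs
  obtain ⟨J, hJ, hJcov⟩ := exists_finset_ae_cover hEtb hE (half_pos hR)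
  obtain ⟨A, hA⟩ := (J.image fun y => |⨍ z in ball y (R / 2), u z ∂μ|).exists_le
  -- `L` dominates the averages over the finite cover, so at levels `t ≥ 2 * L` a value above `t`
  -- deviates from a nearby average by more than `t / 2`.
  set L : ℝ≥0∞ := ENNReal.ofReal (max A 1) with hL
  have hL0 : L ≠ 0 := by simp [hL]
  have hLt : L ≠ ⊤ := ENNReal.ofReal_ne_top
  have h2L0 : 2 * L ≠ 0 := mul_ne_zero (by norm_num) hL0
  have h2Lt : 2 * L ≠ ⊤ := ENNReal.mul_ne_top (by norm_num) hLt
  have hae := ae_isLebesguePoint_realRep h hW hE hP hp hs hR hRR hRR₁ hΘ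
  set W : ℝ≥0∞ := ((C₁ * (K + K ^ 2) ^ s : ℝ≥0) : ℝ≥0∞) *
      (ENNReal.ofReal C * Theta μ ν E α p s τ R) ^ s * (∫⁻ y, ‖g y‖ₑ ^ p ∂μ) ^ (s / p) with hWdef
  have hWt : W ≠ ⊤ := ENNReal.mul_ne_top (ENNReal.mul_ne_top ENNReal.coe_ne_top
    (ENNReal.rpow_ne_top_of_nonneg hs.le (ENNReal.mul_ne_top ENNReal.ofReal_ne_top hΘ)))
    (ENNReal.rpow_ne_top_of_nonneg (by positivity) hP.energy_ne_top)
  have h2Ls0 : (2 * L) ^ s ≠ 0 := by simp [ENNReal.rpow_eq_zero_iff, h2L0, h2Lt]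
  have h2Lst : (2 * L) ^ s ≠ ⊤ := ENNReal.rpow_ne_top_of_nonneg hs.le h2Lt
  refine ne_top_of_le_ne_top ?_ (hC₂ (ν.restrict E) _ hm.enorm (2 * L)
    (2 ^ s * W / (2 * L) ^ s) h2L0 h2Lt fun t hLt' htt => ?_)
  · refine ENNReal.mul_ne_top (ENNReal.rpow_ne_top_of_nonneg hq.le h2Lt)
      (ENNReal.add_ne_top.2 ⟨?_, ENNReal.mul_ne_top ENNReal.coe_ne_top
        (ENNReal.div_ne_top (ENNReal.mul_ne_top (ENNReal.rpow_ne_top_of_nonneg hs.le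
          (by norm_num)) hWt) h2Ls0)⟩)
    rw [Measure.restrict_apply_univ]
    exact ne_top_of_le_ne_top hV hVE
  · rw [ENNReal.div_mul_cancel h2Ls0 h2Lst]
    have ht0 : t / 2 ≠ 0 := ENNReal.div_ne_zero.2
      ⟨(lt_of_lt_of_le (pos_iff_ne_zero.2 h2L0) hLt').ne', by norm_num⟩
    have htle : L ≤ t / 2 := by
      rw [ENNReal.le_div_iff_mul_le (Or.inl (by norm_num)) (Or.inl (by norm_num)), mul_comm]
      exact hLt'
    refine mul_rpow_le_of_measure_le hs.le (by norm_num) (by norm_num) (le_trans ?_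
      (measure_deviationSet_le h hW hP hp hs hR hRR hRR₁ hΘ ht0
        (ENNReal.div_ne_top htt (by norm_num))))
    refine mul_le_mul' (le_trans (measure_mono_ae ?_) (Measure.restrict_le_self _)) le_rfl
    filter_upwards [hae, hJcov] with x hx hxJ hxt
    obtain ⟨y, hy, hxy⟩ := hxJ
    refine ⟨hx.1, y, (hJ y hy).1, hxy, _, hx.2.1, ?_⟩
    have hav : ‖⨍ z in ball y (R / 2), u z ∂μ‖ₑ ≤ t / 2 := by
      refine le_trans ?_ htle
      rw [Real.enorm_eq_ofReal_abs]
      exact ENNReal.ofReal_le_ofReal ((hA _ (Finset.mem_image_of_mem _ hy)).trans (le_max_left _ _))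
    by_contra hle
    have h3 : ‖realRep μ u x‖ₑ ≤ t / 2 + t / 2 :=
      calc ‖realRep μ u x‖ₑ = ‖(realRep μ u x - ⨍ z in ball y (R / 2), u z ∂μ) +
              ⨍ z in ball y (R / 2), u z ∂μ‖ₑ := by congr 1; ring
        _ ≤ _ := enorm_add_le _ _
        _ ≤ t / 2 + t / 2 := add_le_add (not_lt.1 hle) hav
    rw [ENNReal.add_halves] at h3
    exact absurd (show t < ‖realRep μ u x‖ₑ from hxt) (not_lt.2 h3)

/-- A sequence with bounded energies and bounded averages has finite nets in `L^q(E, ν)`. -/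
theorem exists_finite_net [OpensMeasurableSpace X] (h : BallConditions μ ν E K D ρ R₀)
    (hW : RadialWeakType ν E τ p s C₁ R₁) (hE : NullMeasurableSet E ν) (hEtb : TotallyBounded E)
    (hp : 0 < p) (hq : 0 < q) (hqs : q < s) (hR₁ : 0 < R₁) (hRR : R₁ ≤ R₀)
    (hΘ : Tendsto (fun r : ℝ => Theta μ ν E α p s τ r) (𝓝[>] 0) (𝓝 0)) {u g : ℕ → X → ℝ}
    (hP : ∀ n, PoincarePair μ E R₀ α p τ C (u n) (g n))
    (hm : ∀ n, AEMeasurable (realRep μ (u n)) (ν.restrict E)) {Γ : ℝ≥0∞} (hΓ : Γ ≠ ⊤)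
    (hg : ∀ n, ∫⁻ y, ‖g n y‖ₑ ^ p ∂μ ≤ Γ)
    (hav : ∀ R, 0 < R → R ≤ R₁ → Theta μ ν E α p s τ R ≠ ⊤ → ∀ y ∈ E,
      ν (E ∩ ball y (R / 2)) ≠ 0 → ∃ B : ℝ, ∀ n, |⨍ z in ball y (R / 2), u n z ∂μ| ≤ B)
    {ε : ℝ≥0∞} (hε : ε ≠ 0) :
    ∃ T : Finset ℕ, ∀ n, ∃ k ∈ T,
      ∫⁻ x, ‖realRep μ (u n) x - realRep μ (u k) x‖ₑ ^ q ∂ν.restrict E ≤ ε := by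
  have hs : 0 < s := hq.trans hqs
  obtain ⟨V, hV, hVE, -⟩ := exists_measure_ball_le hEtb h.doubling' h.pos
  obtain ⟨C₂, hC₂⟩ := lintegral_rpow_le_of_weak (X := X) q s hq hqs
  -- Order of choices: the level `L` from `ε`, then the radius `R` from `L`, and finally the net of
  -- averages over the cover of radius `R / 2` with accuracy `L`.
  obtain ⟨L, hL, hLε⟩ : ∃ L : ℝ, 0 < L ∧ (3 * ENNReal.ofReal L) ^ q * (V + C₂ * 2) ≤ ε := by
    have hlim : Tendsto (fun L : ℝ => (3 * ENNReal.ofReal L) ^ q * (V + C₂ * 2)) (𝓝[>] 0)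
        (𝓝 ((3 * ENNReal.ofReal 0) ^ q * (V + C₂ * 2))) := by
      refine ENNReal.Tendsto.mul_const ?_ (Or.inr (by finiteness))
      refine (ENNReal.continuous_rpow_const.tendsto _).comp ?_
      refine ENNReal.Tendsto.const_mul ?_ (Or.inr (by norm_num))
      exact (ENNReal.continuous_ofReal.tendsto 0).mono_left nhdsWithin_le_nhds
    rw [ENNReal.ofReal_zero, mul_zero, ENNReal.zero_rpow_of_pos hq, zero_mul] at hlim
    obtain ⟨L, hL1, hL2⟩ := ((ENNReal.tendsto_nhds_zero.1 hlim ε (pos_iff_ne_zero.2 hε)).and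
      self_mem_nhdsWithin).exists
    exact ⟨L, hL2, hL1⟩
  set c : ℝ≥0 := C₁ * (K + K ^ 2) ^ s with hc
  obtain ⟨R, hR, hRR₁, hΘR, hsmall⟩ : ∃ R, 0 < R ∧ R ≤ R₁ ∧ Theta μ ν E α p s τ R ≠ ⊤ ∧
      (c : ℝ≥0∞) * (ENNReal.ofReal C * Theta μ ν E α p s τ R) ^ s * Γ ^ (s / p) ≤
        ENNReal.ofReal L ^ s := by
    have hlim : Tendsto (fun R : ℝ => (c : ℝ≥0∞) *
        (ENNReal.ofReal C * Theta μ ν E α p s τ R) ^ s * Γ ^ (s / p)) (𝓝[>] 0)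
        (𝓝 ((c : ℝ≥0∞) * (ENNReal.ofReal C * 0) ^ s * Γ ^ (s / p))) := by
      refine ENNReal.Tendsto.mul_const (ENNReal.Tendsto.const_mul ?_ (Or.inr ENNReal.coe_ne_top))
        (Or.inr (ENNReal.rpow_ne_top_of_nonneg (by positivity) hΓ))
      refine (ENNReal.continuous_rpow_const.tendsto _).comp ?_
      exact ENNReal.Tendsto.const_mul hΘ (Or.inr ENNReal.ofReal_ne_top)
    rw [mul_zero, ENNReal.zero_rpow_of_pos hs, mul_zero, zero_mul] at hlim
    have hLs : 0 < ENNReal.ofReal L ^ s :=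
      ENNReal.rpow_pos (by simpa using hL) ENNReal.ofReal_ne_top
    obtain ⟨R, ⟨h1, h2⟩, h3⟩ := ((ENNReal.tendsto_nhds_zero.1 hlim _ hLs).and
      (hΘ.eventually (gt_mem_nhds zero_lt_one)) |>.and (Ioc_mem_nhdsGT hR₁)).exists
    exact ⟨R, h3.1, h3.2, (h2.trans ENNReal.one_lt_top).ne, h1⟩
  obtain ⟨J, hJ, hJcov⟩ := exists_finset_ae_cover hEtb hE (half_pos hR)
  have hB : ∀ y ∈ J, ∃ B : ℝ, ∀ n, |⨍ z in ball y (R / 2), u n z ∂μ| ≤ B := fun y hy =>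
    hav R hR hRR₁ hΘR y (hJ y hy).1 (hJ y hy).2
  choose! B hB using hB
  obtain ⟨A, hA⟩ := (J.image B).exists_le
  obtain ⟨T, hT⟩ := exists_finset_forall_abs_sub_le
    (fun n (y : J) => ⨍ z in ball (y : X) (R / 2), u n z ∂μ)
    (fun n y => (hB y y.2 n).trans (hA _ (Finset.mem_image_of_mem _ y.2))) hL
  refine ⟨T, fun n => ?_⟩
  obtain ⟨k, hk, hnk⟩ := hT n
  refine ⟨k, hk, ?_⟩
  have h3L0 : 3 * ENNReal.ofReal L ≠ 0 := mul_ne_zero (by norm_num) (by simpa using hL)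
  have h3Lt : 3 * ENNReal.ofReal L ≠ ⊤ := ENNReal.mul_ne_top (by norm_num) ENNReal.ofReal_ne_top
  -- A difference above `t ≥ 3 * L` splits into two deviations and a difference of averages at most
  -- `L ≤ t / 3`. One deviation must exceed `t / 3`, and each contributes `L ^ s`, whence the
  -- constant 2. Only `u n` and `u k` separately need satisfy a Poincaré inequality, so no linear
  -- structure of the class is involved.
  refine (hC₂ (ν.restrict E) _ ((hm n).sub (hm k)).enorm (3 * ENNReal.ofReal L) 2 h3L0 h3Lt
    fun t hLt htt => ?_).trans (le_trans ?_ hLε)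
  · have ht0 : t / 3 ≠ 0 := ENNReal.div_ne_zero.2
      ⟨(lt_of_lt_of_le (pos_iff_ne_zero.2 h3L0) hLt).ne', by norm_num⟩
    have ht3 : t / 3 ≠ ⊤ := ENNReal.div_ne_top htt (by norm_num)
    have htle : ENNReal.ofReal L ≤ t / 3 := by
      rw [ENNReal.le_div_iff_mul_le (Or.inl (by norm_num)) (Or.inl (by norm_num)), mul_comm]
      exact hLt
    have hdev : ∀ i, ν (deviationSet μ E R (u i) (t / 3)) * (t / 3) ^ s ≤
        ENNReal.ofReal L ^ s := by
      intro i
      refine (measure_deviationSet_le h hW (hP i) hp hs hR (hRR₁.trans hRR) hRR₁ hΘR ht0 ht3).trans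
        (le_trans ?_ hsmall)
      gcongr
      exact hg i
    have hsub : ν.restrict E {x | t < ‖(realRep μ (u n) - realRep μ (u k)) x‖ₑ} ≤
        ν (deviationSet μ E R (u n) (t / 3)) + ν (deviationSet μ E R (u k) (t / 3)) := by
      refine le_trans (measure_mono_ae ?_) ((Measure.restrict_le_self _).trans
        (measure_union_le _ _))
      filter_upwards [hJcov,
        ae_isLebesguePoint_realRep h hW hE (hP n) hp hs hR (hRR₁.trans hRR) hRR₁ hΘR,
        ae_isLebesguePoint_realRep h hW hE (hP k) hp hs hR (hRR₁.trans hRR) hRR₁ hΘR]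
        with x hxJ hxn hxk hxt
      obtain ⟨y, hy, hxy⟩ := hxJ
      by_contra hcon
      change x ∉ deviationSet μ E R (u n) (t / 3) ∪ deviationSet μ E R (u k) (t / 3) at hcon
      rw [mem_union, not_or] at hcon
      have h1 : ‖realRep μ (u n) x - ⨍ z in ball y (R / 2), u n z ∂μ‖ₑ ≤ t / 3 := by
        by_contra hlt
        exact hcon.1 ⟨hxn.1, y, (hJ y hy).1, hxy, _, hxn.2.1, not_le.1 hlt⟩
      have h2 : ‖realRep μ (u k) x - ⨍ z in ball y (R / 2), u k z ∂μ‖ₑ ≤ t / 3 := by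
        by_contra hlt
        exact hcon.2 ⟨hxk.1, y, (hJ y hy).1, hxy, _, hxk.2.1, not_le.1 hlt⟩
      have h3 : ‖(⨍ z in ball y (R / 2), u n z ∂μ) - ⨍ z in ball y (R / 2), u k z ∂μ‖ₑ ≤
          t / 3 := by
        refine le_trans ?_ htle
        rw [Real.enorm_eq_ofReal_abs]
        exact ENNReal.ofReal_le_ofReal (hnk ⟨y, hy⟩)
      have h4 : ‖realRep μ (u n) x - realRep μ (u k) x‖ₑ ≤ t / 3 + t / 3 + t / 3 :=
        calc ‖realRep μ (u n) x - realRep μ (u k) x‖ₑ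
            = ‖((realRep μ (u n) x - ⨍ z in ball y (R / 2), u n z ∂μ) +
                ((⨍ z in ball y (R / 2), u n z ∂μ) - ⨍ z in ball y (R / 2), u k z ∂μ)) -
                (realRep μ (u k) x - ⨍ z in ball y (R / 2), u k z ∂μ)‖ₑ := by congr 1; ring
          _ ≤ _ := enorm_sub_le
          _ ≤ t / 3 + t / 3 + t / 3 := by
            gcongr
            exact (enorm_add_le _ _).trans (add_le_add h1 h3)
      rw [ENNReal.add_thirds] at h4
      exact absurd (show t < ‖realRep μ (u n) x - realRep μ (u k) x‖ₑ from hxt) (not_lt.2 h4)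
    rw [ENNReal.mul_rpow_of_nonneg _ _ hs.le, mul_left_comm]
    refine mul_rpow_le_of_measure_le hs.le (by norm_num) (by norm_num) ?_
    calc _ ≤ (ν (deviationSet μ E R (u n) (t / 3)) + ν (deviationSet μ E R (u k) (t / 3))) *
            (t / 3) ^ s := by gcongr
      _ ≤ ENNReal.ofReal L ^ s + ENNReal.ofReal L ^ s := by
        rw [add_mul]; exact add_le_add (hdev n) (hdev k)
      _ = _ := (two_mul _).symm
  · gcongr
    rw [Measure.restrict_apply_univ]
    exact hVE

end WeakToStrong

/-! ### The two norms. -/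

section Norms

variable {μ ν : Measure X} {E : Set X} {K D ρ C₁ : ℝ≥0} {R₀ R₁ R α p q τ : ℝ}
  {Y : Set (X → ℝ)} {G : (X → ℝ) → X → ℝ} {N : (X → ℝ) → ℝ≥0∞}

omit [MetricSpace X] in
theorem lintegral_rpow_le_of_eLpNorm_le {m : Measure X} {g : X → ℝ} (hp : 0 < p) {M : ℝ≥0∞}
    (h : eLpNorm g (ENNReal.ofReal p) m ≤ M) : ∫⁻ y, ‖g y‖ₑ ^ p ∂m ≤ M ^ p := by
  rw [eLpNorm_eq_lintegral_rpow_enorm_toReal (by simpa using hp) ENNReal.ofReal_ne_top,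
    ENNReal.toReal_ofReal hp.le] at h
  have := ENNReal.rpow_le_rpow h hp.le
  rwa [← ENNReal.rpow_mul, one_div_mul_cancel hp.ne', ENNReal.rpow_one] at this

theorem eLpNorm_gradient_le_norm (hN : N = targetNorm μ ν E p G ∨ N = domainNorm μ p G)
    (u : X → ℝ) : eLpNorm (G u) (ENNReal.ofReal p) μ ≤ N u := by
  rcases hN with rfl | rfl
  · exact le_add_self
  · exact le_add_self

/-- Together with `eLpNorm_gradient_le_norm` this is all that is used about the norm, so the
embedding proofs treat both norms at once. -/
theorem exists_setLAverage_le_norm [OpensMeasurableSpace X] (h : BallConditions μ ν E K D ρ R₀)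
    (hW : RadialWeakType ν E τ p q C₁ R₁) (hE : NullMeasurableSet E ν) (hp : 0 < p)
    (hq : 0 < q) (hN : N = targetNorm μ ν E p G ∨ N = domainNorm μ p G)
    (hYint : ∀ u ∈ Y, IntegrableOnBalls μ u)
    (hYP : ∀ u ∈ Y, PoincarePair μ E R₀ α p τ 1 u (G u)) (hR : 0 < R) (hRR : R ≤ R₀)
    (hRR₁ : R ≤ R₁) (hΘ : Theta μ ν E α p q τ R ≠ ⊤) {y : X} (hy : y ∈ E)
    (hpos : ν (E ∩ ball y (R / 2)) ≠ 0) :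
    ∃ B : ℝ≥0∞, B ≠ ⊤ ∧ ∀ u ∈ Y, ∀ M : ℝ≥0∞, M ≠ 0 → M ≠ ⊤ → N u ≤ M →
      ⨍⁻ z in ball y (R / 2), ‖u z‖ₑ ∂μ ≤ B * M := by
  have hgrad := eLpNorm_gradient_le_norm hN
  rcases hN with rfl | rfl
  · obtain ⟨B, hB, hB'⟩ := exists_setLAverage_le_target (C := 1) h hW hE hp hq hR hRR hRR₁ hΘ hy hpos
    refine ⟨B, hB, fun u hu M hM0 hM hle => ?_⟩
    have hae := ae_isLebesguePoint_realRep h hW hE (hYP u hu) hp hq hR hRR hRR₁ hΘ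
    refine hB' u (G u) (hYP u hu) (aemeasurable_realRep h (hYint u hu) hae) M hM0 hM ?_
      (lintegral_rpow_le_of_eLpNorm_le hp ((hgrad u).trans hle))
    have h1 : extLpNorm ν E 1 (limsupRep μ u) ≤ M := le_self_add.trans hle
    rw [extLpNorm_eq_of_ae 1 (by filter_upwards [hae] with x hx using hx.2.2)] at h1
    simpa using h1
  · obtain ⟨B, hB, hB'⟩ := exists_setLAverage_le_domain h hR hy
    refine ⟨B, hB, fun u hu M hM0 hM hle => hB' u M ?_⟩
    rw [← eLpNorm_one_eq_lintegral_enorm]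
    exact le_self_add.trans hle

end Norms

theorem IntegrableOnBalls.aemeasurable [OpensMeasurableSpace X] {μ : Measure X} {u : X → ℝ}
    (hu : IntegrableOnBalls μ u) : AEMeasurable u μ := by
  rcases isEmpty_or_nonempty X with hX | ⟨⟨x⟩⟩
  · exact (measurable_of_empty u).aemeasurable
  · have h : AEMeasurable u (μ.restrict (⋃ n : ℕ, ball x n)) :=
      aemeasurable_iUnion_iff.2 fun n => (hu x n).aestronglyMeasurable.aemeasurable
    rwa [iUnion_ball_nat, Measure.restrict_univ] at h

theorem IntegrableOnBalls.truncationPairs [OpensMeasurableSpace X] {μ : Measure X} {E : Set X}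
    {K : ℝ≥0} {R₀ α p τ C : ℝ} {u g : X → ℝ} (hd : DoublingBalls μ E K R₀) (hR₀ : 0 < R₀)
    (hp : 0 < p) (hC : 0 ≤ C) (hu : IntegrableOnBalls μ u)
    (hT : ∀ l k : ℝ, l < k →
      PoincareIneqOn μ E R₀ α p τ C (truncate l k u) ({x | l < u x ∧ u x < k}.indicator g))
    (hg : ∫⁻ y, ‖g y‖ₑ ^ p ∂μ ≠ ⊤) : TruncationPairs μ E R₀ α p τ C u g := by
  intro l k hlk
  refine ⟨hC, fun x hx r hr hrR => ?_, hT l k hlk, ne_top_of_le_ne_top hg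
    (lintegral_mono fun y => ?_)⟩
  · have hfin : IsFiniteMeasure (μ.restrict (ball x r)) :=
      ⟨by rw [Measure.restrict_apply_univ]
          exact (hd.ne_top hR₀ hx (by linarith)).lt_top⟩
    exact (integrable_const l).sup ((hu x r).inf (integrable_const k))
  · by_cases hy : y ∈ {x | l < u x ∧ u x < k}
    · rw [indicator_of_mem hy]
    · rw [indicator_of_notMem hy, enorm_zero, ENNReal.zero_rpow_of_pos hp]
      exact zero_le

/-! ### The embeddings. -/

section Embedding

variable {μ ν : Measure X} {E : Set X} {K D ρ C₁ : ℝ≥0} {R₀ R₁ R α p q s τ C : ℝ}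
  {Y : Set (X → ℝ)} {G : (X → ℝ) → X → ℝ} {N : (X → ℝ) → ℝ≥0∞}

theorem exists_pos_le_Theta_ne_top (hR₁ : 0 < R₁)
    (hΘ : Tendsto (fun r : ℝ => Theta μ ν E α p s τ r) (𝓝[>] 0) (𝓝 0)) {ε : ℝ≥0∞} (hε : ε ≠ 0) :
    ∃ R, 0 < R ∧ R ≤ R₁ ∧ Theta μ ν E α p s τ R ≠ ⊤ ∧ Theta μ ν E α p s τ R ≤ ε := by
  obtain ⟨R, ⟨h1, h2⟩, h3⟩ := ((ENNReal.tendsto_nhds_zero.1 hΘ ε (pos_iff_ne_zero.2 hε)).and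
    (hΘ.eventually (gt_mem_nhds zero_lt_one)) |>.and (Ioc_mem_nhdsGT hR₁)).exists
  exact ⟨R, h3.1, h3.2, (h2.trans ENNReal.one_lt_top).ne, h1⟩

/-- Norm-bounded sequences have finite nets in `L^q(E, ν)`. -/
theorem exists_finite_net_of_norm_le [OpensMeasurableSpace X]
    (h : BallConditions μ ν E K D ρ R₀)
    (hW : RadialWeakType ν E τ p s C₁ R₁) (hE : NullMeasurableSet E ν) (hEtb : TotallyBounded E)
    (hp : 0 < p) (hq : 0 < q) (hqs : q < s) (hR₁ : 0 < R₁) (hRR : R₁ ≤ R₀)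
    (hN : N = targetNorm μ ν E p G ∨ N = domainNorm μ p G)
    (hYint : ∀ u ∈ Y, IntegrableOnBalls μ u)
    (hYP : ∀ u ∈ Y, PoincarePair μ E R₀ α p τ 1 u (G u))
    (hΘ : Tendsto (fun r : ℝ => Theta μ ν E α p s τ r) (𝓝[>] 0) (𝓝 0)) {u : ℕ → X → ℝ}
    (hu : ∀ n, u n ∈ Y) {M : ℝ≥0∞} (hM0 : M ≠ 0) (hM : M ≠ ⊤) (huM : ∀ n, N (u n) ≤ M)
    {ε : ℝ≥0∞} (hε : ε ≠ 0) :
    ∃ T : Finset ℕ, ∀ n, ∃ k ∈ T,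
      ∫⁻ x, ‖realRep μ (u n) x - realRep μ (u k) x‖ₑ ^ q ∂ν.restrict E ≤ ε := by
  have hs : 0 < s := hq.trans hqs
  obtain ⟨R, hR, hRR₁, hΘR, -⟩ := exists_pos_le_Theta_ne_top hR₁ hΘ one_ne_zero
  refine exists_finite_net (g := fun n => G (u n)) h hW hE hEtb hp hq hqs hR₁ hRR hΘ
    (fun n => hYP _ (hu n))
    (fun n => aemeasurable_realRep h (hYint _ (hu n)) (ae_isLebesguePoint_realRep h hW hE
      (hYP _ (hu n)) hp hs hR (hRR₁.trans hRR) hRR₁ hΘR))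
    (Γ := M ^ p) (ENNReal.rpow_ne_top_of_nonneg hp.le hM)
    (fun n => lintegral_rpow_le_of_eLpNorm_le hp ((eLpNorm_gradient_le_norm hN _).trans (huM n)))
    ?_ hε
  intro R hR hRR₁ hΘR y hy hpos
  obtain ⟨B, hB, hB'⟩ := exists_setLAverage_le_norm h hW hE hp hs hN hYint hYP hR
    (hRR₁.trans hRR) hRR₁ hΘR hy hpos
  refine ⟨(B * M).toReal, fun n => ?_⟩
  have h1 := (enorm_setAverage_sub_le (h.doubling.ne_zero h.pos hy (half_pos hR))
    (h.doubling.ne_top h.pos hy (r := R / 2) (by linarith [h.pos]))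
    (hYint _ (hu n) y (R / 2)) 0)
  simp only [sub_zero] at h1
  have h2 := h1.trans (hB' _ (hu n) M hM0 hM (huM n))
  rw [Real.enorm_eq_ofReal_abs] at h2
  exact (ENNReal.ofReal_le_iff_le_toReal (ENNReal.mul_ne_top hB hM)).1 h2

theorem memLp_realRep {u : X → ℝ} (hq : 0 < q)
    (hm : AEMeasurable (realRep μ u) (ν.restrict E))
    (hfin : ∫⁻ x, ‖realRep μ u x‖ₑ ^ q ∂ν.restrict E ≠ ⊤) :
    MemLp (realRep μ u) (ENNReal.ofReal q) (ν.restrict E) := by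
  refine ⟨hm.aestronglyMeasurable, ?_⟩
  rw [eLpNorm_eq_lintegral_rpow_enorm_toReal (by simpa using hq) ENNReal.ofReal_ne_top,
    ENNReal.toReal_ofReal hq.le]
  exact ENNReal.rpow_lt_top_of_nonneg (by positivity) hfin

/-- Finite nets for norm-bounded sequences give a compact embedding. -/
theorem embedsCompactly_of_finite_nets (hq : 1 ≤ q)
    (hYm : ∀ u ∈ Y, AEMeasurable (realRep μ u) (ν.restrict E))
    (hYrep : ∀ u ∈ Y, ∀ᵐ x ∂ν.restrict E, limsupRep μ u x = realRep μ u x)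
    (hYfin : ∀ u ∈ Y, ∫⁻ x, ‖realRep μ u x‖ₑ ^ q ∂ν.restrict E ≠ ⊤)
    (hnet : ∀ u : ℕ → X → ℝ, (∀ n, u n ∈ Y) → ∀ M : ℝ≥0∞, M ≠ 0 → M ≠ ⊤ → (∀ n, N (u n) ≤ M) →
      ∀ ε : ℝ≥0∞, ε ≠ 0 → ε ≠ ⊤ → ∃ T : Finset ℕ, ∀ n, ∃ k ∈ T,
        ∫⁻ x, ‖realRep μ (u n) x - realRep μ (u k) x‖ₑ ^ q ∂ν.restrict E ≤ ε) :
    EmbedsCompactly μ ν E Y N q := by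
  have hq0 : 0 < q := by linarith
  refine ⟨fun u hu => extMemLp_of_ae hq0 (hYrep u hu) (hYm u hu) (hYfin u hu), ?_⟩
  rintro u hu ⟨M, hM⟩
  have hnet' := hnet u hu (ENNReal.ofReal (max M 1)) (by simp) ENNReal.ofReal_ne_top
    (fun n => (hM n).trans (ENNReal.ofReal_le_ofReal (le_max_left _ _)))
  obtain ⟨φ, hφ, v, hv, hlim⟩ := exists_subseq_tendsto_of_finite_nets (ν.restrict E) hq
    (fun n => realRep μ (u n))
    (fun n => memLp_realRep hq0 (hYm _ (hu n)) (hYfin _ (hu n))) (fun ε hε => by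
      obtain ⟨T, hT⟩ := hnet' (ENNReal.ofReal ε ^ q)
        (ENNReal.rpow_pos (by simpa using hε) ENNReal.ofReal_ne_top).ne'
        (ENNReal.rpow_ne_top_of_nonneg hq0.le ENNReal.ofReal_ne_top)
      refine ⟨T, fun n => ?_⟩
      obtain ⟨k, hk, hnk⟩ := hT n
      refine ⟨k, hk, (ENNReal.rpow_le_rpow hnk (by positivity)).trans (le_of_eq ?_)⟩
      rw [← ENNReal.rpow_mul, mul_one_div_cancel hq0.ne', ENNReal.rpow_one])
  refine ⟨φ, hφ, v, hv, hlim.congr fun n => ?_⟩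
  rw [extLpNorm_eq_of_ae (w := fun x => realRep μ (u (φ n)) x - v x)]
  filter_upwards [hYrep _ (hu (φ n))] with x hx
  rw [hx, EReal.coe_sub]

theorem embedsCompactly_of_lt [OpensMeasurableSpace X]
    (h : BallConditions μ ν E K D ρ R₀) (hE : NullMeasurableSet E ν) (hEtb : TotallyBounded E)
    (hp : 0 < p) (hps : p < s) (hq : 1 ≤ q) (hqs : q < s) (hτ : 0 < τ)
    (hN : N = targetNorm μ ν E p G ∨ N = domainNorm μ p G)
    (hYint : ∀ u ∈ Y, IntegrableOnBalls μ u)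
    (hYP : ∀ u ∈ Y, PoincarePair μ E R₀ α p τ 1 u (G u))
    (hΘ : Tendsto (fun r : ℝ => Theta μ ν E α p s τ r) (𝓝[>] 0) (𝓝 0)) :
    EmbedsCompactly μ ν E Y N q := by
  have hq0 : 0 < q := by linarith
  have hs : 0 < s := hp.trans hps
  obtain ⟨C₁, R₁, hR₁, hR₁R₀, hW⟩ := h.exists_radialWeakType hp hps hτ
  obtain ⟨R, hR, hRR₁, hΘR, -⟩ := exists_pos_le_Theta_ne_top hR₁ hΘ one_ne_zero
  have hae := fun u hu => ae_isLebesguePoint_realRep h hW hE (hYP u hu) hp hs hR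
    (hRR₁.trans hR₁R₀) hRR₁ hΘR
  have hm := fun u hu => aemeasurable_realRep h (hYint u hu) (hae u hu)
  refine embedsCompactly_of_finite_nets hq hm
    (fun u hu => by filter_upwards [hae u hu] with x hx using hx.2.2)
    (fun u hu => lintegral_realRep_ne_top h hW hE hEtb hp hq0 hqs hR (hRR₁.trans hR₁R₀) hRR₁ hΘR
      (hYP u hu) (hm u hu))
    (fun u hu M hM0 hM huM ε hε _ => exists_finite_net_of_norm_le h hW hE hEtb hp hq0 hqs hR₁ hR₁R₀
      hN hYint hYP hΘ hu hM0 hM huM hε)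

/-- Membership in `L^q` is proved for each `u` separately, with a level taken from the averages of
`u` itself, because the norm of `u` may be infinite. -/
theorem lintegral_realRep_ne_top_of_truncation [OpensMeasurableSpace X]
    (h : BallConditions μ ν E K D ρ R₀)
    (hW : RadialWeakType ν E τ p q C₁ R₁) (hE : NullMeasurableSet E ν) (hEtb : TotallyBounded E)
    (hp : 0 < p) (hpq : p ≤ q) (hR : 0 < R) (hRR : R ≤ R₀) (hRR₁ : R ≤ R₁)
    (hΘ : Theta μ ν E α p q τ R ≠ ⊤) {u g : X → ℝ} (hu : IntegrableOnBalls μ u)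
    (hg : AEMeasurable g μ) (hP : PoincarePair μ E R₀ α p τ 1 u g)
    (hT : TruncationPairs μ E R₀ α p τ C u g) :
    ∫⁻ x, ‖realRep μ u x‖ₑ ^ q ∂ν.restrict E ≠ ⊤ := by
  have hq : 0 < q := hp.trans_le hpq
  obtain ⟨V, hV, hVE, -⟩ := exists_measure_ball_le hEtb h.doubling' h.pos
  obtain ⟨J, hJ, hJcov⟩ := exists_finset_ae_cover hEtb hE (half_pos hR)
  have hae := ae_isLebesguePoint_realRep h hW hE hP hp hq hR hRR hRR₁ hΘ
  have hm := aemeasurable_realRep h hu hae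
  have hS : ∑ y ∈ J, ⨍⁻ z in ball y (R / 2), ‖u z‖ₑ ∂μ ≠ ⊤ := by
    refine ENNReal.sum_ne_top.2 fun y hy => ?_
    rw [setLAverage_eq]
    exact ENNReal.div_ne_top (hu y _).2.ne (h.doubling.ne_zero h.pos (hJ y hy).1 (half_pos hR))
  set L : ℝ := 4 * (∑ y ∈ J, ⨍⁻ z in ball y (R / 2), ‖u z‖ₑ ∂μ).toReal + 1 with hL
  have hL0 : 0 < L := by positivity
  have hcov : ∀ᵐ x ∂ν.restrict E, ∃ y ∈ E, dist x y < R / 2 ∧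
      ⨍⁻ z in ball y (R / 2), ‖u z‖ₑ ∂μ ≤ ENNReal.ofReal (L / 4) := by
    filter_upwards [hJcov] with x hx
    obtain ⟨y, hy, hxy⟩ := hx
    refine ⟨y, (hJ y hy).1, hxy, ?_⟩
    refine (Finset.single_le_sum (f := fun y => ⨍⁻ z in ball y (R / 2), ‖u z‖ₑ ∂μ)
      (fun _ _ => zero_le) hy).trans ?_
    rw [ENNReal.le_ofReal_iff_toReal_le hS (by positivity)]
    rw [hL]; linarith
  have htail := lintegral_tail_le h hW hT hp hpq hR hRR hRR₁ hΘ hL0 hu.aemeasurable hg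
    (by filter_upwards [hae] with x hx using ⟨hx.1, hx.2.1⟩) hm hcov
  refine ne_top_of_le_ne_top ?_ (lintegral_rpow_le_add _ hm.enorm hq.le (ENNReal.ofReal L))
  refine ENNReal.add_ne_top.2 ⟨ENNReal.mul_ne_top
    (ENNReal.rpow_ne_top_of_nonneg hq.le ENNReal.ofReal_ne_top) ?_, ne_top_of_le_ne_top ?_ htail⟩
  · rw [Measure.restrict_apply_univ]; exact ne_top_of_le_ne_top hV hVE
  · have h2 : (2 : ℝ≥0∞) ^ q ≠ ⊤ := ENNReal.rpow_ne_top_of_nonneg hq.le (by norm_num)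
    have h8 : (8 : ℝ≥0∞) ^ q ≠ ⊤ := ENNReal.rpow_ne_top_of_nonneg hq.le (by norm_num)
    have hκ : (ENNReal.ofReal C * Theta μ ν E α p q τ R) ^ q ≠ ⊤ :=
      ENNReal.rpow_ne_top_of_nonneg hq.le (ENNReal.mul_ne_top ENNReal.ofReal_ne_top hΘ)
    have hΓ : (∫⁻ y, ‖g y‖ₑ ^ p ∂μ) ^ (q / p) ≠ ⊤ :=
      ENNReal.rpow_ne_top_of_nonneg (by positivity) hP.energy_ne_top
    exact ENNReal.mul_ne_top h2 (ENNReal.mul_ne_top (by norm_num) (ENNReal.mul_ne_top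
      (ENNReal.mul_ne_top h8 (ENNReal.mul_ne_top ENNReal.coe_ne_top hκ)) hΓ))

/-- Uniform tail bound over norm-bounded subsets, at levels above a multiple of the norm bound. -/
theorem exists_forall_lintegral_tail_le [OpensMeasurableSpace X]
    (h : BallConditions μ ν E K D ρ R₀)
    (hW : RadialWeakType ν E τ p q C₁ R₁) (hE : NullMeasurableSet E ν) (hEtb : TotallyBounded E)
    (hp : 0 < p) (hpq : p ≤ q) (hR : 0 < R) (hRR : R ≤ R₀) (hRR₁ : R ≤ R₁)
    (hΘ : Theta μ ν E α p q τ R ≠ ⊤)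
    (hN : N = targetNorm μ ν E p G ∨ N = domainNorm μ p G)
    (hYint : ∀ u ∈ Y, IntegrableOnBalls μ u) (hYG : ∀ u ∈ Y, AEMeasurable (G u) μ)
    (hYP : ∀ u ∈ Y, PoincarePair μ E R₀ α p τ 1 u (G u))
    (hYT : ∀ u ∈ Y, TruncationPairs μ E R₀ α p τ C u (G u)) :
    ∃ B : ℝ≥0∞, B ≠ ⊤ ∧ ∀ u ∈ Y, ∀ M : ℝ≥0∞, M ≠ 0 → M ≠ ⊤ → N u ≤ M → ∀ L : ℝ, 0 < L →
      B * M ≤ ENNReal.ofReal L →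
      ∫⁻ x in {x | ENNReal.ofReal L < ‖realRep μ u x‖ₑ}, ‖realRep μ u x‖ₑ ^ q ∂ν.restrict E ≤
        2 ^ q * (2 * (8 ^ q * (((C₁ * (K + K ^ 2) ^ q : ℝ≥0) : ℝ≥0∞) *
          (ENNReal.ofReal C * Theta μ ν E α p q τ R) ^ q) * M ^ q)) := by
  have hq : 0 < q := hp.trans_le hpq
  obtain ⟨J, hJ, hJcov⟩ := exists_finset_ae_cover hEtb hE (half_pos hR)
  have hB := fun y (hy : y ∈ J) => exists_setLAverage_le_norm h hW hE hp hq hN hYint hYP hR hRR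
    hRR₁ hΘ (hJ y hy).1 (hJ y hy).2
  choose! B hBt hB using hB
  -- The factor 4 produces the bound `L / 4` on the averages that the truncation argument needs.
  refine ⟨4 * ∑ y ∈ J, B y, ENNReal.mul_ne_top (by norm_num) (ENNReal.sum_ne_top.2 hBt),
    fun u hu M hM0 hM huM L hL hBL => ?_⟩
  have hae := ae_isLebesguePoint_realRep h hW hE (hYP u hu) hp hq hR hRR hRR₁ hΘ
  have hm := aemeasurable_realRep h (hYint u hu) hae
  have hcov : ∀ᵐ x ∂ν.restrict E, ∃ y ∈ E, dist x y < R / 2 ∧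
      ⨍⁻ z in ball y (R / 2), ‖u z‖ₑ ∂μ ≤ ENNReal.ofReal (L / 4) := by
    filter_upwards [hJcov] with x hx
    obtain ⟨y, hy, hxy⟩ := hx
    refine ⟨y, (hJ y hy).1, hxy, (hB y hy u hu M hM0 hM huM).trans ?_⟩
    have h1 : 4 * (B y * M) ≤ ENNReal.ofReal L := by
      refine le_trans ?_ hBL
      rw [mul_assoc]
      gcongr
      exact Finset.single_le_sum (f := B) (fun _ _ => zero_le) hy
    rw [ENNReal.ofReal_div_of_pos (by norm_num), ENNReal.ofReal_ofNat,
      ENNReal.le_div_iff_mul_le (Or.inl (by norm_num)) (Or.inl (by norm_num)), mul_comm]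
    exact h1
  refine (lintegral_tail_le h hW (hYT u hu) hp hpq hR hRR hRR₁ hΘ hL (hYint u hu).aemeasurable
    (hYG u hu) (by filter_upwards [hae] with x hx using ⟨hx.1, hx.2.1⟩) hm hcov).trans ?_
  have hΓ := ENNReal.rpow_le_rpow (lintegral_rpow_le_of_eLpNorm_le hp
    ((eLpNorm_gradient_le_norm hN u).trans huM)) (z := q / p) (by positivity)
  rw [← ENNReal.rpow_mul, mul_div_cancel₀ _ hp.ne'] at hΓ
  gcongr

theorem embedsBoundedly_of_truncation [OpensMeasurableSpace X]
    (h : BallConditions μ ν E K D ρ R₀) (hE : NullMeasurableSet E ν) (hEtb : TotallyBounded E)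
    (hp : 0 < p) (hpq : p < q) (hτ : 0 < τ)
    (hN : N = targetNorm μ ν E p G ∨ N = domainNorm μ p G)
    (hYint : ∀ u ∈ Y, IntegrableOnBalls μ u) (hYG : ∀ u ∈ Y, AEMeasurable (G u) μ)
    (hYP : ∀ u ∈ Y, PoincarePair μ E R₀ α p τ 1 u (G u))
    (hYT : ∀ u ∈ Y, TruncationPairs μ E R₀ α p τ C u (G u))
    (hΘ : Theta μ ν E α p q τ R₀ ≠ ⊤) :
    EmbedsBoundedly μ ν E Y N q := by
  have hq : 0 < q := hp.trans hpq
  obtain ⟨C₁, R, hR, hRR₀, hW⟩ := h.exists_radialWeakType hp hpq hτ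
  have hΘR : Theta μ ν E α p q τ R ≠ ⊤ := ne_top_of_le_ne_top hΘ (Theta_mono hRR₀)
  have hae := fun u hu => ae_isLebesguePoint_realRep h hW hE (hYP u hu) hp hq hR hRR₀ le_rfl hΘR
  have hm := fun u hu => aemeasurable_realRep h (hYint u hu) (hae u hu)
  have hrep : ∀ u ∈ Y, ∀ᵐ x ∂ν.restrict E, limsupRep μ u x = realRep μ u x :=
    fun u hu => by filter_upwards [hae u hu] with x hx using hx.2.2
  refine ⟨fun u hu => extMemLp_of_ae hq (hrep u hu) (hm u hu)
    (lintegral_realRep_ne_top_of_truncation h hW hE hEtb hp hpq.le hR hRR₀ le_rfl hΘR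
      (hYint u hu) (hYG u hu) (hYP u hu) (hYT u hu)), ?_⟩
  obtain ⟨V, hV, hVE, -⟩ := exists_measure_ball_le hEtb h.doubling' h.pos
  obtain ⟨B, hB, htail⟩ := exists_forall_lintegral_tail_le h hW hE hEtb hp hpq.le hR hRR₀ le_rfl
    hΘR hN hYint hYG hYP hYT
  set c : ℝ≥0∞ := 2 ^ q * (2 * (8 ^ q * (((C₁ * (K + K ^ 2) ^ q : ℝ≥0) : ℝ≥0∞) *
    (ENNReal.ofReal C * Theta μ ν E α p q τ R) ^ q))) with hc
  have hct : c ≠ ⊤ := by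
    have hκ : (ENNReal.ofReal C * Theta μ ν E α p q τ R) ^ q ≠ ⊤ :=
      ENNReal.rpow_ne_top_of_nonneg hq.le (ENNReal.mul_ne_top ENNReal.ofReal_ne_top hΘR)
    exact ENNReal.mul_ne_top (ENNReal.rpow_ne_top_of_nonneg hq.le (by norm_num))
      (ENNReal.mul_ne_top (by norm_num) (ENNReal.mul_ne_top
        (ENNReal.rpow_ne_top_of_nonneg hq.le (by norm_num))
        (ENNReal.mul_ne_top ENNReal.coe_ne_top hκ)))
  -- The integral is split at the level `(B + 1) * M`: the part below it gives the term with `V`,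
  -- the tail gives `c`. Using `B + 1` keeps the level positive.
  set A : ℝ≥0∞ := ((B + 1) ^ q * V + c) ^ (1 / q) with hA
  have hAt : A ≠ ⊤ := ENNReal.rpow_ne_top_of_nonneg (by positivity)
    (ENNReal.add_ne_top.2 ⟨ENNReal.mul_ne_top
      (ENNReal.rpow_ne_top_of_nonneg hq.le (by finiteness)) hV, hct⟩)
  have key : ∀ u ∈ Y, ∀ M : ℝ≥0∞, M ≠ 0 → M ≠ ⊤ → N u ≤ M →
      extLpNorm ν E q (limsupRep μ u) ≤ A * M := by
    intro u hu M hM0 hM huM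
    have hBM : (B + 1) * M ≠ ⊤ := ENNReal.mul_ne_top (by finiteness) hM
    have hBM0 : (B + 1) * M ≠ 0 := mul_ne_zero (by simp) hM0
    have hL : ENNReal.ofReal ((B + 1) * M).toReal = (B + 1) * M := ENNReal.ofReal_toReal hBM
    have h1 := htail u hu M hM0 hM huM ((B + 1) * M).toReal (ENNReal.toReal_pos hBM0 hBM) (by
      rw [hL]; gcongr; exact le_self_add)
    rw [hL] at h1
    have h2 := lintegral_rpow_le_add (ν.restrict E) (hm u hu).enorm hq.le ((B + 1) * M)
    rw [extLpNorm_eq_of_ae q (hrep u hu)]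
    have hroot : A * M = (((B + 1) ^ q * V + c) * M ^ q) ^ (1 / q) := by
      rw [ENNReal.mul_rpow_of_nonneg _ _ (by positivity), ← ENNReal.rpow_mul,
        mul_one_div_cancel hq.ne', ENNReal.rpow_one]
    rw [hroot]
    refine ENNReal.rpow_le_rpow ((h2.trans (add_le_add le_rfl h1)).trans ?_) (by positivity)
    rw [ENNReal.mul_rpow_of_nonneg _ _ hq.le, Measure.restrict_apply_univ]
    calc (B + 1) ^ q * M ^ q * ν E + _ ≤ (B + 1) ^ q * M ^ q * V + _ := by gcongr
      _ = ((B + 1) ^ q * V + c) * M ^ q := by rw [hc]; ring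
  refine ⟨A.toReal + 1, by positivity, fun u hu => ?_⟩
  have hA1 : A ≤ ENNReal.ofReal (A.toReal + 1) := by
    rw [ENNReal.le_ofReal_iff_toReal_le hAt (by positivity)]; linarith
  rcases eq_or_ne (N u) ⊤ with htop | htop
  · rw [htop, ENNReal.mul_top]
    · exact le_top
    · simp only [ne_eq, ENNReal.ofReal_eq_zero, not_le]
      positivity
  · refine le_trans ?_ (mul_le_mul' hA1 le_rfl)
    -- Letting `M` decrease to `N u` includes the case `N u = 0`, which the estimates for `M ≠ 0` do
    -- not reach directly.
    have : (𝓝[>] (N u)).NeBot := nhdsGT_neBot_of_exists_gt ⟨⊤, htop.lt_top⟩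
    refine ge_of_tendsto (f := fun M => A * M) (x := 𝓝[>] (N u)) ?_ ?_
    · exact (ENNReal.Tendsto.const_mul tendsto_id (Or.inr hAt)).mono_left nhdsWithin_le_nhds
    · filter_upwards [Ioo_mem_nhdsGT htop.lt_top] with M hM
      exact key u hu M (zero_le.trans_lt hM.1).ne' hM.2.ne hM.1.le

/-- If the larger of `|a|`, `|b|` exceeds `L`, then `|a - b|` is at most twice it and the tail term
pays; otherwise `|a - b| ≤ 2 * L`, and all but one of its powers are bounded. Integrated, this
reduces nets in `L^q` to uniformly small tails and nets in `L^1`. -/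
theorem enorm_sub_rpow_le {a b : ℝ} (hq : 1 ≤ q) {L : ℝ≥0∞} :
    ‖a - b‖ₑ ^ q ≤ 2 ^ q * ((Ioi L).indicator (fun t => t ^ q) ‖a‖ₑ +
      (Ioi L).indicator (fun t => t ^ q) ‖b‖ₑ) + (2 * L) ^ (q - 1) * ‖a - b‖ₑ := by
  have hq0 : 0 ≤ q := by linarith
  have hmain : ∀ x y : ℝ≥0∞, ‖a - b‖ₑ ≤ x + y → y ≤ x → L < x →
      ‖a - b‖ₑ ^ q ≤ 2 ^ q * (Ioi L).indicator (fun t => t ^ q) x := by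
    intro x y hxy hyx hLx
    rw [indicator_of_mem (by exact hLx), ← ENNReal.mul_rpow_of_nonneg _ _ hq0, two_mul]
    exact ENNReal.rpow_le_rpow (hxy.trans (by gcongr)) hq0
  by_cases hmax : L < max ‖a‖ₑ ‖b‖ₑ
  · refine le_trans ?_ le_self_add
    rcases le_total ‖b‖ₑ ‖a‖ₑ with hab | hab
    · rw [max_eq_left hab] at hmax
      exact (hmain _ _ enorm_sub_le hab hmax).trans (by gcongr; exact le_self_add)
    · rw [max_eq_right hab] at hmax
      refine (hmain _ _ ?_ hab hmax).trans (by gcongr; exact le_add_self)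
      rw [add_comm]; exact enorm_sub_le
  · rw [not_lt, max_le_iff] at hmax
    refine le_trans ?_ le_add_self
    have e : ‖a - b‖ₑ ^ q = ‖a - b‖ₑ ^ (q - 1) * ‖a - b‖ₑ := by
      conv_rhs => rw [← ENNReal.rpow_one ‖a - b‖ₑ, ← ENNReal.rpow_mul]
      rw [← ENNReal.rpow_add_of_nonneg _ _ (by linarith) zero_le_one]
      congr 1; ring
    rw [e]
    refine mul_le_mul' (ENNReal.rpow_le_rpow ?_ (by linarith)) le_rfl
    rw [two_mul]
    exact enorm_sub_le.trans (add_le_add hmax.1 hmax.2)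

omit [MetricSpace X] in
theorem lintegral_enorm_sub_rpow_le {m : Measure X} {v w : X → ℝ} (hv : AEMeasurable v m)
    (hw : AEMeasurable w m) (hq : 1 ≤ q) (L : ℝ≥0∞) :
    ∫⁻ x, ‖v x - w x‖ₑ ^ q ∂m ≤
      2 ^ q * ((∫⁻ x in {x | L < ‖v x‖ₑ}, ‖v x‖ₑ ^ q ∂m) +
        ∫⁻ x in {x | L < ‖w x‖ₑ}, ‖w x‖ₑ ^ q ∂m) +
      (2 * L) ^ (q - 1) * ∫⁻ x, ‖v x - w x‖ₑ ∂m := by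
  have hmeas : ∀ {f : X → ℝ}, AEMeasurable f m →
      AEMeasurable (fun x => (Ioi L).indicator (fun t : ℝ≥0∞ => t ^ q) ‖f x‖ₑ) m := fun hf =>
    ((measurable_id.pow_const q).indicator measurableSet_Ioi).comp_aemeasurable hf.enorm
  have hset : ∀ {f : X → ℝ}, AEMeasurable f m →
      ∫⁻ x, (Ioi L).indicator (fun t : ℝ≥0∞ => t ^ q) ‖f x‖ₑ ∂m =
        ∫⁻ x in {x | L < ‖f x‖ₑ}, ‖f x‖ₑ ^ q ∂m := fun {f} hf => by
    rw [← lintegral_indicator₀ (nullMeasurableSet_lt aemeasurable_const hf.enorm)]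
    rfl
  refine (lintegral_mono fun x => enorm_sub_rpow_le hq (L := L)).trans (le_of_eq ?_)
  have hsub : AEMeasurable (fun x => ‖v x - w x‖ₑ) m := (hv.sub hw).enorm
  rw [lintegral_add_right' _ (hsub.const_mul _),
    lintegral_const_mul' _ _ (ENNReal.rpow_ne_top_of_nonneg (by linarith) (by norm_num)),
    lintegral_add_left' (hmeas hv),
    hset hv, hset hw, lintegral_const_mul'' _ hsub]

/-- The tail bound carries the factor `Theta R ^ q`, so a small `R` makes the tails uniformly small
at high levels. Nets in `L^1` come from the weak-type argument, as `1 ≤ p < q`. -/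
theorem embedsCompactly_of_truncation [OpensMeasurableSpace X]
    (h : BallConditions μ ν E K D ρ R₀) (hE : NullMeasurableSet E ν) (hEtb : TotallyBounded E)
    (hp : 1 ≤ p) (hpq : p < q) (hτ : 0 < τ)
    (hN : N = targetNorm μ ν E p G ∨ N = domainNorm μ p G)
    (hYint : ∀ u ∈ Y, IntegrableOnBalls μ u) (hYG : ∀ u ∈ Y, AEMeasurable (G u) μ)
    (hYP : ∀ u ∈ Y, PoincarePair μ E R₀ α p τ 1 u (G u))
    (hYT : ∀ u ∈ Y, TruncationPairs μ E R₀ α p τ C u (G u))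
    (hΘ : Tendsto (fun r : ℝ => Theta μ ν E α p q τ r) (𝓝[>] 0) (𝓝 0)) :
    EmbedsCompactly μ ν E Y N q := by
  have hp0 : 0 < p := by linarith
  have hq1 : 1 < q := hp.trans_lt hpq
  have hq : 0 < q := by linarith
  obtain ⟨C₁, R₁, hR₁, hR₁R₀, hW⟩ := h.exists_radialWeakType hp0 hpq hτ
  obtain ⟨R, hR, hRR₁, hΘR, -⟩ := exists_pos_le_Theta_ne_top hR₁ hΘ one_ne_zero
  have hae := fun u hu => ae_isLebesguePoint_realRep h hW hE (hYP u hu) hp0 hq hR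
    (hRR₁.trans hR₁R₀) hRR₁ hΘR
  have hm := fun u hu => aemeasurable_realRep h (hYint u hu) (hae u hu)
  refine embedsCompactly_of_finite_nets hq1.le hm
    (fun u hu => by filter_upwards [hae u hu] with x hx using hx.2.2)
    (fun u hu => lintegral_realRep_ne_top_of_truncation h hW hE hEtb hp0 hpq.le hR
      (hRR₁.trans hR₁R₀) hRR₁ hΘR (hYint u hu) (hYG u hu) (hYP u hu) (hYT u hu))
    fun u hu M hM0 hM huM ε hε hεt => ?_
  -- The first radius served only the qualitative statements; the new one depends on `ε` and `M`.
  -- The level `L` then depends on `R`, and the accuracy of the `L^1` net on `L`.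
  clear hΘR hRR₁ hR R
  have hε2 : ε / 2 ≠ 0 := ENNReal.div_ne_zero.2 ⟨hε, by norm_num⟩
  obtain ⟨R, hR, hRR₁, hΘR, hsmall⟩ : ∃ R, 0 < R ∧ R ≤ R₁ ∧ Theta μ ν E α p q τ R ≠ ⊤ ∧
      2 ^ q * (2 * (2 ^ q * (2 * (8 ^ q * (((C₁ * (K + K ^ 2) ^ q : ℝ≥0) : ℝ≥0∞) *
          (ENNReal.ofReal C * Theta μ ν E α p q τ R) ^ q) * M ^ q)))) ≤ ε / 2 := by
    set b : ℝ≥0∞ := 2 ^ q * (2 * (2 ^ q * (2 * (8 ^ q * (((C₁ * (K + K ^ 2) ^ q : ℝ≥0) : ℝ≥0∞) *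
          (ENNReal.ofReal C) ^ q) * M ^ q)))) with hb
    have hbt : b ≠ ⊤ := by
      have h1 : ∀ {x : ℝ≥0∞}, x ≠ ⊤ → x ^ q ≠ ⊤ := ENNReal.rpow_ne_top_of_nonneg hq.le
      have h2 := h1 (x := 2) (by norm_num)
      have h8 := h1 (x := 8) (by norm_num)
      have h3 := h1 (x := ENNReal.ofReal C) ENNReal.ofReal_ne_top
      have h4 := h1 hM
      exact ENNReal.mul_ne_top h2 (ENNReal.mul_ne_top (by norm_num) (ENNReal.mul_ne_top h2
        (ENNReal.mul_ne_top (by norm_num) (ENNReal.mul_ne_top (ENNReal.mul_ne_top h8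
          (ENNReal.mul_ne_top ENNReal.coe_ne_top h3)) h4))))
    have hlim : Tendsto (fun R : ℝ => b * Theta μ ν E α p q τ R ^ q) (𝓝[>] 0)
        (𝓝 (b * 0 ^ q)) :=
      ENNReal.Tendsto.const_mul ((ENNReal.continuous_rpow_const.tendsto _).comp hΘ) (Or.inr hbt)
    rw [ENNReal.zero_rpow_of_pos hq, mul_zero] at hlim
    obtain ⟨R, ⟨h1, h2⟩, h3⟩ := ((ENNReal.tendsto_nhds_zero.1 hlim _ (pos_iff_ne_zero.2 hε2)).and
      (hΘ.eventually (gt_mem_nhds zero_lt_one)) |>.and (Ioc_mem_nhdsGT hR₁)).exists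
    refine ⟨R, h3.1, h3.2, (h2.trans ENNReal.one_lt_top).ne, le_trans (le_of_eq ?_) h1⟩
    rw [ENNReal.mul_rpow_of_nonneg _ _ hq.le, hb]
    ring
  obtain ⟨B, hB, htail⟩ := exists_forall_lintegral_tail_le h hW hE hEtb hp0 hpq.le hR
    (hRR₁.trans hR₁R₀) hRR₁ hΘR hN hYint hYG hYP hYT
  set L : ℝ := (B * M).toReal + 1 with hL
  have hL0 : 0 < L := by positivity
  have hBL : B * M ≤ ENNReal.ofReal L := by
    rw [ENNReal.le_ofReal_iff_toReal_le (ENNReal.mul_ne_top hB hM) hL0.le, hL]; linarith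
  set d : ℝ≥0∞ := (2 * ENNReal.ofReal L) ^ (q - 1) with hd
  have hdt : d ≠ ⊤ := ENNReal.rpow_ne_top_of_nonneg (by linarith)
    (ENNReal.mul_ne_top (by norm_num) ENNReal.ofReal_ne_top)
  obtain ⟨T, hT⟩ := exists_finite_net_of_norm_le (q := 1) h hW hE hEtb hp0 one_pos hq1 hR₁ hR₁R₀
    hN hYint hYP hΘ hu hM0 hM huM (ε := ε / 2 / d) (ENNReal.div_ne_zero.2 ⟨hε2, hdt⟩)
  refine ⟨T, fun n => ?_⟩
  obtain ⟨k, hk, hnk⟩ := hT n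
  refine ⟨k, hk, (lintegral_enorm_sub_rpow_le (hm _ (hu n)) (hm _ (hu k)) hq1.le
    (ENNReal.ofReal L)).trans ?_⟩
  have h1 := htail _ (hu n) M hM0 hM (huM n) L hL0 hBL
  have h2 := htail _ (hu k) M hM0 hM (huM k) L hL0 hBL
  simp only [ENNReal.rpow_one] at hnk
  rw [← ENNReal.add_halves ε]
  refine add_le_add (le_trans ?_ hsmall) ?_
  · rw [two_mul (2 ^ q * _)]
    gcongr
  · refine (mul_le_mul' le_rfl hnk).trans ?_
    exact ENNReal.mul_div_le

end Embedding

end PoincareEmbedding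

/-! ### The main theorem. -/

theorem mainTheorem4 {X : Type*} [MetricSpace X] [MeasurableSpace X] [BorelSpace X]
    (μ ν : MeasureTheory.Measure X) (E : Set X)
    (hE : MeasureTheory.NullMeasurableSet E ν) (hνE : 0 < ν E) (hEtb : TotallyBounded E)
    (p q α r₀ τ : ℝ) (hp : 1 ≤ p) (hpq : p < q) (hα : 0 < α) (hr₀ : 0 < r₀) (hτ : 1 ≤ τ)
    (hdoubling : PoincareEmbedding.LocallyDoublingOn μ ν E r₀)
    (Y : Set (X → ℝ)) (hY : Y ⊆ PoincareEmbedding.poincareSobolev μ E r₀ α p τ)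
    (G : (X → ℝ) → (X → ℝ))
    (hG : ∀ u ∈ Y, PoincareEmbedding.IsPoincareGradient μ E r₀ α p τ u (G u))
    (N : (X → ℝ) → ENNReal)
    (hN : N = PoincareEmbedding.targetNorm μ ν E p G ∨ N = PoincareEmbedding.domainNorm μ p G) :
    (PoincareEmbedding.Theta μ ν E α p q τ r₀ < ⊤ →
      ∀ q' : ℝ, 1 ≤ q' → q' < q → PoincareEmbedding.EmbedsCompactly μ ν E Y N q') ∧
    (PoincareEmbedding.TruncationProperty μ E r₀ α p τ Y G →
      (PoincareEmbedding.Theta μ ν E α p q τ r₀ < ⊤ →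
        PoincareEmbedding.EmbedsBoundedly μ ν E Y N q) ∧
      (Filter.Tendsto (fun r : ℝ => PoincareEmbedding.Theta μ ν E α p q τ r)
          (nhdsWithin 0 (Set.Ioi 0)) (nhds 0) →
        PoincareEmbedding.EmbedsCompactly μ ν E Y N q)) := by
  open PoincareEmbedding in
  obtain ⟨K, D, ρ, h⟩ := hdoubling.exists_ballConditions hr₀
  have hp0 : 0 < p := by linarith
  have hτ0 : 0 < τ := by linarith
  have hYint : ∀ u ∈ Y, IntegrableOnBalls μ u := fun u hu => (hY hu).1
  have hYG : ∀ u ∈ Y, AEMeasurable (G u) μ := fun u hu => (hG u hu).1.1.aemeasurable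
  have henergy : ∀ u ∈ Y, ∫⁻ y, ‖G u y‖ₑ ^ p ∂μ ≠ ⊤ := fun u hu =>
    ne_top_of_le_ne_top (ENNReal.rpow_ne_top_of_nonneg hp0.le (hG u hu).1.2.ne)
      (lintegral_rpow_le_of_eLpNorm_le hp0 le_rfl)
  have hYP : ∀ u ∈ Y, PoincarePair μ E r₀ α p τ 1 u (G u) := fun u hu =>
    ⟨zero_le_one, fun x _ r _ _ => hYint u hu x r, (hG u hu).2, henergy u hu⟩
  refine ⟨fun hΘ q' hq' hq'q => ?_, ?_⟩
  -- The auxiliary exponent needs `p < s` for the radial weak-type bound, `q' < s` to integrate it,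
  -- and `s < q` to make `Theta` vanish at zero.
  · obtain ⟨s, hs1, hs2⟩ := exists_between (max_lt hpq hq'q)
    have hps := (le_max_left _ _).trans_lt hs1
    exact embedsCompactly_of_lt h hE hEtb hp0 hps hq' ((le_max_right _ _).trans_lt hs1) hτ0 hN
      hYint hYP (tendsto_Theta_of_lt h hEtb (hp0.trans hps) hs2 hΘ.ne)
  · rintro ⟨C, hC, hT⟩
    have hYT : ∀ u ∈ Y, TruncationPairs μ E r₀ α p τ C u (G u) := fun u hu =>
      (hYint u hu).truncationPairs h.doubling hr₀ hp0 hC.le (hT u hu) (henergy u hu)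
    exact ⟨fun hΘ => embedsBoundedly_of_truncation h hE hEtb hp0 hpq hτ0 hN hYint hYG hYP hYT hΘ.ne,
      embedsCompactly_of_truncation h hE hEtb hp hpq hτ0 hN hYint hYG hYP hYT⟩
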